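/- **Setting.** Let $L,T,\nu,\alpha,\beta,\eta,h,c_1,c_2>0$ and $\Omega=[0,L]^3$. For $s\in\mathbb R$ let $\dot H^s$ be the space of real mean-zero $L$-periodic vector fields (distributions, if $s<0$) $u=\sum_{K\in\mathbb Z^3\setminus\{0\}}\hat u_K e^{2\pi i K\cdot x/L}$, $\hat u_K\in\mathbb C^3$, with norm given by $\|u\|_{\dot H^s}^2=L^3\sum_K (2\pi|K|/L)^{2s}|\hat u_K|^2<\infty$. Let $\dot V_s=\{u\in\dot H^s:\nabla\cdot u=0\}$, $H=\dot V_0$, $V=\dot V_1$, $D(A)=\dot V_2$, $D(A)'=\dot V_{-2}$, and $\dot L^2=\dot H^0$. Let $\mathcal P$ be the Helmholtz–Leray projection, $A=-\Delta$, and $B(v,u)=\mathcal P[(v\cdot\nabla)u]$. The equations below are understood in $L^2(0,T;D(A)')$. Let $f\in L^\infty(0,T;H)$ and $u_0\in V$, and let $u$ be the regular solution of the modified Leray-$\alpha$ model $$\frac{dv}{dt}+\nu Av+B(v,u)=f,\qquad v=u+\alpha^2Au,\qquad u(0)=u_0,$$ that is, $u\in C([0,T);V)\cap L^2(0,T;D(A))$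 and $du/dt\in L^2(0,T;H)$. Let $I_h:\dot H^2(\Omega)\to\dot L^2(\Omega)$ be a linear operator such that $$\|I_hg-g\|_{L^2}^2\le c_1^2h^2\|\nabla g\|_{L^2}^2+c_2^2h^4\|\Delta g\|_{L^2}^2\qquad\text{for all } g\in\dot H^2(\Omega).$$ **Theorem (global well-posedness).** Assume $$\eta\le\frac{\nu}{2}\min\Big\{\frac1{c_1^2h^2},\frac{\beta^2}{c_2^2h^4}\Big\}\qquad\text{and}\qquad \eta^2c_2^2h^4<\frac{\nu^2}{4}.$$ Then for every $w_0\in V$ the data assimilation system $$\frac{dz}{dt}+\nu Az+B(z,w)=f-\eta(I+\beta^2A)\mathcal P(I_hw-I_hu),\qquad z=w+\beta^2Aw,\qquad w(0)=w_0,$$ has a unique solution $w\in C([0,T);V)\cap L^2(0,T;D(A))$ with $dw/dt\in L^2(0,T;H)$. Moreover, the solution depends continuously on $w_0$ in the $V$-norm: for every such solution $w$ there is a constant $C$ such that, for every $w_0'\in V$, the solution $w'$ with $w'(0)=w_0'$ satisfies $$\|w'(t)-w(t)\|_V\le C\,\|w_0'-w_0\|_V\qquad\text{for all } t\in[0,T).$$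 -/

import Mathlib

open MeasureTheory Set Filter Topology

noncomputable section

namespace MLAlpha

/-- A formal Fourier series `∑ K, û K * exp (2 π i K · x / L)` with coefficients in `ℂ³`: the family
of its coefficients, indexed by `K ∈ ℤ³` and by the component `i`. -/
abbrev Field : Type := (Fin 3 → ℤ) → Fin 3 → ℂ

/-- `λ_K = 4 π² |K|² / L²`, the eigenvalue of `-Δ` at the frequency `K`. -/
def eig (L : ℝ) (K : Fin 3 → ℤ) : ℝ := 4 * Real.pi ^ 2 / L ^ 2 * ∑ i, (K i : ℝ) ^ 2

/-- The `K`-th term `(2 π |K| / L)^(2 s) |û K|²` of the squared Sobolev norm of order `s`. -/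
def sobTerm (L s : ℝ) (u : Field) (K : Fin 3 → ℤ) : ℝ := eig L K ^ s * ∑ i, ‖u K i‖ ^ 2

lemma eig_nonneg (L : ℝ) (K : Fin 3 → ℤ) : 0 ≤ eig L K := by
  unfold eig
  positivity

lemma sobTerm_nonneg (L s : ℝ) (u : Field) (K : Fin 3 → ℤ) : 0 ≤ sobTerm L s u K := by
  have := Real.rpow_nonneg (eig_nonneg L K) s
  unfold sobTerm
  positivity

lemma sobTerm_add_le (L s : ℝ) (u v : Field) (K : Fin 3 → ℤ) :
    sobTerm L s (u + v) K ≤ 2 * sobTerm L s u K + 2 * sobTerm L s v K := by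
  have h0 := Real.rpow_nonneg (eig_nonneg L K) s
  have h1 : ∑ i, ‖(u + v) K i‖ ^ 2 ≤ 2 * ∑ i, ‖u K i‖ ^ 2 + 2 * ∑ i, ‖v K i‖ ^ 2 := by
    rw [Finset.mul_sum, Finset.mul_sum, ← Finset.sum_add_distrib]
    refine Finset.sum_le_sum fun i _ => ?_
    have h2 : ‖(u + v) K i‖ ≤ ‖u K i‖ + ‖v K i‖ := norm_add_le _ _
    nlinarith [norm_nonneg ((u + v) K i), sq_nonneg (‖u K i‖ - ‖v K i‖)]
  have h3 := mul_le_mul_of_nonneg_left h1 h0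
  unfold sobTerm
  linarith

/-- `Ḣ^s`: real-valued, mean-zero, `L`-periodic vector fields on `ℝ³` of Sobolev order `s`
(the Fourier series may be a distribution when `s < 0`). `Ḣ^0` is the mean-zero part of `L²`. -/
def Hdot (L s : ℝ) : Submodule ℝ Field where
  carrier := {u | u 0 = 0 ∧ (∀ K i, (starRingEnd ℂ) (u K i) = u (-K) i) ∧
    Summable (sobTerm L s u)}
  zero_mem' := by
    refine ⟨rfl, fun K i => by simp, ?_⟩
    have : sobTerm L s 0 = 0 := by
      funext K
      simp [sobTerm]
    rw [this]
    exact summable_zero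
  add_mem' := by
    rintro u v ⟨hu0, hu1, hu2⟩ ⟨hv0, hv1, hv2⟩
    refine ⟨by simp [hu0, hv0], fun K i => by simp [hu1, hv1], ?_⟩
    exact Summable.of_nonneg_of_le (sobTerm_nonneg L s _) (sobTerm_add_le L s u v)
      ((hu2.mul_left 2).add (hv2.mul_left 2))
  smul_mem' := by
    rintro c u ⟨hu0, hu1, hu2⟩
    refine ⟨by simp [hu0], fun K i => by simp [hu1], ?_⟩
    have : sobTerm L s (c • u) = fun K => c ^ 2 * sobTerm L s u K := by
      funext K
      simp only [sobTerm, Pi.smul_apply, norm_smul, mul_pow, ← Finset.mul_sum, Real.norm_eq_abs,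
        sq_abs]
      ring
    rw [this]
    exact hu2.mul_left _

/-- `V̇_s`: the divergence-free fields in `Ḣ^s`. In particular `H = V̇_0`, `V = V̇_1`,
`D(A) = V̇_2` and `D(A)' = V̇_{-2}`. -/
def Vdot (L s : ℝ) : Submodule ℝ Field where
  carrier := {u | u ∈ Hdot L s ∧ ∀ K, ∑ i, (K i : ℂ) * u K i = 0}
  zero_mem' := ⟨Submodule.zero_mem _, fun K => by simp⟩
  add_mem' := by
    rintro u v ⟨hu, hu'⟩ ⟨hv, hv'⟩
    refine ⟨Submodule.add_mem _ hu hv, fun K => ?_⟩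
    simp [mul_add, Finset.sum_add_distrib, hu', hv']
  smul_mem' := by
    rintro c u ⟨hu, hu'⟩
    refine ⟨Submodule.smul_mem _ c hu, fun K => ?_⟩
    have : ∑ i, (K i : ℂ) * (c • u) K i = (c : ℂ) * ∑ i, (K i : ℂ) * u K i := by
      rw [Finset.mul_sum]
      refine Finset.sum_congr rfl fun i _ => ?_
      simp
      ring
    rw [this, hu', mul_zero]

/-- The norm of `Ḣ^s` and `V̇_s`: its square is `L³ ∑ (2 π |K| / L)^(2 s) |û K|²`. By Parseval, for
`s = 0, 1, 2` this is the norm in `L²([0,L]³)` of `u`, `∇u`, `Δu` respectively. -/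
def sobNorm (L s : ℝ) (u : Field) : ℝ := Real.sqrt (L ^ 3 * ∑' K, sobTerm L s u K)

/-- The Stokes operator `A`, that is `-Δ` on periodic fields. -/
def stokes (L : ℝ) (u : Field) : Field := fun K i => (eig L K : ℂ) * u K i

/-- `(I + a² A) u`. -/
def helmholtz (L a : ℝ) (u : Field) : Field := u + a ^ 2 • stokes L u

/-- The Helmholtz-Leray projection onto mean-zero divergence-free fields. -/
def leray (u : Field) : Field := fun K i =>
  if K = 0 then 0 else u K i - (K i : ℂ) * (∑ j, u K j * (K j : ℂ)) / (∑ j, (K j : ℂ) ^ 2)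

/-- The Haar probability measure of the torus `(ℝ/ℤ)³`. -/
abbrev torusMeasure : Measure (UnitAddTorus (Fin 3)) := Measure.pi fun _ => AddCircle.haarAddCircle

/-- The square-integrable function `y ↦ ∑ K, c K * exp (2 π i K · y)` on the torus `(ℝ/ℤ)³`, for
square-summable coefficients `c`: the series converges in `L²`, and its sum is `0` by convention if
`c` is not square-summable. A function `g` of period `L` is represented by `y ↦ g (L y)`, which has
the same Fourier coefficients as `g`. -/
def synth (c : (Fin 3 → ℤ) → ℂ) : Lp ℂ 2 torusMeasure :=
  ∑' K, c K • UnitAddTorus.mFourierLp 2 K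

/-- The Fourier coefficients of `∂_j g` for a scalar function `g` with coefficients `c`. -/
def partialCoeff (L : ℝ) (j : Fin 3) (c : (Fin 3 → ℤ) → ℂ) : (Fin 3 → ℤ) → ℂ := fun K =>
  2 * Real.pi * Complex.I * (K j : ℂ) / L * c K

/-- `(v · ∇) u = ∑ j, v_j ∂_j u`: the Fourier coefficients of the pointwise product, which is an
integrable function when `v` and `∇u` are in `L²`. -/
def advection (L : ℝ) (v u : Field) : Field := fun K i =>
  UnitAddTorus.mFourierCoeff
    (fun y => ∑ j, synth (fun J => v J j) y * synth (partialCoeff L j fun J => u J i) y) K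

/-- `B(v, u) = P[(v · ∇) u]`. -/
def bilin (L : ℝ) (v u : Field) : Field := leray (advection L v u)

/-- Measurability on `(0, T)` of a time-dependent field. For functions with values in one of the
separable Hilbert spaces `V̇_s` this is strong measurability, by Pettis' theorem. -/
def TimeMeasurable (T : ℝ) (g : ℝ → Field) : Prop :=
  ∀ K i, AEMeasurable (fun t => g t K i) (volume.restrict (Ioo 0 T))

/-- `g ∈ L²(0, T; V̇_s)`. -/
def MemL2 (L T s : ℝ) (g : ℝ → Field) : Prop :=
  TimeMeasurable T g ∧ (∀ᵐ t ∂volume.restrict (Ioo 0 T), g t ∈ Vdot L s) ∧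
    IntegrableOn (fun t => sobNorm L s (g t) ^ 2) (Ioo 0 T)

/-- `g ∈ L^∞(0, T; V̇_s)`. -/
def MemLinfty (L T s : ℝ) (g : ℝ → Field) : Prop :=
  TimeMeasurable T g ∧ (∀ᵐ t ∂volume.restrict (Ioo 0 T), g t ∈ Vdot L s) ∧
    ∃ M : ℝ, ∀ᵐ t ∂volume.restrict (Ioo 0 T), sobNorm L s (g t) ≤ M

/-- `u ∈ C([0, T); V̇_s)`. -/
def MemC (L T s : ℝ) (u : ℝ → Field) : Prop :=
  ∀ t ∈ Ico 0 T, u t ∈ Vdot L s ∧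
    Tendsto (fun τ => sobNorm L s (u τ - u t)) (𝓝[Ico 0 T] t) (𝓝 0)

/-- `du/dt = g` on `[0, T)`, where `g` is in some `L²(0, T; V̇_s)`: `u` is a primitive of `g`,
i.e. `u` is absolutely continuous in time and its derivative is `g`. -/
def HasTimeDeriv (T : ℝ) (u g : ℝ → Field) : Prop :=
  ∀ s t, 0 ≤ s → s ≤ t → t < T → ∀ K i, u t K i - u s K i = ∫ τ in s..t, g τ K i

/-- `u ∈ C([0, T); V) ∩ L²(0, T; D(A))`, `du/dt ∈ L²(0, T; H)` and `u(0) = u₀`. -/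
structure IsRegular (L T : ℝ) (u₀ : Field) (u : ℝ → Field) : Prop where
  continuous : MemC L T 1 u
  memL2 : MemL2 L T 2 u
  deriv : ∃ u' : ℝ → Field, MemL2 L T 0 u' ∧ HasTimeDeriv T u u'
  initial : u 0 = u₀

/-- `u` is a regular solution of the modified Leray-`α` model
`dv/dt + ν A v + B(v, u) = f`, `v = u + α² A u`, `u(0) = u₀`;
the equation is an equality in `L²(0, T; D(A)')`. -/
def IsMLAlphaSolution (L T ν α : ℝ) (f : ℝ → Field) (u₀ : Field) (u : ℝ → Field) : Prop :=
  IsRegular L T u₀ u ∧ ∃ v' : ℝ → Field, MemL2 L T (-2) v' ∧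
    HasTimeDeriv T (fun t => helmholtz L α (u t)) v' ∧
    ∀ᵐ t ∂volume.restrict (Ioo 0 T),
      v' t + ν • stokes L (helmholtz L α (u t)) + bilin L (helmholtz L α (u t)) (u t) = f t

/-- `I_h g` for `g ∈ Ḣ²` (and `0` for other `g`). -/
def interp {L : ℝ} (Ih : Hdot L 2 →ₗ[ℝ] Hdot L 0) (g : Field) : Field :=
  open Classical in if hg : g ∈ Hdot L 2 then (Ih ⟨g, hg⟩ : Field) else 0

/-- `‖I_h g - g‖²_{L²} ≤ c₁² h² ‖∇g‖²_{L²} + c₂² h⁴ ‖Δg‖²_{L²}` for all `g ∈ Ḣ²`. -/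
def ApproximationProperty {L : ℝ} (h c₁ c₂ : ℝ) (Ih : Hdot L 2 →ₗ[ℝ] Hdot L 0) : Prop :=
  ∀ g : Hdot L 2, sobNorm L 0 ((Ih g : Field) - (g : Field)) ^ 2 ≤
    c₁ ^ 2 * h ^ 2 * sobNorm L 1 (g : Field) ^ 2 + c₂ ^ 2 * h ^ 4 * sobNorm L 2 (g : Field) ^ 2

/-- `w` is a regular solution of the data assimilation system
`dz/dt + ν A z + B(z, w) = f - η (I + β² A) P (I_h w - I_h u)`, `z = w + β² A w`, `w(0) = w₀`;
the equation is an equality in `L²(0, T; D(A)')`. -/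
def IsNudgedSolution (L T ν β η : ℝ) (Ih : Hdot L 2 →ₗ[ℝ] Hdot L 0) (f u : ℝ → Field)
    (w₀ : Field) (w : ℝ → Field) : Prop :=
  IsRegular L T w₀ w ∧ ∃ z' : ℝ → Field, MemL2 L T (-2) z' ∧
    HasTimeDeriv T (fun t => helmholtz L β (w t)) z' ∧
    ∀ᵐ t ∂volume.restrict (Ioo 0 T),
      z' t + ν • stokes L (helmholtz L β (w t)) + bilin L (helmholtz L β (w t)) (w t) =
        f t - η • helmholtz L β (leray (interp Ih (w t) - interp Ih (u t)))

end MLAlpha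

end

/-! # Well-posedness of a data assimilation system for the modified Leray-α model

**Reduction.** Fields are identified with their Fourier coefficients, and all Sobolev spaces `V̇_s`
with one Hilbert space `H` (`Hsp`, a closed subspace of `ℓ²`), through the powers of `A`. Since
`(I + β² A)` commutes with `A`, applying its inverse to the system turns it into the equation
`dw/dt + ν A w + η P I_h w + (I + β² A)⁻¹ B((I + β² A) w, w) = g` in `H`, where
`g = (I + β² A)⁻¹ f + η P I_h u` is square integrable in time. In the variables `y = A w` and
`x = A^(1/2) w` all operators in it are bounded: `P I_h A⁻¹` by the approximation property
(`interpOp`), and the advection term, a bilinear map in `(y, x)`, because the Fourier coefficients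
of a product of square-integrable functions are bounded and `∑ λ_K⁻² < ∞` in three dimensions
(`advect`). The equivalence of the two formulations is `equation_iff` at a fixed time, and
`IsNudgedSolution.evol` and `Evol.isNudgedSolution` for curves.

**Estimates.** The equation is tested with `(I + β² A) w`. The advection term then drops out,
because the transport velocity is divergence free (`inner_advect_self`). The condition
`η c₂ h² < ν / 2` lets viscosity absorb the highest-order part of the interpolation error
(`coercive`), and Gronwall's inequality gives a bound in `L^∞(V) ∩ L²(D(A))` (`Evol.energy_bound`).
For the difference of two solutions one advection term remains, `⟨B(z, w), d⟩` with
`z = (I + β² A) d`, where `d` is the difference. It is at most `C ‖A d‖ ‖A w‖ ‖A^(1/2) d‖` by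
Cauchy-Schwarz on the frequency side (`tsum_conv_sq_le`, `abs_inner_advect_le`), and `‖A w‖²` is
integrable in time, so Gronwall's inequality gives uniqueness and Lipschitz dependence on the
initial value (`Evol.stability`).

**Existence.** The frequencies of the transport velocity are cut off at `n`, and the advection term
is truncated where `‖x‖` is large; it is then globally Lipschitz in `x`. The linear problem is
solved mode by mode (`exists_evol_linear`), and the truncated one by the contraction principle
(`exists_evol_semilinear`), where `η c₂ h² < ν / 2` is used again: the interpolation term is
Lipschitz in `A w` with a constant below `ν`, the bound of maximal regularity. The energy estimate
does not see the truncation, which is therefore inactive (`exists_evol_mollified`). The constant in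
the trilinear estimate tends to zero when the transport velocity has only high frequencies
(`tendsto_convWeight`), so the solutions with cutoff form a Cauchy sequence in
`C([0, T]; V) ∩ L²(0, T; D(A))` (`mollified_cauchy`). Its limit is the solution (`exists_evol`). No
compactness argument is needed. -/

noncomputable section

namespace MLAlpha

open scoped ENNReal NNReal Interval

/-! ### Convolution in weighted `ℓ²` -/

/-- Cauchy-Schwarz for sums in `[0, ∞]`. -/
lemma ENNReal_tsum_mul_sq_le {ι : Type*} (f g : ι → ℝ≥0∞) :
    (∑' i, f i * g i) ^ 2 ≤ (∑' i, f i ^ 2) * ∑' i, g i ^ 2 := by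
  let _ : MeasurableSpace ι := ⊤
  have h := ENNReal.lintegral_mul_le_Lp_mul_Lq (Measure.count : Measure ι)
    Real.HolderConjugate.two_two (f := f) (g := g)
    (Measurable.aemeasurable (fun _ _ => trivial)) (Measurable.aemeasurable (fun _ _ => trivial))
  rw [lintegral_count, lintegral_count, lintegral_count] at h
  simp only [Pi.mul_apply, ENNReal.rpow_two] at h
  calc (∑' i, f i * g i) ^ 2 ≤
        ((∑' i, f i ^ 2) ^ (1 / 2 : ℝ) * (∑' i, g i ^ 2) ^ (1 / 2 : ℝ)) ^ 2 := by gcongr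
    _ = _ := by
        rw [mul_pow, ← ENNReal.rpow_natCast, ← ENNReal.rpow_natCast, ← ENNReal.rpow_mul,
          ← ENNReal.rpow_mul]
        norm_num

section Conv
variable {G : Type*} [AddCommGroup G]

/-- The convolution `∑ M, ω(M)⁻¹ ω(J + M)⁻¹`. -/
def convWeight (ω : G → ℝ≥0∞) (J : G) : ℝ≥0∞ := ∑' M, (ω M)⁻¹ * (ω (J + M))⁻¹

lemma tsum_shift (f : G → ℝ≥0∞) (J : G) : ∑' M, f (J + M) = ∑' M, f M :=
  (Equiv.addLeft J).tsum_eq f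

lemma convWeight_le (ω : G → ℝ≥0∞) (J : G) : convWeight ω J ≤ ∑' M, (ω M)⁻¹ ^ 2 := by
  have h := ENNReal_tsum_mul_sq_le (fun M => (ω M)⁻¹) (fun M => (ω (J + M))⁻¹)
  rw [tsum_shift (fun M => (ω M)⁻¹ ^ 2) J, ← sq] at h
  exact (ENNReal.pow_le_pow_left_iff two_ne_zero).1 h

/-- The trilinear form `∑ a(J) b(M) c(J + M)` is bounded on `ℓ²(convWeight ω) × ℓ²(ω) × ℓ²(ω)`.
This is Cauchy-Schwarz on pairs `(J, M)`, with the weights `√ω(M)` and `√ω(J + M)` moved onto `b`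
and `c`. -/
lemma tsum_conv_sq_le (ω : G → ℝ≥0∞) (h0 : ∀ M, ω M ≠ 0) (h1 : ∀ M, ω M ≠ ∞)
    (a b c : G → ℝ≥0∞) :
    (∑' J, ∑' M, a J * b M * c (J + M)) ^ 2 ≤
      (∑' J, a J ^ 2 * convWeight ω J) * ((∑' M, ω M * b M ^ 2) * ∑' M, ω M * c M ^ 2) := by
  have hs : ∀ M, (ω M ^ (1 / 2 : ℝ))⁻¹ * ω M ^ (1 / 2 : ℝ) = 1 := fun M =>
    ENNReal.inv_mul_cancel (by simp [h0, h1]) (by simp [h0, h1])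
  have hsq : ∀ M, (ω M ^ (1 / 2 : ℝ)) ^ 2 = ω M := fun M => by
    rw [← ENNReal.rpow_natCast, ← ENNReal.rpow_mul]; norm_num
  generalize hr : (fun M => ω M ^ (1 / 2 : ℝ)) = r at *
  have hs : ∀ M, (r M)⁻¹ * r M = 1 := by rw [← hr]; exact hs
  have hsq : ∀ M, r M ^ 2 = ω M := by rw [← hr]; exact hsq
  have h := ENNReal_tsum_mul_sq_le
    (fun p : G × G => a p.1 * ((r p.2)⁻¹ * (r (p.1 + p.2))⁻¹))
    (fun p : G × G => (r p.2 * b p.2) * (r (p.1 + p.2) * c (p.1 + p.2)))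
  have e1 : ∀ p : G × G, a p.1 * ((r p.2)⁻¹ * (r (p.1 + p.2))⁻¹) *
      ((r p.2 * b p.2) * (r (p.1 + p.2) * c (p.1 + p.2))) = a p.1 * b p.2 * c (p.1 + p.2) := by
    intro p
    calc _ = ((r p.2)⁻¹ * r p.2) * ((r (p.1 + p.2))⁻¹ * r (p.1 + p.2)) *
          (a p.1 * b p.2 * c (p.1 + p.2)) := by ring
      _ = _ := by rw [hs, hs]; simp
  have e2 : ∑' p : G × G, (a p.1 * ((r p.2)⁻¹ * (r (p.1 + p.2))⁻¹)) ^ 2 =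
      ∑' J, a J ^ 2 * convWeight ω J := by
    rw [ENNReal.tsum_prod']
    refine tsum_congr fun J => ?_
    rw [convWeight, ← ENNReal.tsum_mul_left]
    refine tsum_congr fun M => ?_
    simp only [mul_pow, ← ENNReal.inv_pow, hsq]
  have e3 : ∑' p : G × G, ((r p.2 * b p.2) * (r (p.1 + p.2) * c (p.1 + p.2))) ^ 2 =
      (∑' M, ω M * b M ^ 2) * ∑' M, ω M * c M ^ 2 := by
    rw [ENNReal.tsum_prod', ENNReal.tsum_comm, ← ENNReal.tsum_mul_right]
    refine tsum_congr fun M => ?_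
    simp only [mul_pow, hsq]
    rw [ENNReal.tsum_mul_left]
    congr 1
    simp only [add_comm _ M]
    exact tsum_shift (fun M => ω M * c M ^ 2) M
  rw [e2, e3, tsum_congr e1, ENNReal.tsum_prod'] at h
  exact h

/-- `convWeight ω` vanishes at infinity when `ω⁻¹` is square summable: for all but finitely many
`J`, at least one of `M` and `J + M` lies outside a given finite set, so that Cauchy-Schwarz bounds
each of the two contributions by a tail of `∑ ω⁻²`. -/
lemma tendsto_convWeight (ω : G → ℝ≥0∞)
    (hω : ∑' M, (ω M)⁻¹ ^ 2 ≠ ∞) : Tendsto (convWeight ω) cofinite (𝓝 0) := by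
  classical
  set g : G → ℝ≥0∞ := fun M => (ω M)⁻¹ with hg
  set S := ∑' M, g M ^ 2 with hS
  let tl : Finset G → G → ℝ≥0∞ := fun s M => if M ∈ s then 0 else g M
  have htail : Tendsto (fun s : Finset G => ∑' M, tl s M ^ 2) atTop (𝓝 0) := by
    have h := ENNReal.tendsto_tsum_compl_atTop_zero hω
    refine h.congr fun s => ?_
    rw [← tsum_subtype_eq_of_support_subset (f := fun M => tl s M ^ 2) (s := {M | M ∉ s})]
    · refine tsum_congr fun M => ?_
      have hM : (M : G) ∉ s := M.2
      simp [tl, hM]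
    · intro M hM
      by_contra h'
      simp only [Set.mem_ofPred_eq, not_not] at h'
      simp [tl, h'] at hM
  have hkey : ∀ s : Finset G, ∀ᶠ J in cofinite,
      convWeight ω J ≤ 2 * ((∑' M, tl s M ^ 2) * S) ^ (1 / 2 : ℝ) := by
    intro s
    have hfin : ∀ᶠ J in cofinite, ∀ M, M ∈ s → J + M ∉ s := by
      refine (((s ×ˢ s).image fun p => p.2 - p.1).finite_toSet).subset ?_
      intro J hJ
      simp only [Set.mem_compl_iff, Set.mem_ofPred_eq, not_forall, not_not] at hJ
      obtain ⟨M, hM, hJM⟩ := hJ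
      simp only [Finset.coe_image, Set.mem_image, Finset.mem_coe, Finset.mem_product]
      exact ⟨(M, J + M), ⟨hM, hJM⟩, by simp⟩
    filter_upwards [hfin] with J hJ
    have hcs : ∀ a b : G → ℝ≥0∞, ∑' M, a M * b M ≤
        ((∑' M, a M ^ 2) * ∑' M, b M ^ 2) ^ (1 / 2 : ℝ) := by
      intro a b
      have h := ENNReal_tsum_mul_sq_le a b
      calc ∑' M, a M * b M = ((∑' M, a M * b M) ^ 2) ^ (1 / 2 : ℝ) := by
            rw [← ENNReal.rpow_natCast, ← ENNReal.rpow_mul]; norm_num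
        _ ≤ _ := by gcongr
    have h1 := hcs (tl s) (fun M => g (J + M))
    have h2 := hcs (fun M => tl s (J + M)) g
    rw [tsum_shift (fun M => g M ^ 2) J] at h1
    rw [tsum_shift (fun M => tl s M ^ 2) J] at h2
    calc convWeight ω J ≤ ∑' M, (tl s M * g (J + M) + tl s (J + M) * g M) := by
          refine ENNReal.tsum_le_tsum fun M => ?_
          by_cases hM : M ∈ s
          · simp [tl, hJ M hM, hg, mul_comm]
          · simp [tl, hM, hg]
      _ = ∑' M, tl s M * g (J + M) + ∑' M, tl s (J + M) * g M := ENNReal.tsum_add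
      _ ≤ _ := by
          rw [two_mul]
          exact add_le_add h1 h2
  rw [ENNReal.tendsto_nhds_zero]
  intro ε hε
  have h1 : Tendsto (fun s : Finset G => 2 * ((∑' M, tl s M ^ 2) * S) ^ (1 / 2 : ℝ)) atTop
      (𝓝 0) := by
    have h2 : Tendsto (fun s : Finset G => (∑' M, tl s M ^ 2) * S) atTop (𝓝 0) := by
      simpa using ENNReal.Tendsto.mul_const htail (Or.inr hω)
    have h3 := (ENNReal.continuous_rpow_const (y := (1 / 2 : ℝ))).tendsto 0 |>.comp h2
    rw [ENNReal.zero_rpow_of_pos (by norm_num)] at h3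
    simpa using ENNReal.Tendsto.const_mul h3 (Or.inr (by norm_num : (2 : ℝ≥0∞) ≠ ∞))
  obtain ⟨s, hs⟩ := ((ENNReal.tendsto_nhds_zero.1 h1) ε hε).exists
  exact (hkey s).mono fun J hJ => hJ.trans hs
end Conv

/-! ### Eigenvalues of the Stokes operator -/

lemma eig_pos {L : ℝ} (hL : 0 < L) {K : Fin 3 → ℤ} (hK : K ≠ 0) : 0 < eig L K := by
  obtain ⟨i, hi⟩ := Function.ne_iff.1 hK
  have : 0 < ∑ i, (K i : ℝ) ^ 2 := by
    refine Finset.sum_pos' (fun _ _ => sq_nonneg _) ⟨i, Finset.mem_univ i, ?_⟩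
    have : (K i : ℝ) ≠ 0 := by exact_mod_cast hi
    positivity
  unfold eig
  positivity

/-- The eigenvalue `eig L K`, replaced by `1` at `K = 0`, where mean-zero fields have no component;
so it is positive. -/
def lam (L : ℝ) (K : Fin 3 → ℤ) : ℝ := if K = 0 then 1 else eig L K

lemma lam_pos {L : ℝ} (hL : 0 < L) (K : Fin 3 → ℤ) : 0 < lam L K := by
  unfold lam
  split_ifs with h
  · exact one_pos
  · exact eig_pos hL h

lemma eig_neg (L : ℝ) (K : Fin 3 → ℤ) : eig L (-K) = eig L K := by simp [eig]

lemma lam_neg (L : ℝ) (K : Fin 3 → ℤ) : lam L (-K) = lam L K := by simp [lam, eig_neg]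

lemma lam_of_ne {L : ℝ} {K : Fin 3 → ℤ} (h : K ≠ 0) : lam L K = eig L K := if_neg h

/-- A positive lower bound of all eigenvalues. -/
def lamMin (L : ℝ) : ℝ := min 1 (4 * Real.pi ^ 2 / L ^ 2)

lemma lamMin_pos {L : ℝ} (hL : 0 < L) : 0 < lamMin L := by
  unfold lamMin
  positivity

lemma lamMin_le {L : ℝ} (hL : 0 < L) (K : Fin 3 → ℤ) : lamMin L ≤ lam L K := by
  unfold lamMin lam
  split_ifs with h
  · exact min_le_left _ _
  · refine (min_le_right _ _).trans ?_
    obtain ⟨i, hi⟩ := Function.ne_iff.1 h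
    have h1 : (1 : ℝ) ≤ (K i : ℝ) ^ 2 := by
      have : 1 ≤ (K i) ^ 2 := by
        have := sq_pos_of_ne_zero (a := K i) hi
        omega
      exact_mod_cast this
    have h2 : (K i : ℝ) ^ 2 ≤ ∑ i, (K i : ℝ) ^ 2 :=
      Finset.single_le_sum (f := fun i => (K i : ℝ) ^ 2) (fun _ _ => sq_nonneg _)
        (Finset.mem_univ i)
    unfold eig
    exact le_mul_of_one_le_right (by positivity) (h1.trans h2)

lemma norm_int_sq_le (K : Fin 3 → ℤ) : ‖fun i => (K i : ℝ)‖ ^ 2 ≤ ∑ i, (K i : ℝ) ^ 2 := by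
  refine (Real.le_sqrt (norm_nonneg _) (by positivity)).1 ?_
  rw [pi_norm_le_iff_of_nonneg (Real.sqrt_nonneg _)]
  intro i
  rw [Real.norm_eq_abs]
  refine Real.abs_le_sqrt ?_
  exact Finset.single_le_sum (f := fun i => (K i : ℝ) ^ 2) (fun _ _ => sq_nonneg _)
    (Finset.mem_univ i)

/-- The lattice sum `∑ |K|⁻⁴` over `ℤ³` converges, because `4 > 3`. The term at `K = 0` is the
junk value `0⁻¹ = 0`. -/
lemma summable_norm_int_inv_pow : Summable fun K : Fin 3 → ℤ => (‖fun i => (K i : ℝ)‖⁻¹) ^ 4 := by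
  generalize hb : Pi.basisFun ℝ (Fin 3) = b
  have hfr : Module.finrank ℤ (Submodule.span ℤ (Set.range b)) < 4 := by
    have h1 := finrank_range_le_card (R := ℤ) b
    have h2 : Fintype.card (Fin 3) = 3 := by simp
    have h3 : (Set.range b).finrank ℤ = Module.finrank ℤ (Submodule.span ℤ (Set.range b)) := rfl
    omega
  have h := ZLattice.summable_norm_pow_inv (L := Submodule.span ℤ (Set.range b)) 4 hfr
  have hm : ∀ K : Fin 3 → ℤ, (fun i => (K i : ℝ)) ∈ Submodule.span ℤ (Set.range b) := by
    intro K
    rw [Module.Basis.mem_span_iff_repr_mem]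
    intro i
    exact ⟨K i, by simp [← hb]⟩
  let e : (Fin 3 → ℤ) → Submodule.span ℤ (Set.range b) := fun K => ⟨fun i => (K i : ℝ), hm K⟩
  have hinj : Function.Injective e := by
    intro K K' hK
    funext i
    have h2 : (K i : ℝ) = K' i := congrFun (congrArg Subtype.val hK) i
    exact_mod_cast h2
  have h2 := h.comp_injective hinj
  exact h2

lemma summable_lam_inv_sq {L : ℝ} (hL : 0 < L) : Summable fun K => ((lam L K)⁻¹) ^ 2 := by
  refine Summable.of_norm_bounded_eventually
    (g := fun K => ((4 * Real.pi ^ 2 / L ^ 2)⁻¹) ^ 2 * (‖fun i => (K i : ℝ)‖⁻¹) ^ 4)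
    (summable_norm_int_inv_pow.mul_left _) ?_
  refine (Set.finite_singleton (0 : Fin 3 → ℤ)).subset ?_
  intro K hK
  by_contra h0
  refine hK ?_
  have h0' : K ≠ 0 := h0
  change ‖((lam L K)⁻¹) ^ 2‖ ≤ _
  rw [lam_of_ne h0', Real.norm_of_nonneg (by positivity)]
  have h1 := norm_int_sq_le K
  have h3 : 0 < ‖fun i => (K i : ℝ)‖ := by
    rw [norm_pos_iff]
    intro h
    apply h0'
    funext i
    have h2 : (K i : ℝ) = 0 := congrFun h i
    exact_mod_cast h2
  unfold eig
  rw [mul_inv, mul_pow]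
  have : (∑ i, (K i : ℝ) ^ 2)⁻¹ ≤ (‖fun i => (K i : ℝ)‖ ^ 2)⁻¹ := by gcongr
  calc _ ≤ ((4 * Real.pi ^ 2 / L ^ 2)⁻¹) ^ 2 * ((‖fun i => (K i : ℝ)‖ ^ 2)⁻¹) ^ 2 := by gcongr
    _ = _ := by ring

/-! ### Fourier coefficients of products -/

section FourierProduct
open UnitAddTorus

lemma mFourierCoeff_def (f : UnitAddTorus (Fin 3) → ℂ) (K : Fin 3 → ℤ) :
    mFourierCoeff f K = ∫ y, mFourier (-K) y * f y ∂torusMeasure := rfl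

lemma hasSum_mFourierCoeff (f : Lp ℂ 2 torusMeasure) :
    HasSum (fun K => mFourierCoeff f K • (mFourierLp 2 K : Lp ℂ 2 torusMeasure)) f :=
  hasSum_mFourier_series_L2 f

lemma coeFn_mFourierLp_torus (K : Fin 3 → ℤ) :
    ((mFourierLp 2 K : Lp ℂ 2 torusMeasure) : UnitAddTorus (Fin 3) → ℂ) =ᵐ[torusMeasure]
      mFourier K := coeFn_mFourierLp 2 K

/-- Riesz-Fischer: the synthesis of square-summable coefficients has these Fourier coefficients. -/
lemma mFourierCoeff_synth {c : (Fin 3 → ℤ) → ℂ} (hc : Summable fun K => ‖c K‖ ^ 2)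
    (K : Fin 3 → ℤ) : mFourierCoeff (synth c) K = c K := by
  have hm : Memℓp c 2 := by
    rw [memℓp_gen_iff (by norm_num)]
    simpa using hc
  set F : lp (fun _ : Fin 3 → ℤ => ℂ) 2 := ⟨c, hm⟩
  have h1 := (mFourierBasis (d := Fin 3)).hasSum_repr_symm F
  have h2 : synth c = (mFourierBasis (d := Fin 3)).repr.symm F := by
    have h3 := h1.tsum_eq
    rw [coe_mFourierBasis] at h3
    exact h3
  rw [h2, ← mFourierBasis_repr]
  simp [F]

lemma memLp_conj_mul_mFourier (g : Lp ℂ 2 torusMeasure) (K : Fin 3 → ℤ) :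
    MemLp (fun y => (starRingEnd ℂ) (g y) * mFourier K y) 2 torusMeasure := by
  have hg := Lp.memLp g
  refine MemLp.of_le hg ?_ ?_
  · exact (Complex.continuous_conj.comp_aestronglyMeasurable hg.1).mul
      (mFourier K).continuous.aestronglyMeasurable
  · refine Eventually.of_forall fun y => ?_
    rw [norm_mul, RCLike.norm_conj]
    refine mul_le_of_le_one_right (norm_nonneg _) ?_
    exact ((mFourier K).norm_coe_le_norm y).trans mFourier_norm.le

lemma integrable_mul_of_Lp_two (f g : Lp ℂ 2 torusMeasure) :
    Integrable (fun y => f y * g y) torusMeasure :=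
  (Lp.memLp f).integrable_mul (Lp.memLp g)

/-- The Fourier coefficients of a product of square-integrable functions are the convolution of
their Fourier coefficients. -/
lemma hasSum_mFourierCoeff_mul (f g : Lp ℂ 2 torusMeasure) (K : Fin 3 → ℤ) :
    HasSum (fun J => mFourierCoeff f J * mFourierCoeff g (K - J))
      (mFourierCoeff (fun y => f y * g y) K) := by
  set h : Lp ℂ 2 torusMeasure := (memLp_conj_mul_mFourier g K).toLp _ with hh
  have hcoe : (h : UnitAddTorus (Fin 3) → ℂ) =ᵐ[torusMeasure]
      fun y => (starRingEnd ℂ) (g y) * mFourier K y := MemLp.coeFn_toLp _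
  have key : ∀ F : Lp ℂ 2 torusMeasure,
      inner ℂ h F = ∫ y, mFourier (-K) y * (F y * g y) ∂torusMeasure := by
    intro F
    rw [L2.inner_def]
    refine integral_congr_ae ?_
    filter_upwards [hcoe] with y hy
    rw [hy, RCLike.inner_apply, map_mul, Complex.conj_conj, mFourier_neg]
    ring
  have h1 := (innerSL ℂ h).hasSum (hasSum_mFourierCoeff f)
  have h2 : (innerSL ℂ h) f = mFourierCoeff (fun y => f y * g y) K := by
    rw [innerSL_apply_apply, key, mFourierCoeff_def]
  rw [h2] at h1
  refine h1.congr_fun fun J => ?_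
  simp only [map_smul, smul_eq_mul]
  congr 1
  change _ = inner ℂ h _
  rw [key, mFourierCoeff_def]
  refine integral_congr_ae ?_
  filter_upwards [coeFn_mFourierLp_torus J] with y hy
  rw [hy, show -(K - J) = -K + J by abel, mFourier_add]
  ring

end FourierProduct

/-- The `K`-th coefficient of `(v · ∇) u`, as a convolution. -/
def conv (L : ℝ) (v u : Field) : Field := fun K i =>
  ∑' J, ∑ j, v J j * (2 * Real.pi * Complex.I * ((K - J) j : ℂ) / L * u (K - J) i)

/-- The Fourier coefficients of `(v · ∇) u`, an integral of products of functions, are given by the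
convolution. -/
lemma advection_eq_conv {L : ℝ} {v u : Field} (hv : ∀ j, Summable fun K => ‖v K j‖ ^ 2)
    (hu : ∀ j i, Summable fun K => ‖partialCoeff L j (fun J => u J i) K‖ ^ 2) :
    advection L v u = conv L v u := by
  funext K i
  have h1 : advection L v u K i = ∑ j, UnitAddTorus.mFourierCoeff
      (fun y => synth (fun J => v J j) y * synth (partialCoeff L j fun J => u J i) y) K := by
    unfold advection
    simp only [mFourierCoeff_def, Finset.mul_sum]
    refine integral_finsetSum _ fun j _ => ?_
    have hi := integrable_mul_of_Lp_two (synth (fun J => v J j))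
      (synth (partialCoeff L j fun J => u J i))
    refine hi.bdd_mul (c := 1) (UnitAddTorus.mFourier (-K)).continuous.aestronglyMeasurable ?_
    exact Eventually.of_forall fun y =>
      ((UnitAddTorus.mFourier (-K)).norm_coe_le_norm y).trans UnitAddTorus.mFourier_norm.le
  rw [h1, conv]
  have h2 : ∀ j ∈ Finset.univ, HasSum
      (fun J => v J j * (2 * Real.pi * Complex.I * ((K - J) j : ℂ) / L * u (K - J) i))
      (UnitAddTorus.mFourierCoeff
      (fun y => synth (fun J => v J j) y * synth (partialCoeff L j fun J => u J i) y) K) := by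
    intro j _
    have := hasSum_mFourierCoeff_mul (synth (fun J => v J j))
      (synth (partialCoeff L j fun J => u J i)) K
    simp only [mFourierCoeff_synth (hv j), mFourierCoeff_synth (hu j i)] at this
    exact this
  exact (hasSum_sum h2).tsum_eq.symm

/-! ### The Hilbert space of solenoidal fields -/

/-- The square-summable families of Fourier coefficients of real, mean-zero, divergence-free
fields, as a closed subspace of `ℓ²`. -/
def solenoidal : Submodule ℝ (lp (fun _ : (Fin 3 → ℤ) × Fin 3 => ℂ) 2) where
  carrier := {y | (∀ i, y (0, i) = 0) ∧ (∀ K i, (starRingEnd ℂ) (y (K, i)) = y (-K, i)) ∧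
    ∀ K, ∑ i, (K i : ℂ) * y (K, i) = 0}
  zero_mem' := by simp
  add_mem' := by
    rintro u v ⟨h1, h2, h3⟩ ⟨k1, k2, k3⟩
    refine ⟨fun i => by simp [h1, k1], fun K i => by simp [h2, k2], fun K => ?_⟩
    simp [mul_add, Finset.sum_add_distrib, h3, k3]
  smul_mem' := by
    rintro c u ⟨h1, h2, h3⟩
    refine ⟨fun i => by simp [h1], fun K i => by simp [h2], fun K => ?_⟩
    have : ∑ i, (K i : ℂ) * (c • u) (K, i) = (c : ℂ) * ∑ i, (K i : ℂ) * u (K, i) := by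
      rw [Finset.mul_sum]
      refine Finset.sum_congr rfl fun i _ => ?_
      simp
      ring
    rw [this, h3, mul_zero]

/-- The real Hilbert space `H` of real, mean-zero, divergence-free fields, identified with their
Fourier coefficients. -/
def Hsp : Type := solenoidal

namespace Hsp

instance : NormedAddCommGroup Hsp := inferInstanceAs (NormedAddCommGroup solenoidal)
instance : InnerProductSpace ℝ Hsp := inferInstanceAs (InnerProductSpace ℝ solenoidal)

/-- The Fourier coefficients of an element of `H`. -/
def coef (y : Hsp) : Field := fun K i => Subtype.val (p := fun z => z ∈ solenoidal) y (K, i)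

@[simp] lemma coef_add (x y : Hsp) : coef (x + y) = coef x + coef y := rfl
@[simp] lemma coef_sub (x y : Hsp) : coef (x - y) = coef x - coef y := rfl
@[simp] lemma coef_zero : coef 0 = 0 := rfl
@[simp] lemma coef_smul (c : ℝ) (x : Hsp) : coef (c • x) = c • coef x := rfl

@[ext] lemma ext {x y : Hsp} (h : ∀ K i, coef x K i = coef y K i) : x = y := by
  refine Subtype.ext (lp.ext (funext fun p => ?_))
  exact h p.1 p.2

lemma isClosed : IsClosed (solenoidal : Set (lp (fun _ : (Fin 3 → ℤ) × Fin 3 => ℂ) 2)) := by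
  have hc : ∀ p, Continuous fun y : lp (fun _ : (Fin 3 → ℤ) × Fin 3 => ℂ) 2 => y p := fun p =>
    (lp.evalCLM ℝ (fun _ : (Fin 3 → ℤ) × Fin 3 => ℂ) 2 p).continuous
  have : (solenoidal : Set (lp (fun _ : (Fin 3 → ℤ) × Fin 3 => ℂ) 2)) =
      (⋂ i, {y | y (0, i) = 0}) ∩ ((⋂ K, ⋂ i, {y | (starRingEnd ℂ) (y (K, i)) = y (-K, i)}) ∩
        ⋂ K : Fin 3 → ℤ, {y | ∑ i, (K i : ℂ) * y (K, i) = 0}) := by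
    ext y
    simp only [Set.mem_inter_iff, Set.mem_iInter]
    rfl
  rw [this]
  refine (isClosed_iInter fun i => ?_).inter
    ((isClosed_iInter fun K => isClosed_iInter fun i => ?_).inter (isClosed_iInter fun K => ?_))
  · exact isClosed_eq (hc _) continuous_const
  · exact isClosed_eq (Complex.continuous_conj.comp (hc _)) (hc _)
  · exact isClosed_eq (continuous_finsetSum _ fun i _ => continuous_const.mul (hc _))
      continuous_const

instance : CompleteSpace Hsp := by
  have h : CompleteSpace solenoidal := isClosed.completeSpace_coe
  exact h

/-- The inclusion of `H` into `ℓ²`. -/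
def toLp : Hsp →ₗᵢ[ℝ] lp (fun _ : (Fin 3 → ℤ) × Fin 3 => ℂ) 2 where
  toFun y := Subtype.val (p := fun z => z ∈ solenoidal) y
  map_add' _ _ := rfl
  map_smul' _ _ := rfl
  norm_map' _ := rfl

lemma hasSum_inner (x y : Hsp) :
    HasSum (fun p : (Fin 3 → ℤ) × Fin 3 => inner ℝ (coef x p.1 p.2) (coef y p.1 p.2))
      (inner ℝ x y) :=
  lp.hasSum_inner (Subtype.val (p := fun z => z ∈ solenoidal) x)
    (Subtype.val (p := fun z => z ∈ solenoidal) y)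

lemma hasSum_norm_sq (x : Hsp) :
    HasSum (fun p : (Fin 3 → ℤ) × Fin 3 => ‖coef x p.1 p.2‖ ^ 2) (‖x‖ ^ 2) := by
  have := hasSum_inner x x
  simpa only [real_inner_self_eq_norm_sq] using this

lemma norm_coef_le (x : Hsp) (K : Fin 3 → ℤ) (i : Fin 3) : ‖coef x K i‖ ≤ ‖x‖ := by
  refine (sq_le_sq₀ (norm_nonneg _) (norm_nonneg _)).1 ?_
  exact le_hasSum (hasSum_norm_sq x) (K, i) fun _ _ => sq_nonneg _

/-- A Fourier coefficient as a continuous linear functional. -/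
def coefL (K : Fin 3 → ℤ) (i : Fin 3) : Hsp →L[ℝ] ℂ :=
  LinearMap.mkContinuous
    { toFun := fun y => coef y K i
      map_add' := fun _ _ => rfl
      map_smul' := fun _ _ => rfl } 1 (fun y => by
        rw [one_mul]
        exact norm_coef_le y K i)

@[simp] lemma coefL_apply (K : Fin 3 → ℤ) (i : Fin 3) (y : Hsp) : coefL K i y = coef y K i := rfl

/-- The conditions on a family of coefficients to define an element of `H`. -/
structure IsCoef (u : Field) : Prop where
  zero : u 0 = 0
  conj : ∀ K i, (starRingEnd ℂ) (u K i) = u (-K) i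
  div : ∀ K, ∑ i, (K i : ℂ) * u K i = 0
  summable : Summable fun p : (Fin 3 → ℤ) × Fin 3 => ‖u p.1 p.2‖ ^ 2

lemma isCoef (y : Hsp) : IsCoef (coef y) where
  zero := funext (Subtype.prop (p := fun z => z ∈ solenoidal) y).1
  conj := (Subtype.prop (p := fun z => z ∈ solenoidal) y).2.1
  div := (Subtype.prop (p := fun z => z ∈ solenoidal) y).2.2
  summable := (hasSum_norm_sq y).summable

/-- The element of `H` with given coefficients. -/
def mk (u : Field) (h : IsCoef u) : Hsp :=
  ⟨⟨fun p => u p.1 p.2, by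
    change Memℓp _ 2
    rw [memℓp_gen_iff (by norm_num)]
    simpa using h.summable⟩, fun i => congrFun h.zero i, h.conj, h.div⟩

@[simp] lemma coef_mk (u : Field) (h : IsCoef u) : coef (mk u h) = u := rfl

/-- A curve in `H` with measurable coefficients is strongly measurable, as the limit of its finite
Fourier sums. -/
lemma aestronglyMeasurable_of_coef {α : Type*} [MeasurableSpace α] {μ : Measure α} {f : α → Hsp}
    (h : ∀ K i, AEMeasurable (fun t => coef (f t) K i) μ) : AEStronglyMeasurable f μ := by
  classical
  rw [← toLp.isometry.isEmbedding.aestronglyMeasurable_comp_iff]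
  refine aestronglyMeasurable_of_tendsto_ae (u := (atTop : Filter (Finset ((Fin 3 → ℤ) × Fin 3))))
    (f := fun s t => ∑ p ∈ s, lp.single 2 p (coef (f t) p.1 p.2)) (fun s => ?_)
    (Eventually.of_forall fun t => ?_)
  · refine Finset.aestronglyMeasurable_fun_sum _ fun p _ => ?_
    exact (lp.singleContinuousLinearMap ℝ (fun _ : (Fin 3 → ℤ) × Fin 3 => ℂ) 2
      p).continuous.comp_aestronglyMeasurable (h p.1 p.2).aestronglyMeasurable
  · exact lp.hasSum_single (by norm_num) (toLp (f t))

end Hsp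

namespace Hsp

/-! ### Functions of the Stokes operator -/

lemma IsCoef.mul {u : Field} (hu : IsCoef u) {m : (Fin 3 → ℤ) → ℝ} (hm : ∀ K, m (-K) = m K)
    (hs : Summable fun p : (Fin 3 → ℤ) × Fin 3 => ‖(m p.1 : ℂ) * u p.1 p.2‖ ^ 2) :
    IsCoef fun K i => (m K : ℂ) * u K i where
  zero := by
    funext i
    simp [hu.zero]
  conj K i := by
    rw [map_mul, Complex.conj_ofReal, hu.conj, hm]
  div K := by
    have := hu.div K
    calc _ = (m K : ℂ) * ∑ i, (K i : ℂ) * u K i := by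
          rw [Finset.mul_sum]
          exact Finset.sum_congr rfl fun i _ => by ring
      _ = 0 := by rw [this, mul_zero]
  summable := hs

lemma norm_le_of_coef_le {x : Hsp} {C : ℝ} (hC : 0 ≤ C) {y : Hsp}
    (h : ∀ K i, ‖coef x K i‖ ≤ C * ‖coef y K i‖) : ‖x‖ ≤ C * ‖y‖ := by
  refine (sq_le_sq₀ (norm_nonneg _) (by positivity)).1 ?_
  rw [mul_pow]
  refine hasSum_le (fun p => ?_) (hasSum_norm_sq x) ((hasSum_norm_sq y).mul_left _)
  rw [← mul_pow]
  exact pow_le_pow_left₀ (norm_nonneg _) (h _ _) 2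

/-- The function `φ(A)` of the Stokes operator, for `φ` bounded on the spectrum. -/
def fcalc (L : ℝ) (φ : ℝ → ℝ) (h : ∃ C, ∀ K, |φ (lam L K)| ≤ C) : Hsp →L[ℝ] Hsp :=
  LinearMap.mkContinuous
    { toFun := fun y => mk (fun K i => (φ (lam L K) : ℂ) * coef y K i)
        ((isCoef y).mul (fun K => by rw [lam_neg]) (by
          refine Summable.of_nonneg_of_le (fun _ => sq_nonneg _) (fun p => ?_)
            ((isCoef y).summable.mul_left (h.choose ^ 2))
          rw [norm_mul, mul_pow, Complex.norm_real, Real.norm_eq_abs]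
          exact mul_le_mul_of_nonneg_right
            (pow_le_pow_left₀ (abs_nonneg _) (h.choose_spec _) 2) (sq_nonneg _)))
      map_add' := fun x y => by
        ext K i
        simp [mul_add]
      map_smul' := fun c x => by
        ext K i
        simp
        ring } h.choose
    (fun y => by
      refine norm_le_of_coef_le ((abs_nonneg _).trans (h.choose_spec 0)) fun K i => ?_
      simp only [LinearMap.coe_mk, AddHom.coe_mk, coef_mk, norm_mul, Complex.norm_real,
        Real.norm_eq_abs]
      exact mul_le_mul_of_nonneg_right (h.choose_spec _) (norm_nonneg _))

@[simp] lemma coef_fcalc (L : ℝ) (φ : ℝ → ℝ) (h : ∃ C, ∀ K, |φ (lam L K)| ≤ C) (y : Hsp)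
    (K : Fin 3 → ℤ) (i : Fin 3) :
    coef (fcalc L φ h y) K i = (φ (lam L K) : ℂ) * coef y K i := rfl

lemma norm_fcalc_le {L : ℝ} {φ : ℝ → ℝ} (h : ∃ C, ∀ K, |φ (lam L K)| ≤ C) {C : ℝ}
    (hC : ∀ K, |φ (lam L K)| ≤ C) (y : Hsp) : ‖fcalc L φ h y‖ ≤ C * ‖y‖ := by
  refine norm_le_of_coef_le ((abs_nonneg _).trans (hC 0)) fun K i => ?_
  rw [coef_fcalc, norm_mul, Complex.norm_real, Real.norm_eq_abs]
  exact mul_le_mul_of_nonneg_right (hC _) (norm_nonneg _)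

lemma inner_fcalc_left (L : ℝ) (φ : ℝ → ℝ) (h : ∃ C, ∀ K, |φ (lam L K)| ≤ C) (x y : Hsp) :
    inner ℝ (fcalc L φ h x) y = inner ℝ x (fcalc L φ h y) := by
  rw [← (hasSum_inner _ _).tsum_eq, ← (hasSum_inner _ _).tsum_eq]
  refine tsum_congr fun p => ?_
  simp only [coef_fcalc, Complex.inner, map_mul, Complex.conj_ofReal]
  congr 1
  ring

lemma bdd_rpow {L : ℝ} (hL : 0 < L) {r : ℝ} (hr : r ≤ 0) :
    ∀ K, |(lam L K) ^ r| ≤ lamMin L ^ r := fun K => by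
  rw [abs_of_nonneg (Real.rpow_nonneg (lam_pos hL K).le _)]
  exact Real.rpow_le_rpow_of_nonpos (lamMin_pos hL) (lamMin_le hL K) hr

end Hsp
open Hsp

/-! ### Sobolev spaces as images of `H` -/

lemma sobTerm_eq {L : ℝ} (s : ℝ) {u : Field} (hu : u 0 = 0) (K : Fin 3 → ℤ) :
    sobTerm L s u K = lam L K ^ s * ∑ i, ‖u K i‖ ^ 2 := by
  by_cases hK : K = 0
  · subst hK
    simp [sobTerm, hu]
  · rw [sobTerm, lam_of_ne hK]

lemma norm_rpow_mul_sq {L : ℝ} (hL : 0 < L) (s : ℝ) (K : Fin 3 → ℤ) (z : ℂ) :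
    ‖((lam L K ^ (s / 2) : ℝ) : ℂ) * z‖ ^ 2 = lam L K ^ s * ‖z‖ ^ 2 := by
  have := lam_pos hL K
  rw [norm_mul, mul_pow, Complex.norm_real, Real.norm_of_nonneg (Real.rpow_nonneg this.le _),
    ← Real.rpow_natCast, ← Real.rpow_mul this.le]
  norm_num

lemma isCoef_of_mem_Vdot {L : ℝ} (hL : 0 < L) {s : ℝ} {u : Field} (hu : u ∈ Vdot L s) :
    IsCoef fun K i => ((lam L K ^ (s / 2) : ℝ) : ℂ) * u K i where
  zero := by
    funext i
    simp [hu.1.1]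
  conj K i := by
    rw [map_mul, Complex.conj_ofReal, hu.1.2.1, lam_neg]
  div K := by
    calc _ = ((lam L K ^ (s / 2) : ℝ) : ℂ) * ∑ i, (K i : ℂ) * u K i := by
          rw [Finset.mul_sum]
          exact Finset.sum_congr rfl fun i _ => by ring
      _ = 0 := by rw [hu.2, mul_zero]
  summable := by
    simp only [norm_rpow_mul_sq hL]
    rw [summable_prod_of_nonneg (fun p => mul_nonneg (Real.rpow_nonneg (lam_pos hL _).le _)
      (sq_nonneg _))]
    refine ⟨fun K => Summable.of_finite, ?_⟩
    refine hu.1.2.2.congr fun K => ?_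
    rw [tsum_fintype, sobTerm_eq s hu.1.1, Finset.mul_sum]

open Classical in
/-- The element `A^(s/2) u` of `H`, for `u` in `V̇_s`; it is `0` when `A^(s/2) u` is not in `H`. -/
def toH (L s : ℝ) (u : Field) : Hsp :=
  if h : IsCoef fun K i => ((lam L K ^ (s / 2) : ℝ) : ℂ) * u K i then Hsp.mk _ h else 0

/-- The field `A^(-s/2) y` in `V̇_s`, for `y` in `H`. -/
def ofH (L s : ℝ) (y : Hsp) : Field := fun K i => ((lam L K ^ (-(s / 2)) : ℝ) : ℂ) * coef y K i

lemma coef_toH {L : ℝ} (hL : 0 < L) {s : ℝ} {u : Field} (hu : u ∈ Vdot L s) (K : Fin 3 → ℤ)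
    (i : Fin 3) : coef (toH L s u) K i = ((lam L K ^ (s / 2) : ℝ) : ℂ) * u K i := by
  rw [toH, dif_pos (isCoef_of_mem_Vdot hL hu), coef_mk]

lemma ofH_toH {L : ℝ} (hL : 0 < L) {s : ℝ} {u : Field} (hu : u ∈ Vdot L s) :
    ofH L s (toH L s u) = u := by
  funext K i
  rw [ofH, coef_toH hL hu, ← mul_assoc, ← Complex.ofReal_mul, ← Real.rpow_add (lam_pos hL K)]
  simp

lemma ofH_mem {L : ℝ} (hL : 0 < L) (s : ℝ) (y : Hsp) : ofH L s y ∈ Vdot L s := by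
  have h0 : ofH L s y 0 = 0 := by
    funext i
    simp [ofH, (isCoef y).zero]
  refine ⟨⟨h0, fun K i => ?_, ?_⟩, fun K => ?_⟩
  · rw [ofH, ofH, map_mul, Complex.conj_ofReal, (isCoef y).conj, lam_neg]
  · have h1 := (isCoef y).summable
    rw [summable_prod_of_nonneg (fun p => sq_nonneg _)] at h1
    refine h1.2.congr fun K => ?_
    rw [sobTerm_eq s h0, tsum_fintype, Finset.mul_sum]
    refine Finset.sum_congr rfl fun i _ => ?_
    rw [← norm_rpow_mul_sq hL, ofH, ← mul_assoc, ← Complex.ofReal_mul,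
      ← Real.rpow_add (lam_pos hL K)]
    simp
  · calc _ = ((lam L K ^ (-(s / 2)) : ℝ) : ℂ) * ∑ i, (K i : ℂ) * coef y K i := by
          rw [Finset.mul_sum]
          exact Finset.sum_congr rfl fun i _ => by rw [ofH]; ring
      _ = 0 := by rw [(isCoef y).div, mul_zero]

lemma toH_ofH {L : ℝ} (hL : 0 < L) (s : ℝ) (y : Hsp) : toH L s (ofH L s y) = y := by
  ext K i
  rw [coef_toH hL (ofH_mem hL s y), ofH, ← mul_assoc, ← Complex.ofReal_mul,
    ← Real.rpow_add (lam_pos hL K)]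
  simp

lemma sobNorm_eq {L : ℝ} (hL : 0 < L) {s : ℝ} {u : Field} (hu : u ∈ Vdot L s) :
    sobNorm L s u = Real.sqrt (L ^ 3) * ‖toH L s u‖ := by
  rw [sobNorm, Real.sqrt_mul (by positivity)]
  congr 1
  rw [← Real.sqrt_sq (norm_nonneg (toH L s u)), ← (hasSum_norm_sq _).tsum_eq,
    (hasSum_norm_sq _).summable.tsum_prod]
  congr 1
  refine tsum_congr fun K => ?_
  rw [tsum_fintype, sobTerm_eq s hu.1.1, Finset.mul_sum]
  refine Finset.sum_congr rfl fun i _ => ?_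
  rw [coef_toH hL hu, norm_rpow_mul_sq hL]

lemma sobNorm_ofH {L : ℝ} (hL : 0 < L) (s : ℝ) (y : Hsp) :
    sobNorm L s (ofH L s y) = Real.sqrt (L ^ 3) * ‖y‖ := by
  rw [sobNorm_eq hL (ofH_mem hL s y), toH_ofH hL]

lemma ofH_sub (L s : ℝ) (x y : Hsp) : ofH L s (x - y) = ofH L s x - ofH L s y := by
  funext K i
  simp [ofH, mul_sub]

/-! ### Calculus of absolutely continuous functions -/

section AbsCont

variable {a b : ℝ}

lemma absolutelyContinuous_primitive {g : ℝ → ℝ} (hg : IntervalIntegrable g volume a b) (c : ℝ) :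
    AbsolutelyContinuousOnInterval (fun t => c + ∫ s in a..t, g s) a b :=
  (LipschitzWith.const c).lipschitzOnWith.absolutelyContinuousOnInterval.fun_add
    (hg.absolutelyContinuousOnInterval_intervalIntegral left_mem_uIcc)

lemma ae_deriv_primitive {g : ℝ → ℝ} (hg : IntervalIntegrable g volume a b) (c : ℝ) :
    ∀ᵐ t, t ∈ uIcc a b → HasDerivAt (fun t => c + ∫ s in a..t, g s) (g t) t := by
  filter_upwards [hg.ae_hasDerivAt_integral] with t ht hmem
  exact (ht hmem a left_mem_uIcc).const_add c

/-- Product rule for primitives of integrable functions. -/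
lemma mul_sub_mul_eq_integral (hab : a ≤ b) {f g h k : ℝ → ℝ}
    (hg : IntervalIntegrable g volume a b) (hk : IntervalIntegrable k volume a b)
    (hf : ∀ t ∈ Icc a b, f t = f a + ∫ s in a..t, g s)
    (hh : ∀ t ∈ Icc a b, h t = h a + ∫ s in a..t, k s) :
    f b * h b - f a * h a = ∫ t in a..b, (g t * h t + f t * k t) := by
  have h1 := absolutelyContinuous_primitive hg (f a)
  have h2 := absolutelyContinuous_primitive hk (h a)
  have h3 := h1.integral_deriv_mul_eq_sub h2
  simp only [intervalIntegral.integral_same, add_zero] at h3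
  rw [← hf b (right_mem_Icc.2 hab), ← hh b (right_mem_Icc.2 hab)] at h3
  rw [← h3]
  refine intervalIntegral.integral_congr_ae ?_
  filter_upwards [ae_deriv_primitive hg (f a), ae_deriv_primitive hk (h a)] with t ht1 ht2 hmem
  have hm : t ∈ uIcc a b := uIoc_subset_uIcc hmem
  have hm' : t ∈ Icc a b := by rwa [uIcc_of_le hab] at hm
  rw [(ht1 hm).deriv, (ht2 hm).deriv, ← hf t hm', ← hh t hm']

lemma continuousOn_primitive {E : Type*} [NormedAddCommGroup E] [NormedSpace ℝ E] (hab : a ≤ b)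
    {f g : ℝ → E} (hg : IntervalIntegrable g volume a b)
    (hf : ∀ t ∈ Icc a b, f t = f a + ∫ s in a..t, g s) : ContinuousOn f (Icc a b) := by
  have h1 := intervalIntegral.continuousOn_primitive_interval' hg left_mem_uIcc
  rw [uIcc_of_le hab] at h1
  exact (continuousOn_const.add h1).congr hf

lemma absolutelyContinuous_exp_primitive {k : ℝ → ℝ} (hk : IntervalIntegrable k volume a b) :
    AbsolutelyContinuousOnInterval (fun t => Real.exp (∫ s in a..t, k s)) a b := by
  have h1 := hk.absolutelyContinuousOnInterval_intervalIntegral (c := a) left_mem_uIcc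
  obtain ⟨C, hC⟩ := h1.exists_bound
  obtain ⟨M, hM⟩ := (Real.contDiff_exp.contDiffOn (n := 1)).exists_lipschitzOnWith (by decide)
    (convex_Icc (-C) C) isCompact_Icc
  have hC' : ∀ x ∈ uIcc a b, (∫ s in a..x, k s) ∈ Icc (-C) C := fun x hx =>
    abs_le.1 (by simpa using hC x hx)
  have h2 : Tendsto (fun E : ℕ × (ℕ → ℝ × ℝ) => M * ∑ i ∈ Finset.range E.1,
      dist (∫ s in a..(E.2 i).1, k s) (∫ s in a..(E.2 i).2, k s))
      (AbsolutelyContinuousOnInterval.totalLengthFilter ⊓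
        𝓟 (AbsolutelyContinuousOnInterval.disjWithin a b)) (𝓝 0) := by
    simpa using Tendsto.const_mul (M : ℝ) h1
  refine squeeze_zero' (Eventually.of_forall fun E => Finset.sum_nonneg fun _ _ => dist_nonneg)
    ?_ h2
  refine eventually_inf_principal.2 (Eventually.of_forall fun E hE => ?_)
  rw [Finset.mul_sum]
  refine Finset.sum_le_sum fun i hi => ?_
  exact hM.dist_le_mul _ (hC' _ (hE.1 i hi).1) _ (hC' _ (hE.1 i hi).2)

/-- Gronwall's inequality with an integrable coefficient. The function
`(c + ∫ k φ) exp (-∫ k)` is absolutely continuous with nonpositive derivative. -/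
lemma gronwall_integral (hab : a ≤ b) {φ k : ℝ → ℝ} {c : ℝ} (hk : IntervalIntegrable k volume a b)
    (hk0 : ∀ t, 0 ≤ k t) (hkφ : IntervalIntegrable (fun t => k t * φ t) volume a b)
    (h : ∀ t ∈ Icc a b, φ t ≤ c + ∫ s in a..t, k s * φ s) :
    φ b ≤ c * Real.exp (∫ s in a..b, k s) := by
  have h1 := absolutelyContinuous_primitive hkφ c
  have hkn : IntervalIntegrable (fun t => -k t) volume a b := hk.neg
  have h2 := absolutelyContinuous_exp_primitive hkn
  have h3 := h1.integral_deriv_mul_eq_sub h2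
  simp only [intervalIntegral.integral_same, add_zero, Real.exp_zero, mul_one] at h3
  have h4 : ∫ x in a..b, (deriv (fun t => c + ∫ s in a..t, k s * φ s) x *
      Real.exp (∫ s in a..x, -k s) + (c + ∫ s in a..x, k s * φ s) *
      deriv (fun t => Real.exp (∫ s in a..t, -k s)) x) ≤ 0 := by
    rw [← neg_nonneg, ← intervalIntegral.integral_neg]
    refine intervalIntegral.integral_nonneg_of_ae_restrict hab ?_
    rw [EventuallyLE, ae_restrict_iff' measurableSet_Icc]
    filter_upwards [ae_deriv_primitive hkφ c, hkn.ae_hasDerivAt_integral] with x hx1 hx2 hx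
    have hm : x ∈ uIcc a b := by rwa [uIcc_of_le hab]
    rw [(hx1 hm).deriv, ((hx2 hm a left_mem_uIcc).exp).deriv]
    have h5 := mul_nonneg (mul_nonneg (hk0 x) (Real.exp_pos (∫ s in a..x, -k s)).le)
      (sub_nonneg.2 (h x hx))
    simp only [Pi.zero_apply]
    linarith
  rw [h3] at h4
  have h6 := h b (right_mem_Icc.2 hab)
  rw [intervalIntegral.integral_neg, Real.exp_neg] at h4
  have h7 := Real.exp_pos (∫ s in a..b, k s)
  rw [sub_nonpos, mul_inv_le_iff₀ h7] at h4
  exact h6.trans h4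

lemma re_primitive {f g : ℝ → ℂ} (hg : IntervalIntegrable g volume a b)
    (hf : ∀ t ∈ Icc a b, f t = f a + ∫ s in a..t, g s) :
    ∀ t ∈ Icc a b, (f t).re = (f a).re + ∫ s in a..t, (g s).re := by
  intro t ht
  have hab : a ≤ b := ht.1.trans ht.2
  have hg' : IntervalIntegrable g volume a t := hg.mono_set (by
    rw [uIcc_of_le ht.1, uIcc_of_le hab]; exact Icc_subset_Icc le_rfl ht.2)
  have := Complex.reCLM.intervalIntegral_comp_comm hg'
  simp only [Complex.reCLM_apply] at this
  rw [this, ← Complex.add_re, ← hf t ht]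

lemma im_primitive {f g : ℝ → ℂ} (hg : IntervalIntegrable g volume a b)
    (hf : ∀ t ∈ Icc a b, f t = f a + ∫ s in a..t, g s) :
    ∀ t ∈ Icc a b, (f t).im = (f a).im + ∫ s in a..t, (g s).im := by
  intro t ht
  have hab : a ≤ b := ht.1.trans ht.2
  have hg' : IntervalIntegrable g volume a t := hg.mono_set (by
    rw [uIcc_of_le ht.1, uIcc_of_le hab]; exact Icc_subset_Icc le_rfl ht.2)
  have := Complex.imCLM.intervalIntegral_comp_comm hg'
  simp only [Complex.imCLM_apply] at this
  rw [this, ← Complex.add_im, ← hf t ht]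

lemma intervalIntegrable_re {g : ℝ → ℂ} (hg : IntervalIntegrable g volume a b) :
    IntervalIntegrable (fun t => (g t).re) volume a b :=
  ⟨Complex.reCLM.integrable_comp hg.1, Complex.reCLM.integrable_comp hg.2⟩

lemma intervalIntegrable_im {g : ℝ → ℂ} (hg : IntervalIntegrable g volume a b) :
    IntervalIntegrable (fun t => (g t).im) volume a b :=
  ⟨Complex.imCLM.integrable_comp hg.1, Complex.imCLM.integrable_comp hg.2⟩

/-- The derivative of `‖f‖²` is `2 ⟪f, f'⟫`. -/
lemma norm_sq_sub_norm_sq_eq_integral (hab : a ≤ b) {f g : ℝ → ℂ}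
    (hg : IntervalIntegrable g volume a b) (hf : ∀ t ∈ Icc a b, f t = f a + ∫ s in a..t, g s) :
    ‖f b‖ ^ 2 - ‖f a‖ ^ 2 = ∫ t in a..b, 2 * inner ℝ (f t) (g t) := by
  have h1 := mul_sub_mul_eq_integral hab (intervalIntegrable_re hg) (intervalIntegrable_re hg)
    (re_primitive hg hf) (re_primitive hg hf)
  have h2 := mul_sub_mul_eq_integral hab (intervalIntegrable_im hg) (intervalIntegrable_im hg)
    (im_primitive hg hf) (im_primitive hg hf)
  have hc := continuousOn_primitive hab hg hf
  rw [← uIcc_of_le hab] at hc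
  have hre := Complex.continuous_re.comp_continuousOn hc
  have him := Complex.continuous_im.comp_continuousOn hc
  simp only [Function.comp_def] at hre him
  have e : ∀ z : ℂ, ‖z‖ ^ 2 = z.re * z.re + z.im * z.im := fun z => by
    rw [← Complex.normSq_eq_norm_sq, Complex.normSq_apply]
  rw [e, e]
  have h3 : ∀ t, 2 * inner ℝ (f t) (g t) = ((g t).re * (f t).re + (f t).re * (g t).re) +
      ((g t).im * (f t).im + (f t).im * (g t).im) := fun t => by
    rw [Complex.inner]
    simp
    ring
  simp only [h3]
  rw [intervalIntegral.integral_add, ← h1, ← h2]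
  · ring
  · exact ((intervalIntegrable_re hg).mul_continuousOn hre).add
      ((intervalIntegrable_re hg).continuousOn_mul hre)
  · exact ((intervalIntegrable_im hg).mul_continuousOn him).add
      ((intervalIntegrable_im hg).continuousOn_mul him)

/-- The derivative of `exp (c t) f` is `exp (c t) (f' + c f)`. -/
lemma exp_mul_primitive (hab : a ≤ b) (c : ℝ) {f g : ℝ → ℂ}
    (hg : IntervalIntegrable g volume a b) (hf : ∀ t ∈ Icc a b, f t = f a + ∫ s in a..t, g s) :
    (Real.exp (c * b) : ℂ) * f b = (Real.exp (c * a) : ℂ) * f a +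
      ∫ t in a..b, (Real.exp (c * t) : ℂ) * (g t + c * f t) := by
  have hexp : ∀ t ∈ Icc a b, Real.exp (c * t) =
      Real.exp (c * a) + ∫ s in a..t, c * Real.exp (c * s) := by
    intro t _
    rw [intervalIntegral.integral_eq_sub_of_hasDerivAt (f := fun s => Real.exp (c * s))]
    · ring
    · intro x _
      have := ((hasDerivAt_id x).const_mul c).exp
      simpa [mul_comm] using this
    · exact Continuous.intervalIntegrable (by fun_prop) _ _
  have hexpi : IntervalIntegrable (fun s => c * Real.exp (c * s)) volume a b :=
    Continuous.intervalIntegrable (by fun_prop) _ _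
  have h1 := mul_sub_mul_eq_integral hab (intervalIntegrable_re hg) hexpi
    (re_primitive hg hf) hexp
  have h2 := mul_sub_mul_eq_integral hab (intervalIntegrable_im hg) hexpi
    (im_primitive hg hf) hexp
  have hc := continuousOn_primitive hab hg hf
  rw [← uIcc_of_le hab] at hc
  have hi : IntervalIntegrable (fun t => (Real.exp (c * t) : ℂ) * (g t + c * f t)) volume a b := by
    refine IntervalIntegrable.continuousOn_mul ?_ (Continuous.continuousOn (by fun_prop))
    exact hg.add (continuousOn_const.mul hc).intervalIntegrable
  have hre := Complex.reCLM.intervalIntegral_comp_comm hi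
  have him := Complex.imCLM.intervalIntegral_comp_comm hi
  simp only [Complex.reCLM_apply, Complex.imCLM_apply] at hre him
  apply Complex.ext
  · rw [Complex.add_re, ← hre]
    simp only [Complex.re_ofReal_mul, Complex.add_re]
    have e : ∀ t, Real.exp (c * t) * ((g t).re + c * (f t).re) =
        (g t).re * Real.exp (c * t) + (f t).re * (c * Real.exp (c * t)) := fun t => by ring
    simp only [e]
    rw [← h1]
    ring
  · rw [Complex.add_im, ← him]
    simp only [Complex.im_ofReal_mul, Complex.add_im]
    have e : ∀ t, Real.exp (c * t) * ((g t).im + c * (f t).im) =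
        (g t).im * Real.exp (c * t) + (f t).im * (c * Real.exp (c * t)) := fun t => by ring
    simp only [e]
    rw [← h2]
    ring

end AbsCont

/-! ### The operator `A^(-1/2)` -/

/-- `A^(-1/2)` on `H`. -/
def Dop {L : ℝ} (hL : 0 < L) : Hsp →L[ℝ] Hsp :=
  fcalc L (fun r => r ^ (-(1 / 2) : ℝ)) ⟨_, bdd_rpow hL (by norm_num)⟩

section Dop
variable {L : ℝ} (hL : 0 < L)

lemma coef_Dop (y : Hsp) (K : Fin 3 → ℤ) (i : Fin 3) :
    coef (Dop hL y) K i = ((lam L K ^ (-(1 / 2) : ℝ) : ℝ) : ℂ) * coef y K i := rfl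

lemma coef_Dop_Dop (y : Hsp) (K : Fin 3 → ℤ) (i : Fin 3) :
    coef (Dop hL (Dop hL y)) K i = (((lam L K)⁻¹ : ℝ) : ℂ) * coef y K i := by
  rw [coef_Dop, coef_Dop, ← mul_assoc, ← Complex.ofReal_mul, ← Real.rpow_add (lam_pos hL K)]
  norm_num [Real.rpow_neg_one]

lemma inner_Dop_left (x y : Hsp) : inner ℝ (Dop hL x) y = inner ℝ x (Dop hL y) :=
  inner_fcalc_left _ _ _ _ _

/-- The norm of `A^(-1/2)` is at most this constant. -/
def normD (L : ℝ) : ℝ := lamMin L ^ (-(1 / 2) : ℝ)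

include hL in
lemma normD_pos : 0 < normD L := Real.rpow_pos_of_pos (lamMin_pos hL) _

lemma norm_Dop_le (y : Hsp) : ‖Dop hL y‖ ≤ normD L * ‖y‖ :=
  norm_fcalc_le _ (bdd_rpow hL (by norm_num)) y

lemma Dop_injective : Function.Injective (Dop hL) := by
  intro x y h
  ext K i
  have h1 := congrArg (fun z => coef z K i) h
  simp only [coef_Dop] at h1
  refine mul_left_cancel₀ ?_ h1
  exact_mod_cast (Real.rpow_pos_of_pos (lam_pos hL K) _).ne'

end Dop

/-! ### Square-integrable curves in `H` -/

section Curves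

lemma measurable_coef {α : Type*} [MeasurableSpace α] {μ : Measure α} {y : α → Hsp}
    (hy : AEStronglyMeasurable y μ) (K : Fin 3 → ℤ) (i : Fin 3) :
    AEStronglyMeasurable (fun t => coef (y t) K i) μ :=
  (coefL K i).continuous.comp_aestronglyMeasurable hy

lemma memLp_coef {α : Type*} [MeasurableSpace α] {μ : Measure α} {y : α → Hsp}
    (hy : MemLp y 2 μ) (K : Fin 3 → ℤ) (i : Fin 3) : MemLp (fun t => coef (y t) K i) 2 μ :=
  hy.of_le (measurable_coef hy.1 K i) (Eventually.of_forall fun _ => norm_coef_le _ _ _)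

lemma integrable_norm_sq {α E : Type*} [MeasurableSpace α] [NormedAddCommGroup E] {μ : Measure α}
    {y : α → E} (hy : MemLp y 2 μ) : Integrable (fun t => ‖y t‖ ^ 2) μ :=
  hy.integrable_norm_pow two_ne_zero

lemma hasSum_integral_norm_coef_sq {α : Type*} [MeasurableSpace α] {μ : Measure α} {y : α → Hsp}
    (hy : MemLp y 2 μ) :
    HasSum (fun p : (Fin 3 → ℤ) × Fin 3 => ∫ t, ‖coef (y t) p.1 p.2‖ ^ 2 ∂μ)
      (∫ t, ‖y t‖ ^ 2 ∂μ) := by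
  refine hasSum_integral_of_dominated_convergence (fun p t => ‖coef (y t) p.1 p.2‖ ^ 2)
    (fun p => (memLp_coef hy p.1 p.2).1.norm.pow 2) (fun p => Eventually.of_forall fun _ => ?_)
    (Eventually.of_forall fun t => (hasSum_norm_sq _).summable) ?_
    (Eventually.of_forall fun t => hasSum_norm_sq _)
  · rw [Real.norm_of_nonneg (sq_nonneg _)]
  · refine (integrable_norm_sq hy).congr (Eventually.of_forall fun t => ?_)
    exact (hasSum_norm_sq _).tsum_eq.symm

lemma abs_inner_le_half (z w : ℂ) : |inner ℝ z w| ≤ (‖z‖ ^ 2 + ‖w‖ ^ 2) / 2 := by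
  have h1 := abs_real_inner_le_norm z w
  nlinarith [sq_nonneg (‖z‖ - ‖w‖)]

lemma integrable_inner_of_memLp {α E : Type*} [MeasurableSpace α] [NormedAddCommGroup E]
    [InnerProductSpace ℝ E] {μ : Measure α} {y q : α → E} (hy : MemLp y 2 μ) (hq : MemLp q 2 μ) :
    Integrable (fun t => inner ℝ (y t) (q t)) μ := by
  refine ((integrable_norm_sq hy).add (integrable_norm_sq hq)).mono' (hy.1.inner hq.1)
    (Eventually.of_forall fun t => ?_)
  have h1 := abs_real_inner_le_norm (y t) (q t)
  simp only [Pi.add_apply, Real.norm_eq_abs]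
  nlinarith [sq_nonneg (‖y t‖ - ‖q t‖), sq_nonneg (‖y t‖ + ‖q t‖)]

lemma hasSum_integral_inner_coef {α : Type*} [MeasurableSpace α] {μ : Measure α} {y q : α → Hsp}
    (hy : MemLp y 2 μ) (hq : MemLp q 2 μ) :
    HasSum (fun p : (Fin 3 → ℤ) × Fin 3 =>
      ∫ t, inner ℝ (coef (y t) p.1 p.2) (coef (q t) p.1 p.2) ∂μ) (∫ t, inner ℝ (y t) (q t) ∂μ) := by
  refine hasSum_integral_of_dominated_convergence
    (fun p t => (‖coef (y t) p.1 p.2‖ ^ 2 + ‖coef (q t) p.1 p.2‖ ^ 2) / 2)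
    (fun p => (memLp_coef hy p.1 p.2).1.inner (memLp_coef hq p.1 p.2).1)
    (fun p => Eventually.of_forall fun t => ?_)
    (Eventually.of_forall fun t =>
      ((hasSum_norm_sq (y t)).summable.add (hasSum_norm_sq (q t)).summable).div_const 2) ?_
    (Eventually.of_forall fun t => hasSum_inner _ _)
  · exact abs_inner_le_half _ _
  · refine (((integrable_norm_sq hy).add (integrable_norm_sq hq)).div_const 2).congr
      (Eventually.of_forall fun t => ?_)
    exact (((hasSum_norm_sq (y t)).add (hasSum_norm_sq (q t))).div_const 2).tsum_eq.symm

/-- A family of coefficients, square integrable in time and square summable over the frequencies,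
defines a square-integrable curve in `H`. -/
lemma exists_memLp_of_coef {α : Type*} [MeasurableSpace α] {μ : Measure α} {u : α → Field}
    (hm : ∀ K i, MemLp (fun t => u t K i) 2 μ) (h0 : ∀ᵐ t ∂μ, u t 0 = 0)
    (hc : ∀ᵐ t ∂μ, ∀ K i, (starRingEnd ℂ) (u t K i) = u t (-K) i)
    (hd : ∀ᵐ t ∂μ, ∀ K, ∑ i, (K i : ℂ) * u t K i = 0)
    (hs : Summable fun p : (Fin 3 → ℤ) × Fin 3 => ∫ t, ‖u t p.1 p.2‖ ^ 2 ∂μ) :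
    ∃ y : α → Hsp, MemLp y 2 μ ∧ ∀ᵐ t ∂μ, coef (y t) = u t := by
  classical
  have hi : ∀ p : (Fin 3 → ℤ) × Fin 3, Integrable (fun t => ‖u t p.1 p.2‖ ^ 2) μ := fun p =>
    integrable_norm_sq (hm p.1 p.2)
  have hfin : ∫⁻ t, ∑' p : (Fin 3 → ℤ) × Fin 3, ENNReal.ofReal (‖u t p.1 p.2‖ ^ 2) ∂μ ≠ ∞ := by
    rw [lintegral_tsum fun p => (hi p).1.aemeasurable.ennreal_ofReal]
    have : ∀ p : (Fin 3 → ℤ) × Fin 3, ∫⁻ t, ENNReal.ofReal (‖u t p.1 p.2‖ ^ 2) ∂μ =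
        ENNReal.ofReal (∫ t, ‖u t p.1 p.2‖ ^ 2 ∂μ) := fun p =>
      (ofReal_integral_eq_lintegral_ofReal (hi p) (Eventually.of_forall fun _ => sq_nonneg _)).symm
    simp only [this]
    rw [← ENNReal.ofReal_tsum_of_nonneg (fun p => integral_nonneg fun _ => sq_nonneg _) hs]
    exact ENNReal.ofReal_ne_top
  have hmeas : AEMeasurable
      (fun t => ∑' p : (Fin 3 → ℤ) × Fin 3, ENNReal.ofReal (‖u t p.1 p.2‖ ^ 2)) μ :=
    AEMeasurable.tsum fun p => (hi p).1.aemeasurable.ennreal_ofReal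
  have hae : ∀ᵐ t ∂μ, IsCoef (u t) := by
    filter_upwards [ae_lt_top' hmeas hfin, h0, hc, hd] with t ht h0 hc hd
    refine ⟨h0, hc, hd, ?_⟩
    have := ENNReal.summable_toReal ht.ne
    simpa only [ENNReal.toReal_ofReal (sq_nonneg _)] using this
  let y : α → Hsp := fun t => if h : IsCoef (u t) then Hsp.mk _ h else 0
  have hy : ∀ᵐ t ∂μ, coef (y t) = u t := by
    filter_upwards [hae] with t ht
    simp [y, ht]
  have hym : AEStronglyMeasurable y μ := aestronglyMeasurable_of_coef fun K i =>
    (hm K i).1.aemeasurable.congr (hy.mono fun t ht => by simp only [ht])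
  refine ⟨y, ?_, hy⟩
  rw [memLp_two_iff_integrable_sq_norm hym]
  refine ⟨hym.norm.pow 2, ?_⟩
  rw [hasFiniteIntegral_iff_ofReal (Eventually.of_forall fun _ => sq_nonneg _)]
  refine lt_of_le_of_lt (le_of_eq (lintegral_congr_ae ?_)) hfin.lt_top
  filter_upwards [hy] with t ht
  rw [← (hasSum_norm_sq (y t)).tsum_eq, ENNReal.ofReal_tsum_of_nonneg (fun _ => sq_nonneg _)
    (hasSum_norm_sq (y t)).summable, ht]

end Curves

/-! ### Evolution curves -/

/-- A curve `w` with `x = A^(1/2) w`, `y = A w` and `q = dw/dt` on `[0, T]`, where `y` and `q` are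
square integrable. The value `x t` is prescribed at every time `t`, through the last condition,
while `y` and `q` matter only almost everywhere. -/
structure Evol {L : ℝ} (hL : 0 < L) (T : ℝ) (x y q : ℝ → Hsp) : Prop where
  memLp : MemLp y 2 (volume.restrict (Ioc 0 T))
  memLp_deriv : MemLp q 2 (volume.restrict (Ioc 0 T))
  ae_eq : ∀ᵐ t ∂volume.restrict (Ioc 0 T), x t = Dop hL (y t)
  eq_integral : ∀ t ∈ Icc 0 T, Dop hL (x t) = Dop hL (x 0) + ∫ s in (0 : ℝ)..t, q s

section MemLpInterval
variable {E : Type*} [NormedAddCommGroup E] {T : ℝ} {y : ℝ → E}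

lemma MemLp.intervalIntegrable (hy : MemLp y 2 (volume.restrict (Ioc 0 T))) {t : ℝ}
    (ht : t ∈ Icc 0 T) : IntervalIntegrable y volume 0 t := by
  rw [intervalIntegrable_iff_integrableOn_Ioc_of_le ht.1]
  exact IntegrableOn.mono_set (hy.integrable one_le_two) (Ioc_subset_Ioc_right ht.2)

lemma MemLp.restrict_Ioc (hy : MemLp y 2 (volume.restrict (Ioc 0 T))) {t : ℝ}
    (ht : t ∈ Icc 0 T) : MemLp y 2 (volume.restrict (Ioc 0 t)) :=
  hy.mono_measure (Measure.restrict_mono_set _ (Ioc_subset_Ioc_right ht.2))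

lemma ae_restrict_Ioc_mono {p : ℝ → Prop} (h : ∀ᵐ t ∂volume.restrict (Ioc 0 T), p t) {t : ℝ}
    (ht : t ∈ Icc 0 T) : ∀ᵐ s ∂volume.restrict (Ioc 0 t), p s :=
  ae_restrict_of_ae_restrict_of_subset (Ioc_subset_Ioc_right ht.2) h

end MemLpInterval

namespace Evol
variable {L : ℝ} {hL : 0 < L} {T : ℝ} {x y q x' y' q' : ℝ → Hsp}

lemma sub (h : Evol hL T x y q) (h' : Evol hL T x' y' q') :
    Evol hL T (x - x') (y - y') (q - q') where
  memLp := h.memLp.sub h'.memLp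
  memLp_deriv := h.memLp_deriv.sub h'.memLp_deriv
  ae_eq := by
    filter_upwards [h.ae_eq, h'.ae_eq] with t h1 h2
    simp [h1, h2]
  eq_integral t ht := by
    simp only [Pi.sub_apply, map_sub]
    rw [h.eq_integral t ht, h'.eq_integral t ht, intervalIntegral.integral_sub
      (MemLp.intervalIntegrable h.memLp_deriv ht) (MemLp.intervalIntegrable h'.memLp_deriv ht)]
    abel

/-- The curve `A^(-1/2) w`. -/
lemma smooth (h : Evol hL T x y q) :
    Evol hL T (fun t => Dop hL (x t)) (fun t => Dop hL (y t)) (fun t => Dop hL (q t)) where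
  memLp := (Dop hL).comp_memLp' h.memLp
  memLp_deriv := (Dop hL).comp_memLp' h.memLp_deriv
  ae_eq := by
    filter_upwards [h.ae_eq] with t h1
    rw [h1]
  eq_integral t ht := by
    rw [h.eq_integral t ht, map_add, (Dop hL).intervalIntegral_comp_comm
      (MemLp.intervalIntegrable h.memLp_deriv ht)]

lemma coef_eq_integral (h : Evol hL T x y q) (K : Fin 3 → ℤ) (i : Fin 3) {t : ℝ}
    (ht : t ∈ Icc 0 T) : coef (Dop hL (x t)) K i =
      coef (Dop hL (x 0)) K i + ∫ s in (0 : ℝ)..t, coef (q s) K i := by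
  have h1 := congrArg (coefL K i) (h.eq_integral t ht)
  rw [map_add, ← (coefL K i).intervalIntegral_comp_comm
    (MemLp.intervalIntegrable h.memLp_deriv ht)] at h1
  exact h1

lemma norm_coef_sq_sub (h : Evol hL T x y q) (p : (Fin 3 → ℤ) × Fin 3) {t : ℝ}
    (ht : t ∈ Icc 0 T) : ‖coef (x t) p.1 p.2‖ ^ 2 - ‖coef (x 0) p.1 p.2‖ ^ 2 =
      2 * ∫ s in Ioc 0 t, inner ℝ (coef (y s) p.1 p.2) (coef (q s) p.1 p.2) := by
  have hlam := lam_pos hL p.1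
  have h1 := norm_sq_sub_norm_sq_eq_integral ht.1
    (MemLp.intervalIntegrable (memLp_coef h.memLp_deriv p.1 p.2) ht)
    (fun s hs => h.coef_eq_integral p.1 p.2 ⟨hs.1, hs.2.trans ht.2⟩)
  have e : ∀ s, ‖coef (Dop hL (x s)) p.1 p.2‖ ^ 2 =
      (lam L p.1)⁻¹ * ‖coef (x s) p.1 p.2‖ ^ 2 := fun s => by
    rw [coef_Dop, show (-(1 / 2) : ℝ) = (-1) / 2 by norm_num, norm_rpow_mul_sq hL,
      Real.rpow_neg_one]
  rw [e, e, intervalIntegral.integral_of_le ht.1] at h1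
  have h2 : ∫ s in Ioc 0 t, 2 * inner ℝ (coef (Dop hL (x s)) p.1 p.2) (coef (q s) p.1 p.2) =
      (lam L p.1)⁻¹ * (2 * ∫ s in Ioc 0 t,
        inner ℝ (coef (y s) p.1 p.2) (coef (q s) p.1 p.2)) := by
    rw [← integral_const_mul, ← integral_const_mul]
    refine integral_congr_ae ?_
    filter_upwards [ae_restrict_Ioc_mono h.ae_eq ht] with s hs
    rw [hs, coef_Dop_Dop, ← Complex.real_smul, real_inner_smul_left]
    ring
  rw [h2, ← mul_sub] at h1
  exact mul_left_cancel₀ (inv_pos.2 hlam).ne' h1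

/-- The energy identity `‖x‖² = ‖x(0)‖² + 2 ∫ ⟪y, q⟫`, proved frequency by frequency. -/
lemma norm_sq_eq (h : Evol hL T x y q) {t : ℝ} (ht : t ∈ Icc 0 T) :
    ‖x t‖ ^ 2 = ‖x 0‖ ^ 2 + 2 * ∫ s in Ioc 0 t, inner ℝ (y s) (q s) := by
  have h1 := (hasSum_norm_sq (x t)).sub (hasSum_norm_sq (x 0))
  have h2 := (hasSum_integral_inner_coef (MemLp.restrict_Ioc h.memLp ht)
    (MemLp.restrict_Ioc h.memLp_deriv ht)).mul_left 2
  have h3 := h1.unique (h2.congr_fun fun p => h.norm_coef_sq_sub p ht)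
  linarith

/-- The curve `x` is continuous: each coefficient is, and `‖x t‖²` is dominated coefficient by
coefficient, uniformly in time. -/
lemma continuousOn (h : Evol hL T x y q) : ContinuousOn x (Icc 0 T) := by
  intro t ht
  have hT : (0 : ℝ) ≤ T := ht.1.trans ht.2
  set m : (Fin 3 → ℤ) × Fin 3 → ℝ := fun p => ‖coef (x 0) p.1 p.2‖ ^ 2 +
    ((∫ s in Ioc 0 T, ‖coef (y s) p.1 p.2‖ ^ 2) + ∫ s in Ioc 0 T, ‖coef (q s) p.1 p.2‖ ^ 2) with hm
  have hms : Summable m := (hasSum_norm_sq _).summable.add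
    ((hasSum_integral_norm_coef_sq h.memLp).summable.add
      (hasSum_integral_norm_coef_sq h.memLp_deriv).summable)
  have hbound : ∀ τ ∈ Icc 0 T, ∀ p, ‖coef (x τ) p.1 p.2‖ ^ 2 ≤ m p := by
    intro τ hτ p
    have h1 := h.norm_coef_sq_sub p hτ
    have hy := integrable_norm_sq (memLp_coef h.memLp p.1 p.2)
    have hq := integrable_norm_sq (memLp_coef h.memLp_deriv p.1 p.2)
    have h2 : 2 * ∫ s in Ioc 0 τ, inner ℝ (coef (y s) p.1 p.2) (coef (q s) p.1 p.2) ≤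
        (∫ s in Ioc 0 T, ‖coef (y s) p.1 p.2‖ ^ 2) + ∫ s in Ioc 0 T, ‖coef (q s) p.1 p.2‖ ^ 2 := by
      rw [← integral_add hy hq, ← integral_const_mul]
      have hsub : Ioc 0 τ ⊆ Ioc 0 T := Ioc_subset_Ioc_right hτ.2
      refine le_trans ?_ (setIntegral_mono_set (hy.add hq)
        (Eventually.of_forall fun s => add_nonneg (sq_nonneg _) (sq_nonneg _))
        hsub.eventuallyLE)
      refine integral_mono ((integrable_inner_of_memLp
        (memLp_coef (MemLp.restrict_Ioc h.memLp hτ) p.1 p.2)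
        (memLp_coef (MemLp.restrict_Ioc h.memLp_deriv hτ) p.1 p.2)).const_mul 2)
        ((hy.add hq).mono_measure (Measure.restrict_mono_set _ hsub)) fun s => ?_
      have := le_of_abs_le (abs_inner_le_half (coef (y s) p.1 p.2) (coef (q s) p.1 p.2))
      linarith
    rw [hm]
    linarith
  have hc : ∀ p : (Fin 3 → ℤ) × Fin 3,
      ContinuousWithinAt (fun τ => coef (x τ) p.1 p.2) (Icc 0 T) t := by
    intro p
    have h1 := continuousOn_primitive hT
      (MemLp.intervalIntegrable (memLp_coef h.memLp_deriv p.1 p.2) (right_mem_Icc.2 hT))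
      (fun s hs => h.coef_eq_integral p.1 p.2 hs) t ht
    have h2 := (continuousWithinAt_const (b := ((lam L p.1 ^ (1 / 2 : ℝ) : ℝ) : ℂ))).mul h1
    refine h2.congr (fun s _ => ?_) ?_ <;>
    · rw [Pi.mul_apply, coef_Dop, ← mul_assoc, ← Complex.ofReal_mul,
        ← Real.rpow_add (lam_pos hL _)]
      simp
  rw [ContinuousWithinAt, tendsto_iff_norm_sub_tendsto_zero]
  have h1 : Tendsto (fun τ => ∑' p : (Fin 3 → ℤ) × Fin 3, ‖coef (x τ - x t) p.1 p.2‖ ^ 2)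
      (𝓝[Icc 0 T] t) (𝓝 (∑' _ : (Fin 3 → ℤ) × Fin 3, (0 : ℝ))) := by
    refine tendsto_tsum_of_dominated_convergence (hms.mul_left 4) (fun p => ?_) ?_
    · have h2 := ((hc p).sub (continuousWithinAt_const (b := coef (x t) p.1 p.2))).norm.pow 2
      simpa [ContinuousWithinAt, Pi.pow_def] using h2
    · filter_upwards [self_mem_nhdsWithin] with τ hτ p
      rw [Real.norm_of_nonneg (sq_nonneg _)]
      have h2 := hbound τ hτ p
      have h3 := hbound t ht p
      have h4 : ‖coef (x τ - x t) p.1 p.2‖ ≤ ‖coef (x τ) p.1 p.2‖ + ‖coef (x t) p.1 p.2‖ :=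
        norm_sub_le _ _
      nlinarith [norm_nonneg (coef (x τ - x t) p.1 p.2), norm_nonneg (coef (x τ) p.1 p.2),
        norm_nonneg (coef (x t) p.1 p.2), sq_nonneg (‖coef (x τ) p.1 p.2‖ - ‖coef (x t) p.1 p.2‖)]
  simp only [(hasSum_norm_sq _).tsum_eq, tsum_zero] at h1
  have h2 := h1.sqrt
  simpa using h2

end Evol

lemma memLp_exp_smul {E : Type*} [NormedAddCommGroup E] [NormedSpace ℝ E] {T : ℝ} {y : ℝ → E}
    (c : ℝ) (hy : MemLp y 2 (volume.restrict (Ioc 0 T))) :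
    MemLp (fun t => Real.exp (c * t) • y t) 2 (volume.restrict (Ioc 0 T)) := by
  have hc : Continuous fun t => Real.exp (c * t) := by fun_prop
  refine hy.of_le_mul (c := Real.exp (|c| * T)) (hc.aestronglyMeasurable.smul hy.1) ?_
  filter_upwards [ae_restrict_mem measurableSet_Ioc] with t ht
  rw [norm_smul, Real.norm_of_nonneg (Real.exp_pos _).le]
  refine mul_le_mul_of_nonneg_right (Real.exp_le_exp.2 ?_) (norm_nonneg _)
  exact (mul_le_mul_of_nonneg_right (le_abs_self c) ht.1.le).trans
    (mul_le_mul_of_nonneg_left ht.2 (abs_nonneg c))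

/-- Multiplication of a curve by `exp (c t)`. -/
lemma Evol.exp_smul {L : ℝ} {hL : 0 < L} {T : ℝ} {x y q : ℝ → Hsp} (h : Evol hL T x y q) (c : ℝ) :
    Evol hL T (fun t => Real.exp (c * t) • x t) (fun t => Real.exp (c * t) • y t)
      (fun t => Real.exp (c * t) • (q t + c • Dop hL (Dop hL (y t)))) := by
  have hq : MemLp (fun t => Real.exp (c * t) • (q t + c • Dop hL (Dop hL (y t)))) 2
      (volume.restrict (Ioc 0 T)) := memLp_exp_smul c (h.memLp_deriv.add
      (((Dop hL).comp_memLp' ((Dop hL).comp_memLp' h.memLp)).const_smul c))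
  refine ⟨memLp_exp_smul c h.memLp, hq, ?_, fun t ht => ?_⟩
  · filter_upwards [h.ae_eq] with t ht
    rw [ht, map_smul]
  · ext K i
    rw [coef_add, Pi.add_apply, Pi.add_apply, ← coefL_apply K i (∫ s in (0 : ℝ)..t, _),
      ← (coefL K i).intervalIntegral_comp_comm (MemLp.intervalIntegrable hq ht)]
    have h1 := exp_mul_primitive ht.1 c
      (MemLp.intervalIntegrable (memLp_coef h.memLp_deriv K i) ht)
      (fun s hs => h.coef_eq_integral K i ⟨hs.1, hs.2.trans ht.2⟩)
    simp only [map_smul, coef_smul, Pi.smul_apply, Complex.real_smul]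
    rw [h1]
    congr 1
    refine intervalIntegral.integral_congr_ae ?_
    rw [uIoc_of_le ht.1, ← ae_restrict_iff' measurableSet_Ioc]
    filter_upwards [ae_restrict_Ioc_mono h.ae_eq ht] with s hs
    simp [hs]

/-! ### The linear Stokes problem -/

/-- Duhamel's formula for the solution of `W' + μ W = r`, `W(0) = W₀`. -/
def duhamel (μ : ℝ) (r : ℝ → ℂ) (W₀ : ℂ) (t : ℝ) : ℂ :=
  (Real.exp (-μ * t) : ℂ) * (W₀ + ∫ s in (0 : ℝ)..t, (Real.exp (μ * s) : ℂ) * r s)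

section Duhamel
variable {μ T : ℝ} {r : ℝ → ℂ} {W₀ : ℂ}

lemma duhamel_zero (μ : ℝ) (r : ℝ → ℂ) (W₀ : ℂ) : duhamel μ r W₀ 0 = W₀ := by simp [duhamel]

lemma memLp_exp_mul {T : ℝ} {r : ℝ → ℂ} (c : ℝ) (hr : MemLp r 2 (volume.restrict (Ioc 0 T))) :
    MemLp (fun t => (Real.exp (c * t) : ℂ) * r t) 2 (volume.restrict (Ioc 0 T)) := by
  simpa only [Complex.real_smul] using memLp_exp_smul c hr

lemma duhamel_eq_integral (hr : MemLp r 2 (volume.restrict (Ioc 0 T))) {t : ℝ} (ht : t ∈ Icc 0 T) :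
    duhamel μ r W₀ t = duhamel μ r W₀ 0 + ∫ s in (0 : ℝ)..t, (r s - μ * duhamel μ r W₀ s) := by
  have h1 := exp_mul_primitive (f := fun t => W₀ + ∫ s in (0 : ℝ)..t, (Real.exp (μ * s) : ℂ) * r s)
    ht.1 (-μ) (MemLp.intervalIntegrable (memLp_exp_mul μ hr) ht) (fun s hs => by simp)
  rw [duhamel, h1, duhamel]
  congr 1
  refine intervalIntegral.integral_congr fun s _ => ?_
  simp only [duhamel, mul_add, ← mul_assoc, ← Complex.ofReal_mul, ← Real.exp_add]
  simp
  ring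

lemma continuousOn_duhamel (hr : MemLp r 2 (volume.restrict (Ioc 0 T))) :
    ContinuousOn (duhamel μ r W₀) (Icc 0 T) := by
  by_cases hT : 0 ≤ T
  · have h1 : IntervalIntegrable (fun t => (Real.exp (μ * t) : ℂ) * r t) volume 0 T :=
      MemLp.intervalIntegrable (memLp_exp_mul μ hr) (right_mem_Icc.2 hT)
    have h2 := intervalIntegral.continuousOn_primitive_interval' h1 left_mem_uIcc
    rw [uIcc_of_le hT] at h2
    exact (Continuous.continuousOn (by fun_prop)).mul (continuousOn_const.add h2)
  · rw [Icc_eq_empty hT]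
    exact continuousOn_empty _

lemma memLp_duhamel (hr : MemLp r 2 (volume.restrict (Ioc 0 T))) :
    MemLp (duhamel μ r W₀) 2 (volume.restrict (Ioc 0 T)) := by
  have hc := continuousOn_duhamel (μ := μ) (W₀ := W₀) hr
  obtain ⟨C, hC⟩ := isCompact_Icc.exists_bound_of_continuousOn hc
  refine MemLp.of_bound ((hc.mono Ioc_subset_Icc_self).aestronglyMeasurable measurableSet_Ioc) C ?_
  filter_upwards [ae_restrict_mem measurableSet_Ioc] with t ht
  exact hC t (Ioc_subset_Icc_self ht)

/-- The energy inequality for a single Fourier mode. -/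
lemma duhamel_energy (hμ : 0 < μ) (hr : MemLp r 2 (volume.restrict (Ioc 0 T))) {t : ℝ}
    (ht : t ∈ Icc 0 T) :
    ‖duhamel μ r W₀ t‖ ^ 2 + μ * ∫ s in Ioc 0 t, ‖duhamel μ r W₀ s‖ ^ 2 ≤
      ‖W₀‖ ^ 2 + μ⁻¹ * ∫ s in Ioc 0 T, ‖r s‖ ^ 2 := by
  have hW := memLp_duhamel (μ := μ) (W₀ := W₀) hr
  have hg : MemLp (fun s => r s - μ * duhamel μ r W₀ s) 2 (volume.restrict (Ioc 0 T)) :=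
    hr.sub (hW.const_mul _)
  have h1 := norm_sq_sub_norm_sq_eq_integral ht.1 (MemLp.intervalIntegrable hg ht)
    (fun s hs => duhamel_eq_integral hr ⟨hs.1, hs.2.trans ht.2⟩)
  rw [duhamel_zero, intervalIntegral.integral_of_le ht.1] at h1
  have hWi := integrable_norm_sq (MemLp.restrict_Ioc hW ht)
  have hri := integrable_norm_sq (MemLp.restrict_Ioc hr ht)
  have h2 : ∫ s in Ioc 0 t, 2 * inner ℝ (duhamel μ r W₀ s) (r s - μ * duhamel μ r W₀ s) ≤
      ∫ s in Ioc 0 t, (μ⁻¹ * ‖r s‖ ^ 2 - μ * ‖duhamel μ r W₀ s‖ ^ 2) := by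
    refine integral_mono ((integrable_inner_of_memLp (MemLp.restrict_Ioc hW ht)
      (MemLp.restrict_Ioc hg ht)).const_mul 2) ((hri.const_mul _).sub (hWi.const_mul _)) fun s => ?_
    have h3 := le_of_abs_le (abs_real_inner_le_norm (duhamel μ r W₀ s) (r s))
    simp only
    rw [inner_sub_right, ← Complex.real_smul, real_inner_smul_right, real_inner_self_eq_norm_sq]
    have h4 : 0 ≤ μ⁻¹ * (‖r s‖ - μ * ‖duhamel μ r W₀ s‖) ^ 2 := by positivity
    have h5 : μ⁻¹ * (‖r s‖ - μ * ‖duhamel μ r W₀ s‖) ^ 2 = μ⁻¹ * ‖r s‖ ^ 2 -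
        2 * (‖duhamel μ r W₀ s‖ * ‖r s‖) + μ * ‖duhamel μ r W₀ s‖ ^ 2 := by
      field_simp
      ring
    linarith
  rw [integral_sub (hri.const_mul _) (hWi.const_mul _)] at h2
  simp only [integral_const_mul] at h1 h2
  have h6 : ∫ s in Ioc 0 t, ‖r s‖ ^ 2 ≤ ∫ s in Ioc 0 T, ‖r s‖ ^ 2 :=
    setIntegral_mono_set (integrable_norm_sq hr) (Eventually.of_forall fun s => sq_nonneg _)
      (Ioc_subset_Ioc_right ht.2).eventuallyLE
  have h7 := mul_le_mul_of_nonneg_left h6 (inv_pos.2 hμ).le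
  linarith

end Duhamel

/-- Solvability of the linear Stokes problem `dw/dt + ν A w + γ w = ρ`, with maximal regularity.
Each Fourier mode is given by Duhamel's formula; its energy inequality, multiplied by the
eigenvalue, is summable over the frequencies. -/
lemma exists_evol_linear {L : ℝ} (hL : 0 < L) {T : ℝ} (hT : 0 ≤ T) {ν γ : ℝ} (hν : 0 < ν)
    (hγ : 0 ≤ γ) {ρ : ℝ → Hsp} (hρ : MemLp ρ 2 (volume.restrict (Ioc 0 T))) (x₀ : Hsp) :
    ∃ x y, Evol hL T x y (fun t => ρ t - (ν • y t + γ • Dop hL (Dop hL (y t)))) ∧ x 0 = x₀ := by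
  classical
  have hlam := lam_pos hL
  set μ : (Fin 3 → ℤ) → ℝ := fun K => ν * lam L K + γ with hμd
  have hμ : ∀ K, 0 < μ K := fun K => add_pos_of_pos_of_nonneg (mul_pos hν (hlam K)) hγ
  have hνμ : ∀ K, ν * lam L K ≤ μ K := fun K => le_add_of_nonneg_right hγ
  set W₀ : Field := coef (Dop hL x₀) with hW₀
  set W : ℝ → Field := fun t K i => duhamel (μ K) (fun s => coef (ρ s) K i) (W₀ K i) t with hW
  have hr : ∀ K i, MemLp (fun s => coef (ρ s) K i) 2 (volume.restrict (Ioc 0 T)) :=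
    fun K i => memLp_coef hρ K i
  have hW0 : ∀ t, W t 0 = 0 := by
    intro t
    funext i
    simp [hW, duhamel, hW₀, (isCoef (Dop hL x₀)).zero, (isCoef (ρ _)).zero]
  have hWc : ∀ t K i, (starRingEnd ℂ) (W t K i) = W t (-K) i := by
    intro t K i
    simp only [hW, duhamel, map_mul, map_add, Complex.conj_ofReal, hW₀, (isCoef (Dop hL x₀)).conj,
      hμd, lam_neg]
    congr 2
    simp only [intervalIntegral, map_sub, ← integral_conj, map_mul, Complex.conj_ofReal,
      (isCoef (ρ _)).conj]
  have hWd : ∀ t ∈ Icc 0 T, ∀ K, ∑ i, (K i : ℂ) * W t K i = 0 := by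
    intro t ht K
    have h1 : ∀ i ∈ Finset.univ, IntervalIntegrable
        (fun s => (K i : ℂ) * ((Real.exp (μ K * s) : ℂ) * coef (ρ s) K i)) volume 0 t :=
      fun i _ => (MemLp.intervalIntegrable (memLp_exp_mul (μ K) (hr K i)) ht).const_mul _
    have h2 := intervalIntegral.integral_finsetSum h1
    have h3 : ∀ s, ∑ i, (K i : ℂ) * ((Real.exp (μ K * s) : ℂ) * coef (ρ s) K i) = 0 := by
      intro s
      have := (isCoef (ρ s)).div K
      calc _ = (Real.exp (μ K * s) : ℂ) * ∑ i, (K i : ℂ) * coef (ρ s) K i := by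
            rw [Finset.mul_sum]
            exact Finset.sum_congr rfl fun i _ => by ring
        _ = 0 := by rw [this, mul_zero]
    simp only [h3, intervalIntegral.integral_zero, intervalIntegral.integral_const_mul] at h2
    have h4 := (isCoef (Dop hL x₀)).div K
    calc _ = (Real.exp (-μ K * t) : ℂ) * (∑ i, (K i : ℂ) * W₀ K i + ∑ i, (K i : ℂ) *
          ∫ s in (0 : ℝ)..t, (Real.exp (μ K * s) : ℂ) * coef (ρ s) K i) := by
          rw [← Finset.sum_add_distrib, Finset.mul_sum]
          exact Finset.sum_congr rfl fun i _ => by simp only [hW, duhamel]; ring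
      _ = 0 := by rw [← h2, hW₀, h4]; simp
  have hWm : ∀ K i, MemLp (fun t => W t K i) 2 (volume.restrict (Ioc 0 T)) := fun K i =>
    memLp_duhamel (hr K i)
  -- the energy inequality for each mode, multiplied by `λ_K`
  have hen : ∀ K i, ∀ t ∈ Icc 0 T, lam L K * ‖W t K i‖ ^ 2 + ν * (lam L K ^ 2 *
      ∫ s in Ioc 0 t, ‖W s K i‖ ^ 2) ≤
      ‖coef x₀ K i‖ ^ 2 + ν⁻¹ * ∫ s in Ioc 0 T, ‖coef (ρ s) K i‖ ^ 2 := by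
    intro K i t ht
    have h1 := duhamel_energy (W₀ := W₀ K i) (hμ K) (hr K i) ht
    have h2 : lam L K * ‖W₀ K i‖ ^ 2 = ‖coef x₀ K i‖ ^ 2 := by
      rw [hW₀, coef_Dop, show (-(1 / 2) : ℝ) = (-1) / 2 by norm_num, norm_rpow_mul_sq hL,
        Real.rpow_neg_one, mul_inv_cancel_left₀ (hlam K).ne']
    have hI : 0 ≤ ∫ s in Ioc 0 T, ‖coef (ρ s) K i‖ ^ 2 := integral_nonneg fun _ => sq_nonneg _
    have hJ : 0 ≤ ∫ s in Ioc 0 t, ‖W s K i‖ ^ 2 := integral_nonneg fun _ => sq_nonneg _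
    have h3 := mul_le_mul_of_nonneg_left h1 (hlam K).le
    have h4 : lam L K * (μ K)⁻¹ ≤ ν⁻¹ := by
      rw [← div_eq_mul_inv, div_le_iff₀ (hμ K), inv_mul_eq_div, le_div_iff₀ hν]
      linarith [hνμ K]
    have h5 := mul_le_mul_of_nonneg_right h4 hI
    have h6 := mul_le_mul_of_nonneg_right (mul_le_mul_of_nonneg_left (hνμ K) (hlam K).le) hJ
    change lam L K * (‖W t K i‖ ^ 2 + μ K * ∫ s in Ioc 0 t, ‖W s K i‖ ^ 2) ≤ _ at h3
    nlinarith
  have hsum : Summable fun p : (Fin 3 → ℤ) × Fin 3 => ‖coef x₀ p.1 p.2‖ ^ 2 +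
      ν⁻¹ * ∫ s in Ioc 0 T, ‖coef (ρ s) p.1 p.2‖ ^ 2 :=
    (hasSum_norm_sq x₀).summable.add ((hasSum_integral_norm_coef_sq hρ).summable.mul_left _)
  have hsc : ∀ (r : ℝ) t, t ∈ Icc 0 T → ∀ K,
      ∑ i, (K i : ℂ) * (((lam L K ^ r : ℝ) : ℂ) * W t K i) = 0 := by
    intro r t ht K
    calc _ = ((lam L K ^ r : ℝ) : ℂ) * ∑ i, (K i : ℂ) * W t K i := by
          rw [Finset.mul_sum]
          exact Finset.sum_congr rfl fun i _ => by ring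
      _ = 0 := by rw [hWd t ht, mul_zero]
  have hX : ∀ t ∈ Icc 0 T, IsCoef fun K i => ((lam L K ^ (1 / 2 : ℝ) : ℝ) : ℂ) * W t K i := by
    intro t ht
    refine ⟨funext fun i => by simp [hW0], fun K i => by simp [hWc, lam_neg], hsc _ t ht, ?_⟩
    refine Summable.of_nonneg_of_le (fun _ => sq_nonneg _) (fun p => ?_) hsum
    rw [norm_rpow_mul_sq hL, Real.rpow_one]
    have h1 := hen p.1 p.2 t ht
    have h2 : 0 ≤ ν * (lam L p.1 ^ 2 * ∫ s in Ioc 0 t, ‖W s p.1 p.2‖ ^ 2) := by positivity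
    linarith
  obtain ⟨y, hym, hy⟩ := exists_memLp_of_coef (μ := volume.restrict (Ioc 0 T))
    (u := fun t K i => ((lam L K ^ (1 : ℝ) : ℝ) : ℂ) * W t K i)
    (fun K i => (hWm K i).const_mul _) (Eventually.of_forall fun t => funext fun i => by simp [hW0])
    (Eventually.of_forall fun t K i => by simp [hWc, lam_neg])
    (by filter_upwards [ae_restrict_mem measurableSet_Ioc] with t ht
        exact hsc 1 t (Ioc_subset_Icc_self ht))
    (by
      refine Summable.of_nonneg_of_le (fun _ => integral_nonneg fun _ => sq_nonneg _) (fun p => ?_)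
        (hsum.mul_left ν⁻¹)
      simp only [norm_mul, mul_pow, Complex.norm_real, Real.rpow_one, Real.norm_eq_abs, sq_abs]
      rw [integral_const_mul]
      have h1 := hen p.1 p.2 T (right_mem_Icc.2 hT)
      have h2 : 0 ≤ lam L p.1 * ‖W T p.1 p.2‖ ^ 2 := mul_nonneg (hlam _).le (sq_nonneg _)
      rw [inv_mul_eq_div, le_div_iff₀ hν]
      linarith)
  set x : ℝ → Hsp := fun t =>
    if h : IsCoef fun K i => ((lam L K ^ (1 / 2 : ℝ) : ℝ) : ℂ) * W t K i then Hsp.mk _ h else 0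
    with hx
  have hxc : ∀ t ∈ Icc 0 T, ∀ K i,
      coef (x t) K i = ((lam L K ^ (1 / 2 : ℝ) : ℝ) : ℂ) * W t K i := by
    intro t ht K i
    simp only [hx, dif_pos (hX t ht), coef_mk]
  have hDx : ∀ t ∈ Icc 0 T, ∀ K i, coef (Dop hL (x t)) K i = W t K i := by
    intro t ht K i
    rw [coef_Dop, hxc t ht, ← mul_assoc, ← Complex.ofReal_mul, ← Real.rpow_add (hlam K)]
    simp
  have hq : MemLp (fun t => ρ t - (ν • y t + γ • Dop hL (Dop hL (y t)))) 2
      (volume.restrict (Ioc 0 T)) := hρ.sub ((hym.const_smul ν).add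
        (((Dop hL).comp_memLp' ((Dop hL).comp_memLp' hym)).const_smul γ))
  refine ⟨x, y, ⟨hym, hq, ?_, fun t ht => ?_⟩, ?_⟩
  · filter_upwards [hy, ae_restrict_mem measurableSet_Ioc] with t ht hmem
    ext K i
    rw [hxc t (Ioc_subset_Icc_self hmem), coef_Dop, ht, ← mul_assoc, ← Complex.ofReal_mul,
      ← Real.rpow_add (hlam K)]
    norm_num
  · ext K i
    rw [coef_add, Pi.add_apply, Pi.add_apply, ← coefL_apply K i (∫ s in (0 : ℝ)..t, _),
      ← (coefL K i).intervalIntegral_comp_comm (MemLp.intervalIntegrable hq ht), hDx t ht,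
      hDx 0 (left_mem_Icc.2 hT)]
    change duhamel _ _ _ _ = _
    rw [duhamel_eq_integral (hr K i) ht]
    congr 1
    refine intervalIntegral.integral_congr_ae ?_
    rw [uIoc_of_le ht.1, ← ae_restrict_iff' measurableSet_Ioc]
    filter_upwards [ae_restrict_Ioc_mono hy ht] with s hs
    simp only [coefL_apply, coef_sub, coef_add, coef_smul, Pi.sub_apply, Pi.add_apply,
      Pi.smul_apply, coef_Dop_Dop, hs, Real.rpow_one, Complex.real_smul]
    change _ - (μ K : ℂ) * W s K i = _
    rw [← mul_assoc (((lam L K)⁻¹ : ℝ) : ℂ), ← Complex.ofReal_mul, inv_mul_cancel₀ (hlam K).ne']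
    simp only [hμd]
    push_cast
    ring
  · apply Dop_injective hL
    ext K i
    rw [hDx 0 (left_mem_Icc.2 hT)]
    exact duhamel_zero _ _ _

/-! ### Energy estimates -/

/-- `(A⁻¹ + β²) y`: with `y = A w` this is `(I + β² A) w`, the field against which the equation for
`w` is tested. -/
def testOp {L : ℝ} (hL : 0 < L) (β : ℝ) : Hsp →L[ℝ] Hsp :=
  (Dop hL).comp (Dop hL) + β ^ 2 • ContinuousLinearMap.id ℝ Hsp

/-- `J` acts like interpolation of `A⁻¹ y`, with the error bound `a ‖∇ A⁻¹ y‖ + b ‖y‖`. -/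
def IsInterpolation {L : ℝ} (hL : 0 < L) (J : Hsp →L[ℝ] Hsp) (a b : ℝ) : Prop :=
  ∀ y, ‖J y - Dop hL (Dop hL y)‖ ≤ a * ‖Dop hL y‖ + b * ‖y‖

section Energy
variable {L : ℝ} (hL : 0 < L)

lemma testOp_apply (β : ℝ) (y : Hsp) :
    testOp hL β y = Dop hL (Dop hL y) + β ^ 2 • y := rfl

lemma norm_testOp_le (β : ℝ) (y : Hsp) : ‖testOp hL β y‖ ≤ normD L * ‖Dop hL y‖ + β ^ 2 * ‖y‖ := by
  rw [testOp_apply]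
  refine (norm_add_le _ _).trans (add_le_add (norm_Dop_le hL _) ?_)
  rw [norm_smul, Real.norm_of_nonneg (sq_nonneg β)]

lemma norm_testOp_le' (β : ℝ) (y : Hsp) : ‖testOp hL β y‖ ≤ (normD L ^ 2 + β ^ 2) * ‖y‖ := by
  have h1 := norm_testOp_le hL β y
  have h2 := mul_le_mul_of_nonneg_left (norm_Dop_le hL y) (normD_pos hL).le
  linarith

/-- The lower-order constant in the coercivity estimate. -/
def coerConst (L ν β η a b : ℝ) : ℝ :=
  (η * (a * β ^ 2 + b * normD L)) ^ 2 / (ν * β ^ 2) + η * a * normD L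

/-- Coercivity of the linear part. The condition `η b ≤ ν / 2` lets the viscous term absorb the
highest-order part of the interpolation error; the rest is of lower order. -/
lemma coercive {ν β η a b : ℝ} (hν : 0 < ν) (hβ : 0 < β) (hη : 0 ≤ η)
    {J : Hsp →L[ℝ] Hsp} (hJ : IsInterpolation hL J a b) (hb : η * b ≤ ν / 2) (y : Hsp) :
    ν * β ^ 2 / 4 * ‖y‖ ^ 2 - coerConst L ν β η a b * ‖Dop hL y‖ ^ 2 ≤
      inner ℝ (ν • y + η • J y) (testOp hL β y) := by
  set D := Dop hL with hD
  have e1 : inner ℝ y (D (D y)) = ‖D y‖ ^ 2 := by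
    rw [← inner_Dop_left, real_inner_self_eq_norm_sq]
  have e2 : inner ℝ (D (D y)) y = ‖D y‖ ^ 2 := by rw [real_inner_comm, e1]
  have e3 : J y = D (D y) + (J y - D (D y)) := by abel
  have h1 : inner ℝ (ν • y + η • J y) (testOp hL β y) =
      ν * (‖D y‖ ^ 2 + β ^ 2 * ‖y‖ ^ 2) + η * (‖D (D y)‖ ^ 2 + β ^ 2 * ‖D y‖ ^ 2) +
        η * inner ℝ (J y - D (D y)) (testOp hL β y) := by
    conv_lhs => rw [e3]
    rw [inner_add_left, smul_add, inner_add_left, real_inner_smul_left, real_inner_smul_left,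
      real_inner_smul_left, testOp_apply, inner_add_right, inner_add_right, real_inner_smul_right,
      real_inner_smul_right, real_inner_self_eq_norm_sq, e1, e2, real_inner_self_eq_norm_sq]
    ring
  have h2 : -((a * ‖D y‖ + b * ‖y‖) * (normD L * ‖D y‖ + β ^ 2 * ‖y‖)) ≤
      inner ℝ (J y - D (D y)) (testOp hL β y) := by
    have h3 := abs_real_inner_le_norm (J y - D (D y)) (testOp hL β y)
    have h4 : ‖J y - D (D y)‖ * ‖testOp hL β y‖ ≤
        (a * ‖D y‖ + b * ‖y‖) * (normD L * ‖D y‖ + β ^ 2 * ‖y‖) :=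
      mul_le_mul (hJ y) (norm_testOp_le hL β y) (norm_nonneg _) ((norm_nonneg _).trans (hJ y))
    exact (neg_le_neg (h3.trans h4)).trans (neg_abs_le _)
  rw [h1]
  have h5 := mul_le_mul_of_nonneg_left h2 hη
  have h6 : η * b * (β ^ 2 * ‖y‖ ^ 2) ≤ ν / 2 * (β ^ 2 * ‖y‖ ^ 2) :=
    mul_le_mul_of_nonneg_right hb (by positivity)
  -- Young's inequality for the mixed term `‖D y‖ ‖y‖`
  have h7 : η * (a * β ^ 2 + b * normD L) * (‖D y‖ * ‖y‖) ≤ ν * β ^ 2 / 4 * ‖y‖ ^ 2 +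
      (η * (a * β ^ 2 + b * normD L)) ^ 2 / (ν * β ^ 2) * ‖D y‖ ^ 2 := by
    have hνβ : 0 < ν * β ^ 2 := by positivity
    set s := η * (a * β ^ 2 + b * normD L)
    have h8 : 0 ≤ (ν * β ^ 2 / 2 * ‖y‖ - s * ‖D y‖) ^ 2 / (ν * β ^ 2) := by positivity
    have h9 : (ν * β ^ 2 / 2 * ‖y‖ - s * ‖D y‖) ^ 2 / (ν * β ^ 2) = ν * β ^ 2 / 4 * ‖y‖ ^ 2 +
      s ^ 2 / (ν * β ^ 2) * ‖D y‖ ^ 2 - s * (‖D y‖ * ‖y‖) := by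
      field_simp
      ring
    linarith
  have h10 : 0 ≤ ν * ‖D y‖ ^ 2 := by positivity
  have h11 : 0 ≤ η * (‖D (D y)‖ ^ 2 + β ^ 2 * ‖D y‖ ^ 2) := by positivity
  unfold coerConst
  linarith

/-- The energy estimate for curves that solve the equation up to a perturbation controlled by `k`
and `s`: coercivity absorbs the highest-order part, and Gronwall's inequality the rest. -/
lemma Evol.energy_bound {T ν β η a b : ℝ} (hν : 0 < ν) (hβ : 0 < β)
    (hη : 0 ≤ η) (ha : 0 ≤ a) {J : Hsp →L[ℝ] Hsp} (hJ : IsInterpolation hL J a b)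
    (hb : η * b ≤ ν / 2) {x y q : ℝ → Hsp} (h : Evol hL T x y q) {k s : ℝ → ℝ}
    (hk : IntegrableOn k (Ioc 0 T)) (hk0 : ∀ t, 0 ≤ k t) (hs : IntegrableOn s (Ioc 0 T))
    (hs0 : ∀ t, 0 ≤ s t)
    (hq : ∀ᵐ t ∂volume.restrict (Ioc 0 T),
      2 * inner ℝ (q t + (ν • y t + η • J (y t))) (testOp hL β (y t)) ≤
        ν * β ^ 2 / 4 * ‖y t‖ ^ 2 + k t * ‖x t‖ ^ 2 + s t) {t : ℝ} (ht : t ∈ Icc 0 T) :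
    β ^ 2 * ‖x t‖ ^ 2 + ν * β ^ 2 / 4 * ∫ τ in Ioc 0 t, ‖y τ‖ ^ 2 ≤
      ((normD L ^ 2 + β ^ 2) * ‖x 0‖ ^ 2 + ∫ τ in Ioc 0 T, s τ) *
        Real.exp (∫ τ in Ioc 0 T, (k τ + 2 * coerConst L ν β η a b) / β ^ 2) := by
  set C := coerConst L ν β η a b with hC
  set κ := ν * β ^ 2 / 4 with hκ
  have hκ0 : 0 < κ := by positivity
  have hC0 : 0 ≤ C := by
    have := normD_pos hL
    rw [hC, coerConst]
    positivity
  have hβ2 : 0 < β ^ 2 := by positivity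
  have hT : (0 : ℝ) ≤ T := ht.1.trans ht.2
  -- the energy of `w` in `H` and `V` together with the dissipation, to which Gronwall applies
  set φ : ℝ → ℝ := fun t => ‖Dop hL (x t)‖ ^ 2 + β ^ 2 * ‖x t‖ ^ 2 +
    κ * ∫ τ in (0 : ℝ)..t, ‖y τ‖ ^ 2 with hφ
  have hcx := h.continuousOn
  have hy2 := integrable_norm_sq h.memLp
  have hφc : ContinuousOn φ (Icc 0 T) := by
    have h1 : IntervalIntegrable (fun τ => ‖y τ‖ ^ 2) volume 0 T := by
      rw [intervalIntegrable_iff_integrableOn_Ioc_of_le hT]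
      exact hy2
    have h2 := intervalIntegral.continuousOn_primitive_interval' h1 left_mem_uIcc
    rw [uIcc_of_le hT] at h2
    exact ((((Dop hL).continuous.comp_continuousOn hcx).norm.pow 2).add
      (continuousOn_const.mul (hcx.norm.pow 2))).add (continuousOn_const.mul h2)
  have hφx : ∀ t ∈ Icc 0 T, β ^ 2 * ‖x t‖ ^ 2 ≤ φ t := by
    intro t ht
    have h1 : 0 ≤ ∫ τ in (0 : ℝ)..t, ‖y τ‖ ^ 2 :=
      intervalIntegral.integral_nonneg ht.1 fun _ _ => sq_nonneg _
    have h2 : 0 ≤ κ * ∫ τ in (0 : ℝ)..t, ‖y τ‖ ^ 2 := by positivity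
    have h3 := sq_nonneg ‖Dop hL (x t)‖
    rw [hφ]
    linarith
  set k' : ℝ → ℝ := fun τ => (k τ + 2 * C) / β ^ 2 with hk'
  have hk'0 : ∀ t, 0 ≤ k' t := fun t => div_nonneg (by linarith [hk0 t]) hβ2.le
  have hk'i : IntegrableOn k' (Ioc 0 T) :=
    (hk.add (integrableOn_const (by simp))).div_const _
  have hsub : ∀ t ∈ Icc 0 T, Ioc 0 t ⊆ Ioc 0 T := fun t ht => Ioc_subset_Ioc_right ht.2
  have hk'φ : IntegrableOn (fun τ => k' τ * φ τ) (Ioc 0 T) := by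
    obtain ⟨M, hM⟩ := isCompact_Icc.exists_bound_of_continuousOn hφc
    refine Integrable.mul_bdd (c := M) hk'i
      ((hφc.mono Ioc_subset_Icc_self).aestronglyMeasurable measurableSet_Ioc) ?_
    filter_upwards [ae_restrict_mem measurableSet_Ioc] with t ht
    exact hM t (Ioc_subset_Icc_self ht)
  have hsT : 0 ≤ ∫ τ in Ioc 0 T, s τ := integral_nonneg hs0
  set c := φ 0 + ∫ τ in Ioc 0 T, s τ with hc
  have hφ0 : φ 0 ≤ (normD L ^ 2 + β ^ 2) * ‖x 0‖ ^ 2 := by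
    have h1 := pow_le_pow_left₀ (norm_nonneg _) (norm_Dop_le hL (x 0)) 2
    simp only [hφ, intervalIntegral.integral_same]
    nlinarith
  have hmain : ∀ t ∈ Icc 0 T, φ t ≤ c + ∫ τ in (0 : ℝ)..t, k' τ * φ τ := by
    intro t ht
    have hyt := MemLp.restrict_Ioc h.memLp ht
    have hqt := MemLp.restrict_Ioc h.memLp_deriv ht
    have h1 := h.norm_sq_eq ht
    have h2 := h.smooth.norm_sq_eq ht
    have hi1 := integrable_inner_of_memLp hyt hqt
    have hi2 := integrable_inner_of_memLp ((Dop hL).comp_memLp' hyt) ((Dop hL).comp_memLp' hqt)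
    have hi3 := integrable_norm_sq hyt
    have h3 : φ t = φ 0 + ∫ τ in Ioc 0 t, (2 * inner ℝ (Dop hL (y τ)) (Dop hL (q τ)) +
        β ^ 2 * (2 * inner ℝ (y τ) (q τ)) + κ * ‖y τ‖ ^ 2) := by
      have hi2' : Integrable (fun τ => inner ℝ (Dop hL (y τ)) (Dop hL (q τ)))
          (volume.restrict (Ioc 0 t)) := hi2
      rw [integral_add (f := fun τ => 2 * inner ℝ (Dop hL (y τ)) (Dop hL (q τ)) +
          β ^ 2 * (2 * inner ℝ (y τ) (q τ)))
          ((hi2'.const_mul 2).add ((hi1.const_mul 2).const_mul _)) (hi3.const_mul _),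
        integral_add (hi2'.const_mul 2) ((hi1.const_mul 2).const_mul _)]
      simp only [integral_const_mul, hφ, intervalIntegral.integral_same,
        intervalIntegral.integral_of_le ht.1]
      rw [h1, h2]
      ring
    have hst : IntegrableOn s (Ioc 0 t) := hs.mono_set (hsub t ht)
    have hkt : IntegrableOn (fun τ => k' τ * φ τ) (Ioc 0 t) := hk'φ.mono_set (hsub t ht)
    have h4 : ∫ τ in Ioc 0 t, (2 * inner ℝ (Dop hL (y τ)) (Dop hL (q τ)) +
        β ^ 2 * (2 * inner ℝ (y τ) (q τ)) + κ * ‖y τ‖ ^ 2) ≤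
        ∫ τ in Ioc 0 t, (s τ + k' τ * φ τ) := by
      refine integral_mono_ae (((hi2.const_mul 2).add ((hi1.const_mul 2).const_mul _)).add
        (hi3.const_mul _)) (hst.add hkt) ?_
      filter_upwards [ae_restrict_Ioc_mono hq ht, ae_restrict_Ioc_mono h.ae_eq ht,
        ae_restrict_mem measurableSet_Ioc] with τ h5 h6 h7
      have h8 := coercive hL hν hβ hη hJ hb (y τ)
      rw [inner_add_left] at h5
      have h9 : inner ℝ (q τ) (testOp hL β (y τ)) =
          inner ℝ (Dop hL (y τ)) (Dop hL (q τ)) + β ^ 2 * inner ℝ (y τ) (q τ) := by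
        rw [testOp_apply, inner_add_right, real_inner_smul_right, ← inner_Dop_left,
          real_inner_comm, real_inner_comm (y τ) (q τ)]
      rw [h9] at h5
      rw [← h6, ← hκ, ← hC] at h8
      have h10 : (k τ + 2 * C) * ‖x τ‖ ^ 2 ≤ k' τ * φ τ := by
        have h11 := mul_le_mul_of_nonneg_left (hφx τ ⟨h7.1.le, h7.2.trans ht.2⟩) (hk'0 τ)
        have h12 : k' τ * (β ^ 2 * ‖x τ‖ ^ 2) = (k τ + 2 * C) * ‖x τ‖ ^ 2 := by
          simp only [hk']
          field_simp
        linarith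
      linarith
    rw [integral_add hst hkt] at h4
    have h13 : ∫ τ in Ioc 0 t, s τ ≤ ∫ τ in Ioc 0 T, s τ :=
      setIntegral_mono_set hs (Eventually.of_forall hs0) (hsub t ht).eventuallyLE
    rw [intervalIntegral.integral_of_le ht.1, h3, hc]
    linarith
  have hint : ∀ {u : ℝ → ℝ}, IntegrableOn u (Ioc 0 T) → IntervalIntegrable u volume 0 t := by
    intro u hu
    rw [intervalIntegrable_iff_integrableOn_Ioc_of_le ht.1]
    exact hu.mono_set (hsub t ht)
  have hg := gronwall_integral ht.1 (hint hk'i) hk'0 (hint hk'φ)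
    (fun τ hτ => hmain τ ⟨hτ.1, hτ.2.trans ht.2⟩)
  have hφt : β ^ 2 * ‖x t‖ ^ 2 + κ * ∫ τ in Ioc 0 t, ‖y τ‖ ^ 2 ≤ φ t := by
    simp only [hφ, intervalIntegral.integral_of_le ht.1]
    linarith [sq_nonneg ‖Dop hL (x t)‖]
  refine hφt.trans (hg.trans ?_)
  have hexp : ∫ τ in (0 : ℝ)..t, k' τ ≤ ∫ τ in Ioc 0 T, k' τ := by
    rw [intervalIntegral.integral_of_le ht.1]
    exact setIntegral_mono_set hk'i (Eventually.of_forall hk'0) (hsub t ht).eventuallyLE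
  refine mul_le_mul (by rw [hc]; linarith) (Real.exp_le_exp.2 hexp) (Real.exp_pos _).le ?_
  have : 0 ≤ (normD L ^ 2 + β ^ 2) * ‖x 0‖ ^ 2 := by positivity
  linarith

end Energy

/-! ### Semilinear problems with Lipschitz nonlinearity -/

section Semilinear
variable {L : ℝ} (hL : 0 < L)

/-- Maximal regularity with constant one: `‖(ν A + γ) w‖ ≤ ‖dw/dt + ν A w + γ w‖` in `L²(0, T; H)`,
when `w(0) = 0`. -/
lemma Evol.integral_le_of_zero {T ν γ : ℝ} (hν : 0 ≤ ν) (hγ : 0 ≤ γ) (hT : 0 ≤ T)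
    {x y q ρ : ℝ → Hsp} (hρ : MemLp ρ 2 (volume.restrict (Ioc 0 T))) (h : Evol hL T x y q)
    (h0 : x 0 = 0)
    (hq : ∀ᵐ t ∂volume.restrict (Ioc 0 T), q t + (ν • y t + γ • Dop hL (Dop hL (y t))) = ρ t) :
    ∫ t in Ioc 0 T, ‖ν • y t + γ • Dop hL (Dop hL (y t))‖ ^ 2 ≤ ∫ t in Ioc 0 T, ‖ρ t‖ ^ 2 := by
  have hTm : T ∈ Icc 0 T := right_mem_Icc.2 hT
  have h1 := h.norm_sq_eq hTm
  have h2 := h.smooth.norm_sq_eq hTm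
  simp only [h0, map_zero, norm_zero] at h1 h2
  have hDy : MemLp (fun t => Dop hL (y t)) 2 (volume.restrict (Ioc 0 T)) :=
    (Dop hL).comp_memLp' h.memLp
  have hDq : MemLp (fun t => Dop hL (q t)) 2 (volume.restrict (Ioc 0 T)) :=
    (Dop hL).comp_memLp' h.memLp_deriv
  have hDDy : MemLp (fun t => Dop hL (Dop hL (y t))) 2 (volume.restrict (Ioc 0 T)) :=
    (Dop hL).comp_memLp' hDy
  set Y : ℝ → Hsp := fun t => ν • y t + γ • Dop hL (Dop hL (y t)) with hY
  have hYm : MemLp Y 2 (volume.restrict (Ioc 0 T)) := (h.memLp.const_smul ν).add (hDDy.const_smul γ)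
  have hi1 := integrable_inner_of_memLp h.memLp h.memLp_deriv
  have hi2 := integrable_inner_of_memLp hDy hDq
  have h3 : 0 ≤ ∫ t in Ioc 0 T, inner ℝ (Y t) (q t) := by
    have e : ∀ t, inner ℝ (Y t) (q t) = ν * inner ℝ (y t) (q t) +
        γ * inner ℝ (Dop hL (y t)) (Dop hL (q t)) := fun t => by
      rw [hY]
      simp only
      rw [inner_add_left, real_inner_smul_left, real_inner_smul_left, inner_Dop_left]
    simp only [e]
    rw [integral_add (hi1.const_mul ν) (hi2.const_mul γ), integral_const_mul, integral_const_mul]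
    have h4 : 0 ≤ ∫ t in Ioc 0 T, inner ℝ (y t) (q t) := by nlinarith [sq_nonneg ‖x T‖]
    have h5 : 0 ≤ ∫ t in Ioc 0 T, inner ℝ (Dop hL (y t)) (Dop hL (q t)) := by
      nlinarith [sq_nonneg ‖Dop hL (x T)‖]
    positivity
  have hiY := integrable_norm_sq hYm
  have hiρ := integrable_norm_sq hρ
  have h6 : ∫ t in Ioc 0 T, (2 * inner ℝ (Y t) (q t) + ‖Y t‖ ^ 2) ≤ ∫ t in Ioc 0 T, ‖ρ t‖ ^ 2 := by
    refine integral_mono_ae (((integrable_inner_of_memLp hYm h.memLp_deriv).const_mul 2).add hiY)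
      hiρ ?_
    filter_upwards [hq] with t ht
    have e : ‖q t + Y t‖ ^ 2 = ‖ρ t‖ ^ 2 := by rw [← ht]
    rw [norm_add_sq_real, real_inner_comm] at e
    nlinarith [sq_nonneg ‖q t‖]
  rw [integral_add ((integrable_inner_of_memLp hYm h.memLp_deriv).const_mul 2) hiY,
    integral_const_mul] at h6
  linarith

lemma Lp_norm_sq_eq_integral {T : ℝ} (f : Lp Hsp 2 (volume.restrict (Ioc 0 T))) :
    ‖f‖ ^ 2 = ∫ t in Ioc 0 T, ‖f t‖ ^ 2 := by
  rw [← real_inner_self_eq_norm_sq, L2.inner_def]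
  simp only [real_inner_self_eq_norm_sq]

/-- The norm of `ν y + γ A⁻¹ y` controls both the highest-order and the lower-order term. -/
lemma norm_add_sq_ge {ν γ : ℝ} (hν : 0 ≤ ν) (y : Hsp) :
    ν ^ 2 * ‖y‖ ^ 2 + 2 * ν * γ * ‖Dop hL y‖ ^ 2 ≤ ‖ν • y + γ • Dop hL (Dop hL y)‖ ^ 2 := by
  rw [norm_add_sq_real, real_inner_smul_left, real_inner_smul_right, ← inner_Dop_left,
    real_inner_self_eq_norm_sq, norm_smul, norm_smul, mul_pow, mul_pow, Real.norm_of_nonneg hν]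
  nlinarith [sq_nonneg (‖γ‖ * ‖Dop hL (Dop hL y)‖)]

/-- A problem `dw/dt + ν A w + 𝒢(A w) = g` is solvable on all of `[0, T]` when `𝒢` is Lipschitz with
constant `ν / 2` up to lower-order terms. The solution is found by the contraction principle, after
`w` is multiplied by a decaying exponential to make the lower-order terms small. -/
lemma exists_evol_semilinear {T ν c : ℝ} (hT : 0 ≤ T) (hν : 0 < ν) (hc : 0 ≤ c) {𝒢 : Hsp → Hsp}
    (h𝒢 : ∀ y y', ‖𝒢 y - 𝒢 y'‖ ≤ ν / 2 * ‖y - y'‖ + c * ‖Dop hL (y - y')‖) {g : ℝ → Hsp}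
    (hg : MemLp g 2 (volume.restrict (Ioc 0 T))) (x₀ : Hsp) :
    ∃ x y q, Evol hL T x y q ∧ x 0 = x₀ ∧
      ∀ᵐ t ∂volume.restrict (Ioc 0 T), q t = g t - ν • y t - 𝒢 (y t) := by
  -- with this `γ`, the cross term in `‖ν y + γ A⁻¹ y‖²` is `4 c² ‖A^(-1/2) y‖²`, which makes the
  -- contraction constant `√(1/2)`
  set γ : ℝ := 2 * c ^ 2 / ν with hγd
  have hγ : 0 ≤ γ := by positivity
  set C : ℝ := ν / 2 + c * normD L with hCd
  have hC : 0 ≤ C := by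
    have := normD_pos hL
    positivity
  have h𝒢' : ∀ y y', ‖𝒢 y - 𝒢 y'‖ ≤ C * ‖y - y'‖ := fun y y' => by
    have h1 := mul_le_mul_of_nonneg_left (norm_Dop_le hL (y - y')) hc
    have h2 := h𝒢 y y'
    rw [hCd]
    linarith
  have h𝒢c : Continuous 𝒢 := by
    refine (LipschitzWith.of_dist_le_mul (K := ⟨C, hC⟩) fun y y' => ?_).continuous
    rw [dist_eq_norm, dist_eq_norm]
    exact h𝒢' y y'
  have hcomp : ∀ {y : ℝ → Hsp}, MemLp y 2 (volume.restrict (Ioc 0 T)) →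
      MemLp (fun t => 𝒢 (y t)) 2 (volume.restrict (Ioc 0 T)) := by
    intro y hy
    have h1 : MemLp (fun t => 𝒢 (y t) - 𝒢 0) 2 (volume.restrict (Ioc 0 T)) := by
      refine hy.of_le_mul (c := C)
        ((h𝒢c.comp_aestronglyMeasurable hy.1).sub aestronglyMeasurable_const) ?_
      exact Eventually.of_forall fun t => by simpa using h𝒢' (y t) 0
    have h2 := h1.add (memLp_const (𝒢 0))
    refine h2.ae_eq (Eventually.of_forall fun t => ?_)
    simp
  choose X Y hE hX0 using fun ρ : Lp Hsp 2 (volume.restrict (Ioc 0 T)) =>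
    exists_evol_linear hL hT hν hγ (Lp.memLp ρ) x₀
  have hF : ∀ ρ, MemLp (fun t => Real.exp (-γ * t) • (g t - 𝒢 (Real.exp (γ * t) • Y ρ t))) 2
      (volume.restrict (Ioc 0 T)) := fun ρ =>
    memLp_exp_smul (-γ) (hg.sub (hcomp (memLp_exp_smul γ (hE ρ).memLp)))
  set Φ : Lp Hsp 2 (volume.restrict (Ioc 0 T)) → Lp Hsp 2 (volume.restrict (Ioc 0 T)) :=
    fun ρ => (hF ρ).toLp _ with hΦ
  have hΦL : LipschitzWith (Real.toNNReal (Real.sqrt (1 / 2))) Φ := by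
    refine LipschitzWith.of_dist_le_mul fun ρ ρ' => ?_
    rw [dist_eq_norm, dist_eq_norm]
    rw [Real.coe_toNNReal _ (Real.sqrt_nonneg _)]
    refine (sq_le_sq₀ (norm_nonneg _) (by positivity)).1 ?_
    rw [mul_pow, Real.sq_sqrt (by norm_num), Lp_norm_sq_eq_integral, Lp_norm_sq_eq_integral]
    have hd := (hE ρ).sub (hE ρ')
    have h1 := hd.integral_le_of_zero hL hν.le hγ hT (Lp.memLp (ρ - ρ'))
      (by simp [hX0]) (by
        filter_upwards [Lp.coeFn_sub ρ ρ'] with t ht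
        rw [ht]
        simp only [Pi.sub_apply, map_sub, smul_sub]
        abel)
    refine le_trans ?_ (mul_le_mul_of_nonneg_left h1 (by norm_num : (0 : ℝ) ≤ 1 / 2))
    have hYd : MemLp (fun t => (Y ρ - Y ρ') t) 2 (volume.restrict (Ioc 0 T)) := hd.memLp
    have hDD : MemLp (fun t => Dop hL (Dop hL ((Y ρ - Y ρ') t))) 2 (volume.restrict (Ioc 0 T)) :=
      (Dop hL).comp_memLp' ((Dop hL).comp_memLp' hYd)
    rw [← integral_const_mul]
    refine integral_mono_ae (integrable_norm_sq (Lp.memLp _))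
      ((integrable_norm_sq ((hYd.const_smul ν).add (hDD.const_smul γ))).const_mul _) ?_
    filter_upwards [Lp.coeFn_sub (Φ ρ) (Φ ρ'), (hF ρ).coeFn_toLp, (hF ρ').coeFn_toLp]
      with t e1 e2 e3
    rw [e1, Pi.sub_apply, hΦ]
    simp only
    rw [e2, e3, ← smul_sub]
    set z := (Y ρ - Y ρ') t with hz
    have h2 := h𝒢 (Real.exp (γ * t) • Y ρ' t) (Real.exp (γ * t) • Y ρ t)
    rw [← smul_sub, map_smul, norm_smul, norm_smul, Real.norm_of_nonneg (Real.exp_pos _).le,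
      ← neg_sub (Y ρ t), map_neg, norm_neg, norm_neg] at h2
    change _ ≤ ν / 2 * (Real.exp (γ * t) * ‖z‖) + c * (Real.exp (γ * t) * ‖Dop hL z‖) at h2
    have h3 : ‖Real.exp (-γ * t) • (g t - 𝒢 (Real.exp (γ * t) • Y ρ t) -
        (g t - 𝒢 (Real.exp (γ * t) • Y ρ' t)))‖ ≤ ν / 2 * ‖z‖ + c * ‖Dop hL z‖ := by
      rw [sub_sub_sub_cancel_left, norm_smul, Real.norm_of_nonneg (Real.exp_pos _).le]
      refine (mul_le_mul_of_nonneg_left h2 (Real.exp_pos _).le).trans (le_of_eq ?_)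
      have h4 : Real.exp (-γ * t) * Real.exp (γ * t) = 1 := by
        rw [← Real.exp_add]
        simp
      linear_combination (ν / 2 * ‖z‖ + c * ‖Dop hL z‖) * h4
    have h5 := pow_le_pow_left₀ (norm_nonneg _) h3 2
    have h6 := norm_add_sq_ge (γ := γ) hL hν.le z
    have h7 : 2 * ν * γ = 4 * c ^ 2 := by
      rw [hγd]
      field_simp
      ring
    rw [h7] at h6
    nlinarith [sq_nonneg (ν / 2 * ‖z‖ - c * ‖Dop hL z‖)]
  have hcon : ContractingWith (Real.toNNReal (Real.sqrt (1 / 2))) Φ := by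
    refine ⟨?_, hΦL⟩
    rw [Real.toNNReal_lt_one, Real.sqrt_lt' one_pos]
    norm_num
  set ρ := ContractingWith.fixedPoint Φ hcon with hρd
  have hfix : Φ ρ = ρ := hcon.fixedPoint_isFixedPt
  have hρ : ∀ᵐ t ∂volume.restrict (Ioc 0 T),
      ρ t = Real.exp (-γ * t) • (g t - 𝒢 (Real.exp (γ * t) • Y ρ t)) := by
    have h1 := (hF ρ).coeFn_toLp
    change (Φ ρ : ℝ → Hsp) =ᵐ[_] _ at h1
    rw [hfix] at h1
    exact h1
  refine ⟨_, _, _, (hE ρ).exp_smul γ, by simp [hX0], ?_⟩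
  filter_upwards [hρ] with t ht
  have h4 : Real.exp (γ * t) * Real.exp (-γ * t) = 1 := by
    rw [← Real.exp_add]
    simp
  rw [ht]
  simp only [smul_sub, smul_add, smul_smul, h4, one_smul]
  simp only [← sub_sub, mul_comm]
  abel

end Semilinear

/-! ### Frequency cutoff and radial truncation -/

/-- `A^(1/2)` restricted to the frequencies `K` with `λ_K ≤ n`. -/
def cutoffRoot (L : ℝ) (n : ℕ) : Hsp →L[ℝ] Hsp :=
  fcalc L (fun r => if r ≤ n then r ^ (1 / 2 : ℝ) else 0)
    ⟨(max 0 (n : ℝ)) ^ (1 / 2 : ℝ), fun K => by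
    by_cases h : lam L K ≤ n
    · rw [if_pos h]
      by_cases h0 : 0 ≤ lam L K
      · rw [abs_of_nonneg (Real.rpow_nonneg h0 _)]
        exact Real.rpow_le_rpow h0 (h.trans (le_max_right _ _)) (by norm_num)
      · exfalso
        apply h0
        unfold lam
        split_ifs
        · norm_num
        · exact eig_nonneg L K
    · rw [if_neg h, abs_zero]
      exact Real.rpow_nonneg (le_max_left _ _) _⟩

section Cutoff
variable {L : ℝ} (hL : 0 < L)

lemma coef_cutoffRoot_Dop (n : ℕ) (y : Hsp) (K : Fin 3 → ℤ) (i : Fin 3) :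
    coef (cutoffRoot L n (Dop hL y)) K i = if lam L K ≤ n then coef y K i else 0 := by
  rw [cutoffRoot, coef_fcalc, coef_Dop]
  split_ifs with h
  · rw [← mul_assoc, ← Complex.ofReal_mul, ← Real.rpow_add (lam_pos hL K)]
    norm_num
  · simp

lemma norm_cutoffRoot_Dop_le (n : ℕ) (y : Hsp) : ‖cutoffRoot L n (Dop hL y)‖ ≤ ‖y‖ := by
  have h := norm_le_of_coef_le (x := cutoffRoot L n (Dop hL y)) (y := y) zero_le_one fun K i => by
    rw [coef_cutoffRoot_Dop]
    split_ifs <;> simp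
  simpa using h

lemma tendsto_cutoffRoot_Dop (y : Hsp) :
    Tendsto (fun n : ℕ => ‖cutoffRoot L n (Dop hL y) - y‖ ^ 2) atTop (𝓝 0) := by
  have h1 : Tendsto (fun n : ℕ => ∑' p : (Fin 3 → ℤ) × Fin 3,
      ‖coef (cutoffRoot L n (Dop hL y) - y) p.1 p.2‖ ^ 2) atTop
      (𝓝 (∑' _ : (Fin 3 → ℤ) × Fin 3, (0 : ℝ))) := by
    refine tendsto_tsum_of_dominated_convergence (hasSum_norm_sq y).summable (fun p => ?_)
      (Eventually.of_forall fun n p => ?_)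
    · refine tendsto_const_nhds.congr' ?_
      filter_upwards [eventually_ge_atTop ⌈lam L p.1⌉₊] with n hn
      have h2 : lam L p.1 ≤ n := (Nat.le_ceil _).trans (by exact_mod_cast hn)
      rw [coef_sub, Pi.sub_apply, Pi.sub_apply, coef_cutoffRoot_Dop, if_pos h2]
      simp
    · rw [Real.norm_of_nonneg (sq_nonneg _), coef_sub, Pi.sub_apply, Pi.sub_apply,
        coef_cutoffRoot_Dop]
      split_ifs
      · simp
      · simp
  simpa only [(hasSum_norm_sq _).tsum_eq, tsum_zero] using h1

end Cutoff

/-- `x` if `‖x‖ ≤ M`, and otherwise the multiple of `x` of norm `M`. -/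
def radialTrunc {E : Type*} [NormedAddCommGroup E] [NormedSpace ℝ E] (M : ℝ) (x : E) : E :=
  (M / max M ‖x‖) • x

section Trunc
variable {E : Type*} [NormedAddCommGroup E] [NormedSpace ℝ E] {M : ℝ}

lemma radialTrunc_of_norm_le (hM : 0 < M) {x : E} (hx : ‖x‖ ≤ M) : radialTrunc M x = x := by
  rw [radialTrunc, max_eq_left hx, div_self hM.ne', one_smul]

lemma norm_radialTrunc_le (hM : 0 < M) (x : E) : ‖radialTrunc M x‖ ≤ M := by
  have h1 : 0 < max M ‖x‖ := lt_max_of_lt_left hM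
  rw [radialTrunc, norm_smul, Real.norm_of_nonneg (by positivity), div_mul_eq_mul_div,
    div_le_iff₀ h1]
  exact mul_le_mul_of_nonneg_left (le_max_right _ _) hM.le

lemma norm_radialTrunc_sub_le (hM : 0 < M) (x x' : E) :
    ‖radialTrunc M x - radialTrunc M x'‖ ≤ 2 * ‖x - x'‖ := by
  have h1 : 0 < max M ‖x‖ := lt_max_of_lt_left hM
  have h2 : 0 < max M ‖x'‖ := lt_max_of_lt_left hM
  have e : radialTrunc M x - radialTrunc M x' =
      (M / max M ‖x‖) • (x - x') + (M / max M ‖x‖ - M / max M ‖x'‖) • x' := by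
    rw [radialTrunc, radialTrunc, smul_sub, sub_smul]
    abel
  have h3 : M / max M ‖x‖ ≤ 1 := (div_le_one h1).2 (le_max_left _ _)
  have h4 : |max M ‖x'‖ - max M ‖x‖| ≤ ‖x - x'‖ :=
    (abs_max_sub_max_le_abs ‖x'‖ ‖x‖ M |>.trans_eq' (by rw [max_comm M, max_comm M])).trans
      ((abs_norm_sub_norm_le x' x).trans_eq (norm_sub_rev _ _))
  have h5 : ‖(M / max M ‖x‖ - M / max M ‖x'‖) • x'‖ ≤ ‖x - x'‖ := by
    have e2 : M / max M ‖x‖ - M / max M ‖x'‖ =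
        (M / max M ‖x‖) * ((max M ‖x'‖ - max M ‖x‖) / max M ‖x'‖) := by
      field_simp
    rw [norm_smul, e2, norm_mul, Real.norm_of_nonneg (by positivity : 0 ≤ M / max M ‖x‖), norm_div,
      Real.norm_of_nonneg h2.le, Real.norm_eq_abs]
    calc M / max M ‖x‖ * (|max M ‖x'‖ - max M ‖x‖| / max M ‖x'‖) * ‖x'‖
        ≤ 1 * (‖x - x'‖ / max M ‖x'‖) * max M ‖x'‖ := by
          gcongr
          exact le_max_right _ _
      _ = ‖x - x'‖ := by field_simp
  rw [e]
  refine (norm_add_le _ _).trans ?_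
  rw [norm_smul, Real.norm_of_nonneg (by positivity : 0 ≤ M / max M ‖x‖)]
  have h6 := mul_le_mul_of_nonneg_right h3 (norm_nonneg (x - x'))
  linarith

end Trunc

/-! ### The abstract advection term -/

/-- The properties of the advection term `N(v, x) = (I + β² A)⁻¹ B((A⁻¹ + β²) v, A^(-1/2) x)`, where
`v = A w` and `x = A^(1/2) w`, that the theory uses. Tested against `(A⁻¹ + β²) d`, it is the
trilinear form `⟨B(z, A⁻¹ y), A⁻¹ d⟩` with `z = (A⁻¹ + β²) v`; the tail estimate says that high
frequencies of `v` contribute little, uniformly on bounded sets. -/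
structure IsAdvection {L : ℝ} (hL : 0 < L) (β C : ℝ) (N : Hsp →L[ℝ] Hsp →L[ℝ] Hsp) : Prop where
  cancel : ∀ v y, inner ℝ (N v (Dop hL y)) (testOp hL β y) = 0
  nonneg : 0 ≤ C
  le : ∀ v y d, |inner ℝ (N v (Dop hL y)) (testOp hL β d)| ≤ C * ‖v‖ * ‖y‖ * ‖Dop hL d‖
  tail : ∀ ε : ℝ, 0 < ε → ∃ n₀ : ℕ, ∀ n ≥ n₀, ∀ v y d,
    |inner ℝ (N (v - cutoffRoot L n (Dop hL v)) (Dop hL y)) (testOp hL β d)| ≤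
      ε * ‖v‖ * ‖y‖ * ‖Dop hL d‖

section Mollified
variable {L : ℝ} (hL : 0 < L)

/-- The problem with mollified transport velocity has solutions on `[0, T]`, bounded independently
of the mollification. The advection term, truncated to make it globally Lipschitz, drops out of the
energy estimate; the resulting bound makes the truncation inactive. -/
lemma exists_evol_mollified {T ν β η a b C : ℝ} (hT : 0 ≤ T) (hν : 0 < ν) (hβ : 0 < β)
    (hη : 0 ≤ η) (ha : 0 ≤ a) {J : Hsp →L[ℝ] Hsp} (hJ : IsInterpolation hL J a b)
    (hb : η * b ≤ ν / 2) {N : Hsp →L[ℝ] Hsp →L[ℝ] Hsp} (hN : IsAdvection hL β C N) {g : ℝ → Hsp}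
    (hg : MemLp g 2 (volume.restrict (Ioc 0 T))) (x₀ : Hsp) :
    ∃ B : ℝ, 0 ≤ B ∧ ∀ n : ℕ, ∃ x y q, Evol hL T x y q ∧ x 0 = x₀ ∧
      (∀ᵐ t ∂volume.restrict (Ioc 0 T), q t = g t - ν • y t - η • J (y t) -
        N (cutoffRoot L n (Dop hL (y t))) (Dop hL (y t))) ∧
      (∀ t ∈ Icc 0 T, ‖x t‖ ≤ B) ∧ ∫ t in Ioc 0 T, ‖y t‖ ^ 2 ≤ B := by
  set κ := ν * β ^ 2 / 4 with hκ
  have hκ0 : 0 < κ := by positivity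
  set A := normD L ^ 2 + β ^ 2 with hA
  have hD0 := normD_pos hL
  set B₁ := (A * ‖x₀‖ ^ 2 + ∫ τ in Ioc 0 T, A ^ 2 / κ * ‖g τ‖ ^ 2) *
    Real.exp (∫ _ in Ioc 0 T, (0 + 2 * coerConst L ν β η a b) / β ^ 2) with hB₁
  have hs0 : ∀ t, 0 ≤ A ^ 2 / κ * ‖g t‖ ^ 2 := fun t => by positivity
  have hB₁0 : 0 ≤ B₁ := by
    have : 0 ≤ ∫ τ in Ioc 0 T, A ^ 2 / κ * ‖g τ‖ ^ 2 := integral_nonneg hs0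
    positivity
  -- the truncation radius exceeds the a priori bound `√(B₁ / β²)` for `‖x‖`, and is positive
  set M := Real.sqrt (B₁ / β ^ 2) + 1 with hM
  have hM0 : 0 < M := by positivity
  refine ⟨M + B₁ / κ, by positivity, fun n => ?_⟩
  set R : Hsp → Hsp := radialTrunc M with hR
  set c := η * (normD L + a) + ‖N‖ * (‖cutoffRoot L n‖ * 2) * M + ‖N‖ * (‖cutoffRoot L n‖ * M) * 2
    with hc
  have hc0 : 0 ≤ c := by positivity
  obtain ⟨x, y, q, hE, hx0, hq⟩ := exists_evol_semilinear hL hT hν hc0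
    (𝒢 := fun y => η • J y + N (cutoffRoot L n (R (Dop hL y))) (R (Dop hL y))) (by
      intro y y'
      set d := Dop hL y
      set d' := Dop hL y'
      have e : η • J y + N (cutoffRoot L n (R d)) (R d) -
          (η • J y' + N (cutoffRoot L n (R d')) (R d')) =
          η • J (y - y') + (N (cutoffRoot L n (R d - R d')) (R d) +
            N (cutoffRoot L n (R d')) (R d - R d')) := by
        simp only [map_sub, smul_sub, sub_apply]
        abel
      have hdd : Dop hL (y - y') = d - d' := map_sub _ _ _
      have h1 : ‖η • J (y - y')‖ ≤ ν / 2 * ‖y - y'‖ + η * (normD L + a) * ‖d - d'‖ := by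
        rw [norm_smul, Real.norm_of_nonneg hη]
        have h2 := hJ (y - y')
        have h3 := norm_Dop_le hL (Dop hL (y - y'))
        have h4 : ‖J (y - y')‖ ≤ (normD L + a) * ‖d - d'‖ + b * ‖y - y'‖ := by
          have h5 := norm_le_norm_add_norm_sub (Dop hL (Dop hL (y - y'))) (J (y - y'))
          rw [norm_sub_rev, hdd] at h5
          rw [hdd] at h2 h3
          linarith
        have h6 := mul_le_mul_of_nonneg_left h4 hη
        have h7 := mul_le_mul_of_nonneg_right hb (norm_nonneg (y - y'))
        linarith
      have hNle : ∀ v w, ‖N v w‖ ≤ ‖N‖ * ‖v‖ * ‖w‖ := fun v w => N.le_opNorm₂ v w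
      have h2 : ‖N (cutoffRoot L n (R d - R d')) (R d)‖ ≤
          ‖N‖ * (‖cutoffRoot L n‖ * 2) * M * ‖d - d'‖ := by
        refine (hNle _ _).trans ?_
        have h3 : ‖cutoffRoot L n (R d - R d')‖ ≤ ‖cutoffRoot L n‖ * (2 * ‖d - d'‖) :=
          (ContinuousLinearMap.le_opNorm _ _).trans
            (mul_le_mul_of_nonneg_left (norm_radialTrunc_sub_le hM0 _ _) (norm_nonneg _))
        calc _ ≤ ‖N‖ * (‖cutoffRoot L n‖ * (2 * ‖d - d'‖)) * M := by
              gcongr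
              exact norm_radialTrunc_le hM0 _
          _ = _ := by ring
      have h3 : ‖N (cutoffRoot L n (R d')) (R d - R d')‖ ≤
          ‖N‖ * (‖cutoffRoot L n‖ * M) * 2 * ‖d - d'‖ := by
        refine (hNle _ _).trans ?_
        have h3 : ‖cutoffRoot L n (R d')‖ ≤ ‖cutoffRoot L n‖ * M :=
          (ContinuousLinearMap.le_opNorm _ _).trans
            (mul_le_mul_of_nonneg_left (norm_radialTrunc_le hM0 _) (norm_nonneg _))
        calc _ ≤ ‖N‖ * (‖cutoffRoot L n‖ * M) * (2 * ‖d - d'‖) := by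
              gcongr
              exact norm_radialTrunc_sub_le hM0 _ _
          _ = _ := by ring
      have h4 := norm_add_le (η • J (y - y')) (N (cutoffRoot L n (R d - R d')) (R d) +
            N (cutoffRoot L n (R d')) (R d - R d'))
      have h5 := norm_add_le (N (cutoffRoot L n (R d - R d')) (R d))
        (N (cutoffRoot L n (R d')) (R d - R d'))
      rw [e, hdd, hc]
      linarith) hg x₀
  have hbound : ∀ t ∈ Icc 0 T,
      β ^ 2 * ‖x t‖ ^ 2 + κ * ∫ τ in Ioc 0 t, ‖y τ‖ ^ 2 ≤ B₁ := by
    intro t ht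
    have h1 := hE.energy_bound hL hν hβ hη ha hJ hb (k := fun _ => 0)
      (s := fun t => A ^ 2 / κ * ‖g t‖ ^ 2) (integrableOn_const (by simp)) (fun _ => le_rfl)
      ((integrable_norm_sq hg).const_mul _) hs0 (by
        filter_upwards [hq] with t ht
        have e : q t + (ν • y t + η • J (y t)) =
            g t - N (cutoffRoot L n (R (Dop hL (y t)))) (R (Dop hL (y t))) := by
          rw [ht]
          abel
        -- a truncated field is a multiple of the field, so the cancellation survives truncation
        have hzero : inner ℝ (N (cutoffRoot L n (R (Dop hL (y t)))) (R (Dop hL (y t))))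
            (testOp hL β (y t)) = 0 := by
          rw [show R (Dop hL (y t)) = (M / max M ‖Dop hL (y t)‖) • Dop hL (y t) from rfl, map_smul,
            map_smul, real_inner_smul_left, hN.cancel, mul_zero]
        rw [e, inner_sub_left, hzero, sub_zero, zero_mul, add_zero, ← hκ]
        have h2 : inner ℝ (g t) (testOp hL β (y t)) ≤ ‖g t‖ * (A * ‖y t‖) :=
          (real_inner_le_norm _ _).trans
            (mul_le_mul_of_nonneg_left (norm_testOp_le' hL β _) (norm_nonneg _))
        have h3 : 0 ≤ (κ * ‖y t‖ - A * ‖g t‖) ^ 2 / κ := by positivity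
        have h4 : (κ * ‖y t‖ - A * ‖g t‖) ^ 2 / κ =
            κ * ‖y t‖ ^ 2 + A ^ 2 / κ * ‖g t‖ ^ 2 - 2 * (‖g t‖ * (A * ‖y t‖)) := by
          field_simp
          ring
        linarith) ht
    rw [hx0] at h1
    exact h1
  have hIy : ∀ t, 0 ≤ ∫ τ in Ioc 0 t, ‖y τ‖ ^ 2 := fun t => integral_nonneg fun _ => sq_nonneg _
  have hxM : ∀ t ∈ Icc 0 T, ‖x t‖ ≤ M := by
    intro t ht
    have h1 := hbound t ht
    have h2 : 0 ≤ κ * ∫ τ in Ioc 0 t, ‖y τ‖ ^ 2 := mul_nonneg hκ0.le (hIy t)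
    have h3 : ‖x t‖ ≤ Real.sqrt (B₁ / β ^ 2) := by
      refine Real.le_sqrt_of_sq_le ?_
      rw [le_div_iff₀ (by positivity)]
      linarith
    linarith
  refine ⟨x, y, q, hE, hx0, ?_, fun t ht => (hxM t ht).trans ?_, ?_⟩
  · filter_upwards [hq, hE.ae_eq, ae_restrict_mem measurableSet_Ioc] with t h1 h2 h3
    have h4 : R (Dop hL (y t)) = Dop hL (y t) := by
      refine radialTrunc_of_norm_le hM0 ?_
      rw [← h2]
      exact hxM t (Ioc_subset_Icc_self h3)
    rw [h1, h4]
    abel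
  · have : 0 ≤ B₁ / κ := by positivity
    linarith
  · have h1 := hbound T (right_mem_Icc.2 hT)
    have h2 : 0 ≤ β ^ 2 * ‖x T‖ ^ 2 := by positivity
    have h3 : ∫ τ in Ioc 0 T, ‖y τ‖ ^ 2 ≤ B₁ / κ := by
      rw [le_div_iff₀ hκ0]
      linarith
    linarith

end Mollified

/-! ### Stability and convergence of the mollified solutions -/

section Stability
variable {L : ℝ} (hL : 0 < L)

lemma young_two_mul {κ C p r s : ℝ} (hκ : 0 < κ) :
    2 * (C * p * r * s) ≤ κ * p ^ 2 + C ^ 2 / κ * r ^ 2 * s ^ 2 := by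
  have h1 : 0 ≤ (κ * p - C * r * s) ^ 2 / κ := by positivity
  have h2 : (κ * p - C * r * s) ^ 2 / κ =
      κ * p ^ 2 + C ^ 2 / κ * r ^ 2 * s ^ 2 - 2 * (C * p * r * s) := by
    field_simp
    ring
  linarith

/-- Two solutions with the same data except for the initial value stay close: the difference solves
a linear equation, whose advection term is controlled by `∫ ‖y‖²`. -/
lemma Evol.stability {T ν β η a b C : ℝ} (hν : 0 < ν) (hβ : 0 < β) (hη : 0 ≤ η) (ha : 0 ≤ a)
    {J : Hsp →L[ℝ] Hsp} (hJ : IsInterpolation hL J a b) (hb : η * b ≤ ν / 2)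
    {N : Hsp →L[ℝ] Hsp →L[ℝ] Hsp} (hN : IsAdvection hL β C N) {g x y q x' y' q' : ℝ → Hsp}
    (h : Evol hL T x y q) (h' : Evol hL T x' y' q')
    (hq : ∀ᵐ t ∂volume.restrict (Ioc 0 T),
      q t = g t - ν • y t - η • J (y t) - N (y t) (Dop hL (y t)))
    (hq' : ∀ᵐ t ∂volume.restrict (Ioc 0 T),
      q' t = g t - ν • y' t - η • J (y' t) - N (y' t) (Dop hL (y' t))) {t : ℝ} (ht : t ∈ Icc 0 T) :
    β ^ 2 * ‖x' t - x t‖ ^ 2 ≤ (normD L ^ 2 + β ^ 2) * ‖x' 0 - x 0‖ ^ 2 *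
      Real.exp (∫ τ in Ioc 0 T, (C ^ 2 / (ν * β ^ 2 / 4) * ‖y τ‖ ^ 2 +
        2 * coerConst L ν β η a b) / β ^ 2) := by
  set κ := ν * β ^ 2 / 4 with hκ
  have hκ0 : 0 < κ := by positivity
  have hd := h'.sub h
  have h1 := hd.energy_bound hL hν hβ hη ha hJ hb (k := fun t => C ^ 2 / κ * ‖y t‖ ^ 2)
    (s := fun _ => 0) ((integrable_norm_sq h.memLp).const_mul _) (fun _ => by positivity)
    (integrableOn_const (by simp)) (fun _ => le_rfl) (by
      filter_upwards [hq, hq', hd.ae_eq] with t e1 e2 e3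
      simp only [Pi.sub_apply] at e3 ⊢
      set d := y' t - y t with hdd
      have e : q' t - q t + (ν • d + η • J d) = -(N d (Dop hL (y t)) + N (y' t) (Dop hL d)) := by
        rw [e1, e2, hdd]
        simp only [map_sub, smul_sub, sub_apply]
        abel
      rw [e, inner_neg_left, inner_add_left, hN.cancel, add_zero, add_zero, e3, ← hκ]
      have h2 := hN.le d (y t) d
      have h3 := (neg_le_abs _).trans h2
      have h4 := young_two_mul (C := C) (p := ‖d‖) (r := ‖y t‖) (s := ‖Dop hL d‖) hκ0
      linarith) ht
  have h2 : 0 ≤ ∫ τ in Ioc 0 t, ‖(y' - y) τ‖ ^ 2 := integral_nonneg fun _ => sq_nonneg _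
  have h3 : 0 ≤ κ * ∫ τ in Ioc 0 t, ‖(y' - y) τ‖ ^ 2 := by positivity
  simp only [integral_zero, add_zero, Pi.sub_apply, ← hκ] at h1 h3
  linarith

/-- Solutions of the mollified problems form a Cauchy sequence. As in the stability estimate, the
advection of the difference is controlled by Gronwall's inequality; the different cutoffs add a
source that the tail estimate makes small. -/
lemma mollified_cauchy {T ν β η a b C B : ℝ} (hT : 0 ≤ T) (hν : 0 < ν) (hβ : 0 < β) (hη : 0 ≤ η)
    (ha : 0 ≤ a) {J : Hsp →L[ℝ] Hsp} (hJ : IsInterpolation hL J a b) (hb : η * b ≤ ν / 2)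
    {N : Hsp →L[ℝ] Hsp →L[ℝ] Hsp} (hN : IsAdvection hL β C N) {g : ℝ → Hsp} (hB : 0 ≤ B)
    {x y q : ℕ → ℝ → Hsp} (h : ∀ n, Evol hL T (x n) (y n) (q n)) {x₀ : Hsp}
    (h0 : ∀ n, x n 0 = x₀)
    (hq : ∀ n, ∀ᵐ t ∂volume.restrict (Ioc 0 T), q n t = g t - ν • y n t - η • J (y n t) -
        N (cutoffRoot L n (Dop hL (y n t))) (Dop hL (y n t)))
    (hxB : ∀ n, ∀ t ∈ Icc 0 T, ‖x n t‖ ≤ B)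
    (hyB : ∀ n, ∫ t in Ioc 0 T, ‖y n t‖ ^ 2 ≤ B) {ε : ℝ} (hε : 0 < ε) :
    ∃ n₀ : ℕ, ∀ n ≥ n₀, ∀ m ≥ n₀, ∀ t ∈ Icc 0 T,
      ‖x n t - x m t‖ ^ 2 ≤ ε ∧ ∫ τ in Ioc 0 t, ‖y n τ - y m τ‖ ^ 2 ≤ ε := by
  set κ := ν * β ^ 2 / 4 with hκ
  have hκ0 : 0 < κ := by positivity
  set F := Real.exp ((C ^ 2 / κ * B + 2 * coerConst L ν β η a b * T) / β ^ 2) with hF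
  have hF0 : 0 < F := Real.exp_pos _
  set c := min (β ^ 2) κ with hc
  have hc0 : 0 < c := by positivity
  -- chosen so that the source, of size `8 B² δ`, times the Gronwall factor `F` is below `ε c`
  set δ := ε * c / ((8 * B ^ 2 + 1) * F) with hδ
  have hδ0 : 0 < δ := by positivity
  obtain ⟨n₀, hn₀⟩ := hN.tail δ hδ0
  refine ⟨n₀, fun n hn m hm t ht => ?_⟩
  have hd := (h n).sub (h m)
  have hsI : IntegrableOn (fun t => 4 * δ * B * (‖y n t‖ ^ 2 + ‖y m t‖ ^ 2)) (Ioc 0 T) :=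
    Integrable.const_mul (f := fun t => ‖y n t‖ ^ 2 + ‖y m t‖ ^ 2)
      ((integrable_norm_sq (h n).memLp).add (integrable_norm_sq (h m).memLp)) _
  have h1 := hd.energy_bound hL hν hβ hη ha hJ hb (k := fun t => C ^ 2 / κ * ‖y n t‖ ^ 2)
    (s := fun t => 4 * δ * B * (‖y n t‖ ^ 2 + ‖y m t‖ ^ 2))
    ((integrable_norm_sq (h n).memLp).const_mul _) (fun _ => by positivity)
    hsI (fun _ => by positivity) (by
      filter_upwards [hq n, hq m, hd.ae_eq, ae_restrict_mem measurableSet_Ioc] with τ e1 e2 e3 hτ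
      simp only [Pi.sub_apply] at e3 ⊢
      have hτ' : τ ∈ Icc 0 T := Ioc_subset_Icc_self hτ
      set d := y n τ - y m τ with hdd
      set v := y m τ
      -- the difference of the two cutoffs of `v` is expressed through the two tails
      have e : q n τ - q m τ + (ν • d + η • J d) =
          -(N (cutoffRoot L n (Dop hL d)) (Dop hL (y n τ)) -
            N (v - cutoffRoot L n (Dop hL v)) (Dop hL (y n τ)) +
            N (v - cutoffRoot L m (Dop hL v)) (Dop hL (y n τ)) +
            N (cutoffRoot L m (Dop hL v)) (Dop hL d)) := by
        rw [e1, e2, hdd]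
        simp only [map_sub, smul_sub, sub_apply]
        abel
      rw [e, inner_neg_left, inner_add_left, hN.cancel, add_zero, inner_add_left, inner_sub_left,
        e3, ← hκ]
      have h2 := (neg_le_abs _).trans (hN.le (cutoffRoot L n (Dop hL d)) (y n τ) d)
      have h3 := (le_abs_self _).trans (hn₀ n hn v (y n τ) d)
      have h4 := (neg_le_abs _).trans (hn₀ m hm v (y n τ) d)
      have h5 : C * ‖cutoffRoot L n (Dop hL d)‖ * ‖y n τ‖ * ‖Dop hL d‖ ≤
          C * ‖d‖ * ‖y n τ‖ * ‖Dop hL d‖ := by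
        have := hN.nonneg
        gcongr
        exact norm_cutoffRoot_Dop_le hL n d
      have h6 := young_two_mul (C := C) (p := ‖d‖) (r := ‖y n τ‖) (s := ‖Dop hL d‖) hκ0
      have h7 : ‖Dop hL d‖ ≤ 2 * B := by
        rw [← e3]
        have := norm_sub_le (x n τ) (x m τ)
        linarith [hxB n τ hτ', hxB m τ hτ']
      have h8 : δ * ‖v‖ * ‖y n τ‖ * ‖Dop hL d‖ ≤ δ * B * (‖y n τ‖ ^ 2 + ‖v‖ ^ 2) := by
        have h9 : δ * ‖v‖ * ‖y n τ‖ * ‖Dop hL d‖ ≤ δ * ‖v‖ * ‖y n τ‖ * (2 * B) := by gcongr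
        have h10 : 0 ≤ δ * B * (‖y n τ‖ - ‖v‖) ^ 2 := by positivity
        linarith
      linarith) ht
  have hs : ∫ τ in Ioc 0 T, 4 * δ * B * (‖y n τ‖ ^ 2 + ‖y m τ‖ ^ 2) ≤ 8 * B ^ 2 * δ := by
    rw [integral_const_mul, integral_add (integrable_norm_sq (h n).memLp)
      (integrable_norm_sq (h m).memLp)]
    have := mul_le_mul_of_nonneg_left (add_le_add (hyB n) (hyB m))
      (by positivity : 0 ≤ 4 * δ * B)
    linarith
  have hE : ∫ τ in Ioc 0 T, (C ^ 2 / κ * ‖y n τ‖ ^ 2 + 2 * coerConst L ν β η a b) / β ^ 2 ≤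
      (C ^ 2 / κ * B + 2 * coerConst L ν β η a b * T) / β ^ 2 := by
    rw [integral_div, integral_add ((integrable_norm_sq (h n).memLp).const_mul _)
      (integrableOn_const (by simp)), integral_const_mul, setIntegral_const]
    have h2 := mul_le_mul_of_nonneg_left (hyB n) (by positivity : 0 ≤ C ^ 2 / κ)
    have h3 : volume.real (Ioc 0 T) = T := by simp [hT]
    rw [h3, smul_eq_mul]
    gcongr ?_ / _
    linarith
  have h2 : β ^ 2 * ‖x n t - x m t‖ ^ 2 + κ * ∫ τ in Ioc 0 t, ‖y n τ - y m τ‖ ^ 2 ≤ ε * c := by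
    have h0' : (x n - x m) 0 = 0 := by simp [h0]
    rw [h0', norm_zero] at h1
    simp only [Pi.sub_apply] at h1
    refine h1.trans ?_
    have h3 : 0 ≤ ∫ τ in Ioc 0 T, 4 * δ * B * (‖y n τ‖ ^ 2 + ‖y m τ‖ ^ 2) :=
      integral_nonneg fun _ => by positivity
    calc _ ≤ (8 * B ^ 2 + 1) * δ * F := by
          refine mul_le_mul (by linarith) (Real.exp_le_exp.2 hE) (Real.exp_pos _).le (by positivity)
      _ = ε * c := by
          rw [hδ]
          field_simp
  have h3 : 0 ≤ ∫ τ in Ioc 0 t, ‖y n τ - y m τ‖ ^ 2 := integral_nonneg fun _ => sq_nonneg _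
  have h4 := sq_nonneg ‖x n t - x m t‖
  have h5 : c ≤ β ^ 2 := min_le_left _ _
  have h6 : c ≤ κ := min_le_right _ _
  constructor
  · refine le_of_mul_le_mul_right ?_ hc0
    have := mul_le_mul_of_nonneg_right h5 h4
    have := mul_nonneg hκ0.le h3
    linarith
  · refine le_of_mul_le_mul_right ?_ hc0
    have := mul_le_mul_of_nonneg_right h6 h3
    have : 0 ≤ β ^ 2 * ‖x n t - x m t‖ ^ 2 := by positivity
    linarith

end Stability

/-! ### Passage to the limit -/

section Limit

lemma sq_integral_norm_le {T : ℝ} (hT : 0 ≤ T) {f : ℝ → Hsp}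
    (hf : MemLp f 2 (volume.restrict (Ioc 0 T))) :
    (∫ t in Ioc 0 T, ‖f t‖) ^ 2 ≤ T * ∫ t in Ioc 0 T, ‖f t‖ ^ 2 := by
  have hf1 : Integrable (fun t => ‖f t‖) (volume.restrict (Ioc 0 T)) :=
    (hf.integrable (by norm_num)).norm
  have hf2 := integrable_norm_sq hf
  set I := ∫ t in Ioc 0 T, ‖f t‖ with hI
  have h1 : 0 ≤ ∫ t in Ioc 0 T, (T * ‖f t‖ - I) ^ 2 := integral_nonneg fun _ => sq_nonneg _
  have h2 : ∀ t, (T * ‖f t‖ - I) ^ 2 = T ^ 2 * ‖f t‖ ^ 2 - 2 * T * I * ‖f t‖ + I ^ 2 := fun t => by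
    ring
  have h3 : volume.real (Ioc 0 T) = T := by simp [hT]
  simp only [h2] at h1
  rw [integral_add (f := fun t => T ^ 2 * ‖f t‖ ^ 2 - 2 * T * I * ‖f t‖)
      ((hf2.const_mul _).sub (hf1.const_mul _)) (integrable_const _),
    integral_sub (hf2.const_mul _) (hf1.const_mul _), integral_const_mul, integral_const_mul,
    setIntegral_const, h3, ← hI, smul_eq_mul] at h1
  rcases hT.eq_or_lt with rfl | hT0
  · simp [hI]
  · have h4 : 0 ≤ T * (T * (∫ t in Ioc 0 T, ‖f t‖ ^ 2) - I ^ 2) := by linarith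
    have h5 := nonneg_of_mul_nonneg_right h4 hT0
    linarith

lemma tendsto_integral_of_tendsto_sq {T : ℝ} (hT : 0 ≤ T) {f : ℕ → ℝ → Hsp} {F : ℝ → Hsp}
    (hf : ∀ n, MemLp (f n) 2 (volume.restrict (Ioc 0 T)))
    (hF : MemLp F 2 (volume.restrict (Ioc 0 T)))
    (h : Tendsto (fun n => ∫ t in Ioc 0 T, ‖f n t - F t‖ ^ 2) atTop (𝓝 0)) {t : ℝ}
    (ht : t ∈ Icc 0 T) :
    Tendsto (fun n => ∫ s in (0 : ℝ)..t, f n s) atTop (𝓝 (∫ s in (0 : ℝ)..t, F s)) := by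
  rw [tendsto_iff_norm_sub_tendsto_zero]
  have h1 : Tendsto (fun n => Real.sqrt (T * ∫ t in Ioc 0 T, ‖f n t - F t‖ ^ 2)) atTop (𝓝 0) := by
    have := (h.const_mul T).sqrt
    simpa using this
  refine squeeze_zero (fun _ => norm_nonneg _) (fun n => ?_) h1
  have hd := (hf n).sub hF
  rw [← intervalIntegral.integral_sub (MemLp.intervalIntegrable (hf n) ht)
    (MemLp.intervalIntegrable hF ht), intervalIntegral.integral_of_le ht.1]
  refine (norm_integral_le_integral_norm _).trans ?_
  refine le_trans ?_ (Real.le_sqrt_of_sq_le (sq_integral_norm_le hT hd))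
  exact setIntegral_mono_set (hd.integrable (by norm_num)).norm
    (Eventually.of_forall fun _ => norm_nonneg _) (Ioc_subset_Ioc_right ht.2).eventuallyLE

/-- Completeness of `L²(0, T; H)`, for curves rather than classes. -/
lemma exists_memLp_limit {T : ℝ} {y : ℕ → ℝ → Hsp}
    (hy : ∀ n, MemLp (y n) 2 (volume.restrict (Ioc 0 T)))
    (hc : ∀ ε : ℝ, 0 < ε → ∃ n₀ : ℕ, ∀ n ≥ n₀, ∀ m ≥ n₀,
      ∫ t in Ioc 0 T, ‖y n t - y m t‖ ^ 2 ≤ ε) :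
    ∃ Y : ℝ → Hsp, MemLp Y 2 (volume.restrict (Ioc 0 T)) ∧
      Tendsto (fun n => ∫ t in Ioc 0 T, ‖y n t - Y t‖ ^ 2) atTop (𝓝 0) ∧
      ∃ φ : ℕ → ℕ, StrictMono φ ∧
        ∀ᵐ t ∂volume.restrict (Ioc 0 T), Tendsto (fun n => y (φ n) t) atTop (𝓝 (Y t)) := by
  have hnorm : ∀ {f : ℝ → Hsp} (hf : MemLp f 2 (volume.restrict (Ioc 0 T))),
      ‖hf.toLp f‖ ^ 2 = ∫ t in Ioc 0 T, ‖f t‖ ^ 2 := fun hf => by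
    rw [Lp_norm_sq_eq_integral]
    refine integral_congr_ae ?_
    filter_upwards [hf.coeFn_toLp] with t ht
    rw [ht]
  have hcs : CauchySeq fun n => (hy n).toLp (y n) := by
    rw [Metric.cauchySeq_iff]
    intro ε hε
    obtain ⟨n₀, h⟩ := hc ((ε / 2) ^ 2) (by positivity)
    refine ⟨n₀, fun n hn m hm => ?_⟩
    rw [dist_eq_norm, ← MemLp.toLp_sub]
    have h1 := h n hn m hm
    have h2 := hnorm ((hy n).sub (hy m))
    simp only [Pi.sub_apply] at h2
    rw [← h2] at h1
    have h3 := abs_le_of_sq_le_sq h1 (by positivity)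
    rw [abs_norm] at h3
    linarith
  obtain ⟨Y, hY⟩ := cauchySeq_tendsto_of_complete hcs
  have hYm : MemLp (Y : ℝ → Hsp) 2 (volume.restrict (Ioc 0 T)) := Lp.memLp Y
  refine ⟨Y, hYm, ?_, ?_⟩
  · have h1 : Tendsto (fun n => ‖(hy n).toLp (y n) - Y‖ ^ 2) atTop (𝓝 0) := by
      have := (tendsto_iff_norm_sub_tendsto_zero.1 hY).pow 2
      simpa using this
    refine h1.congr fun n => ?_
    have h2 := hnorm ((hy n).sub hYm)
    rw [MemLp.toLp_sub (hy n) hYm, Lp.toLp_coeFn Y hYm] at h2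
    exact h2
  · have h1 := tendstoInMeasure_of_tendsto_Lp hY
    obtain ⟨φ, hφ, h2⟩ := h1.exists_seq_tendsto_ae
    refine ⟨φ, hφ, ?_⟩
    filter_upwards [h2, ae_all_iff.2 fun n => (hy n).coeFn_toLp] with t h3 h4
    simpa only [h4] using h3

variable {L : ℝ} (hL : 0 < L)

/-- Existence for the limit problem, on the closed interval `[0, T]`. The mollified solutions
converge in `C([0, T]; V) ∩ L²(0, T; D(A))`, which suffices for their time derivatives to converge
in `L²(0, T; H)`. -/
lemma exists_evol {T ν β η a b C : ℝ} (hT : 0 ≤ T) (hν : 0 < ν) (hβ : 0 < β) (hη : 0 ≤ η)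
    (ha : 0 ≤ a) {J : Hsp →L[ℝ] Hsp} (hJ : IsInterpolation hL J a b) (hb : η * b ≤ ν / 2)
    {N : Hsp →L[ℝ] Hsp →L[ℝ] Hsp} (hN : IsAdvection hL β C N) {g : ℝ → Hsp}
    (hg : MemLp g 2 (volume.restrict (Ioc 0 T))) (x₀ : Hsp) :
    ∃ x y q, Evol hL T x y q ∧ x 0 = x₀ ∧ ∀ᵐ t ∂volume.restrict (Ioc 0 T),
      q t = g t - ν • y t - η • J (y t) - N (y t) (Dop hL (y t)) := by
  obtain ⟨B, hB, hex⟩ := exists_evol_mollified hL hT hν hβ hη ha hJ hb hN hg x₀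
  choose x y q hE hx0 hq hxB hyB using hex
  have hcauchy := fun ε hε => mollified_cauchy hL hT hν hβ hη ha hJ hb hN hB hE hx0 hq hxB hyB
    (ε := ε) hε
  have hTm : T ∈ Icc 0 T := right_mem_Icc.2 hT
  obtain ⟨Y, hY, hYlim, φ, hφ, hYae⟩ := exists_memLp_limit (fun n => (hE n).memLp) fun ε hε => by
    obtain ⟨n₀, h⟩ := hcauchy ε hε
    exact ⟨n₀, fun n hn m hm => (h n hn m hm T hTm).2⟩
  have hXex : ∀ t, ∃ X, t ∈ Icc 0 T → Tendsto (fun n => x n t) atTop (𝓝 X) := by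
    intro t
    by_cases ht : t ∈ Icc 0 T
    · have : CauchySeq fun n => x n t := by
        rw [Metric.cauchySeq_iff]
        intro ε hε
        obtain ⟨n₀, h⟩ := hcauchy ((ε / 2) ^ 2) (by positivity)
        refine ⟨n₀, fun n hn m hm => ?_⟩
        rw [dist_eq_norm]
        have h3 := abs_le_of_sq_le_sq (h n hn m hm t ht).1 (by positivity)
        rw [abs_norm] at h3
        linarith
      obtain ⟨X, hX⟩ := cauchySeq_tendsto_of_complete this
      exact ⟨X, fun _ => hX⟩
    · exact ⟨0, fun h => absurd h ht⟩
  choose X hX using hXex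
  have hXB : ∀ t ∈ Icc 0 T, ‖X t‖ ≤ B := fun t ht =>
    le_of_tendsto (hX t ht).norm (Eventually.of_forall fun n => hxB n t ht)
  have hxy : ∀ᵐ t ∂volume.restrict (Ioc 0 T), ∀ n, x n t = Dop hL (y n t) :=
    ae_all_iff.2 fun n => (hE n).ae_eq
  have hXY : ∀ᵐ t ∂volume.restrict (Ioc 0 T), X t = Dop hL (Y t) := by
    filter_upwards [hxy, hYae, ae_restrict_mem measurableSet_Ioc] with t h1 h2 h3
    have h4 := (hX t (Ioc_subset_Icc_self h3)).comp hφ.tendsto_atTop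
    refine tendsto_nhds_unique h4 ?_
    simp only [Function.comp_def, h1]
    exact ((Dop hL).continuous.tendsto _).comp h2
  set Q : ℝ → Hsp := fun t => g t - ν • Y t - η • J (Y t) - N (Y t) (Dop hL (Y t)) with hQd
  have hDY : MemLp (fun t => Dop hL (Y t)) 2 (volume.restrict (Ioc 0 T)) :=
    (Dop hL).comp_memLp' hY
  have hNY : MemLp (fun t => N (Y t) (Dop hL (Y t))) 2 (volume.restrict (Ioc 0 T)) := by
    refine hY.of_le_mul (c := ‖N‖ * B)
      (N.continuous₂.comp_aestronglyMeasurable (hY.1.prodMk hDY.1)) ?_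
    filter_upwards [hXY, ae_restrict_mem measurableSet_Ioc] with t h1 h2
    have h3 := hXB t (Ioc_subset_Icc_self h2)
    refine (N.le_opNorm₂ _ _).trans ?_
    rw [← h1]
    calc ‖N‖ * ‖Y t‖ * ‖X t‖ ≤ ‖N‖ * ‖Y t‖ * B := by gcongr
      _ = ‖N‖ * B * ‖Y t‖ := by ring
  have hQ : MemLp Q 2 (volume.restrict (Ioc 0 T)) :=
    ((hg.sub (hY.const_smul ν)).sub ((J.comp_memLp' hY).const_smul η)).sub hNY
  have hlim : Tendsto (fun n => ∫ t in Ioc 0 T, ‖q n t - Q t‖ ^ 2) atTop (𝓝 0) := by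
    set c₁ := ν + η * ‖J‖ + ‖N‖ * B with hc₁
    have hc₁0 : 0 ≤ c₁ := by positivity
    -- `q n - Q` has three contributions: terms linear in `y n - Y`, the cutoff error of `Y`, and
    -- `x n - X` transported by `Y`
    have l2 : Tendsto (fun n => ∫ t in Ioc 0 T, ‖cutoffRoot L n (Dop hL (Y t)) - Y t‖ ^ 2) atTop
        (𝓝 0) := by
      have := tendsto_integral_of_dominated_convergence (μ := volume.restrict (Ioc 0 T))
        (F := fun n t => ‖cutoffRoot L n (Dop hL (Y t)) - Y t‖ ^ 2) (f := fun _ => (0 : ℝ))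
        (fun t => 4 * ‖Y t‖ ^ 2)
        (fun n => ((((cutoffRoot L n).continuous.comp_aestronglyMeasurable hDY.1).sub hY.1).norm.pow
          2)) ((integrable_norm_sq hY).const_mul 4)
        (fun n => Eventually.of_forall fun t => ?_)
        (Eventually.of_forall fun t => tendsto_cutoffRoot_Dop hL (Y t))
      · simpa using this
      · rw [Real.norm_of_nonneg (sq_nonneg _)]
        have h1 := norm_sub_le (cutoffRoot L n (Dop hL (Y t))) (Y t)
        have h2 := norm_cutoffRoot_Dop_le hL n (Y t)
        have h3 := pow_le_pow_left₀ (norm_nonneg _) (h1.trans (add_le_add_left h2 _)) 2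
        linarith
    have hXm : AEStronglyMeasurable X (volume.restrict (Ioc 0 T)) :=
      hDY.1.congr (hXY.mono fun t ht => ht.symm)
    have hxm : ∀ n, AEStronglyMeasurable (x n) (volume.restrict (Ioc 0 T)) := fun n =>
      ((Dop hL).continuous.comp_aestronglyMeasurable (hE n).memLp.1).congr
        ((hE n).ae_eq.mono fun t ht => ht.symm)
    have hbd : ∀ n, ∀ᵐ t ∂volume.restrict (Ioc 0 T),
        ‖(‖x n t - X t‖ * ‖Y t‖) ^ 2‖ ≤ 4 * B ^ 2 * ‖Y t‖ ^ 2 := by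
      intro n
      filter_upwards [ae_restrict_mem measurableSet_Ioc] with t h2
      have h3 := norm_sub_le (x n t) (X t)
      have h4 := hxB n t (Ioc_subset_Icc_self h2)
      have h5 := hXB t (Ioc_subset_Icc_self h2)
      have h6 : ‖x n t - X t‖ ^ 2 ≤ (2 * B) ^ 2 :=
        pow_le_pow_left₀ (norm_nonneg _) (by linarith) 2
      rw [Real.norm_of_nonneg (sq_nonneg _), mul_pow]
      have := mul_le_mul_of_nonneg_right h6 (sq_nonneg ‖Y t‖)
      linarith
    have hdom : Integrable (fun t => 4 * B ^ 2 * ‖Y t‖ ^ 2) (volume.restrict (Ioc 0 T)) :=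
      (integrable_norm_sq hY).const_mul _
    have hms : ∀ n, AEStronglyMeasurable (fun t => (‖x n t - X t‖ * ‖Y t‖) ^ 2)
        (volume.restrict (Ioc 0 T)) := fun n =>
      ((((hxm n).sub hXm).norm.mul hY.1.norm).pow 2)
    have l3 : Tendsto (fun n => ∫ t in Ioc 0 T, (‖x n t - X t‖ * ‖Y t‖) ^ 2) atTop (𝓝 0) := by
      have := tendsto_integral_of_dominated_convergence (μ := volume.restrict (Ioc 0 T))
        (F := fun n t => (‖x n t - X t‖ * ‖Y t‖) ^ 2) (f := fun _ => (0 : ℝ)) _ hms hdom hbd ?_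
      · simpa using this
      · filter_upwards [ae_restrict_mem measurableSet_Ioc] with t h2
        have h3 := tendsto_iff_norm_sub_tendsto_zero.1 (hX t (Ioc_subset_Icc_self h2))
        simpa using (h3.mul_const ‖Y t‖).pow 2
    have i1 : ∀ n, Integrable (fun t => ‖y n t - Y t‖ ^ 2) (volume.restrict (Ioc 0 T)) := fun n =>
      integrable_norm_sq ((hE n).memLp.sub hY)
    have i2 : ∀ n, Integrable (fun t => ‖cutoffRoot L n (Dop hL (Y t)) - Y t‖ ^ 2)
        (volume.restrict (Ioc 0 T)) := fun n =>
      integrable_norm_sq (((cutoffRoot L n).comp_memLp' hDY).sub hY)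
    have i3 : ∀ n, Integrable (fun t => (‖x n t - X t‖ * ‖Y t‖) ^ 2)
        (volume.restrict (Ioc 0 T)) := fun n => hdom.mono' (hms n) (hbd n)
    have l4 := ((hYlim.const_mul (3 * c₁ ^ 2)).add (l2.const_mul (3 * (‖N‖ * B) ^ 2))).add
      (l3.const_mul (3 * ‖N‖ ^ 2))
    simp only [mul_zero, add_zero] at l4
    refine squeeze_zero (fun _ => integral_nonneg fun _ => sq_nonneg _) (fun n => ?_) l4
    rw [← integral_const_mul, ← integral_const_mul, ← integral_const_mul,
      ← integral_add ((i1 n).const_mul _) ((i2 n).const_mul _),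
      ← integral_add (f := fun t => 3 * c₁ ^ 2 * ‖y n t - Y t‖ ^ 2 +
        3 * (‖N‖ * B) ^ 2 * ‖cutoffRoot L n (Dop hL (Y t)) - Y t‖ ^ 2)
        (((i1 n).const_mul _).add ((i2 n).const_mul _)) ((i3 n).const_mul _)]
    refine integral_mono_ae (integrable_norm_sq ((hE n).memLp_deriv.sub hQ))
      ((((i1 n).const_mul _).add ((i2 n).const_mul _)).add ((i3 n).const_mul _)) ?_
    filter_upwards [hq n, (hE n).ae_eq, hXY, ae_restrict_mem measurableSet_Ioc] with t h1 h2 h3 h4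
    set e := y n t - Y t with he
    set r := cutoffRoot L n (Dop hL (Y t)) - Y t with hr
    have e1 : q n t - Q t = -(ν • e + η • J e + N (cutoffRoot L n (Dop hL e)) (x n t) +
        N r (x n t) + N (Y t) (x n t - X t)) := by
      rw [h1, hQd, h2, h3, he, hr]
      simp only [map_sub, smul_sub, sub_apply]
      abel
    have b0 := hxB n t (Ioc_subset_Icc_self h4)
    have b1 : ‖ν • e‖ ≤ ν * ‖e‖ := by rw [norm_smul, Real.norm_of_nonneg hν.le]
    have b2 : ‖η • J e‖ ≤ η * ‖J‖ * ‖e‖ := by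
      rw [norm_smul, Real.norm_of_nonneg hη, mul_assoc]
      exact mul_le_mul_of_nonneg_left (J.le_opNorm _) hη
    have b3 : ‖N (cutoffRoot L n (Dop hL e)) (x n t)‖ ≤ ‖N‖ * B * ‖e‖ := by
      refine (N.le_opNorm₂ _ _).trans ?_
      calc ‖N‖ * ‖cutoffRoot L n (Dop hL e)‖ * ‖x n t‖ ≤ ‖N‖ * ‖e‖ * B := by
            gcongr
            exact norm_cutoffRoot_Dop_le hL n e
        _ = ‖N‖ * B * ‖e‖ := by ring
    have b4 : ‖N r (x n t)‖ ≤ ‖N‖ * B * ‖r‖ := by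
      refine (N.le_opNorm₂ _ _).trans ?_
      calc ‖N‖ * ‖r‖ * ‖x n t‖ ≤ ‖N‖ * ‖r‖ * B := by gcongr
        _ = ‖N‖ * B * ‖r‖ := by ring
    have b5 : ‖N (Y t) (x n t - X t)‖ ≤ ‖N‖ * (‖x n t - X t‖ * ‖Y t‖) :=
      (N.le_opNorm₂ _ _).trans_eq (by ring)
    have b6 : ‖q n t - Q t‖ ≤ c₁ * ‖e‖ + ‖N‖ * B * ‖r‖ + ‖N‖ * (‖x n t - X t‖ * ‖Y t‖) := by
      rw [e1, norm_neg, hc₁]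
      refine norm_add_le_of_le (norm_add_le_of_le ((norm_add₃_le).trans ?_) b4) b5
      linarith
    have b7 := pow_le_pow_left₀ (norm_nonneg _) b6 2
    change ‖q n t - Q t‖ ^ 2 ≤ 3 * c₁ ^ 2 * ‖e‖ ^ 2 + 3 * (‖N‖ * B) ^ 2 * ‖r‖ ^ 2 +
      3 * ‖N‖ ^ 2 * (‖x n t - X t‖ * ‖Y t‖) ^ 2
    generalize ‖x n t - X t‖ * ‖Y t‖ = p at b7 ⊢
    nlinarith [sq_nonneg (c₁ * ‖e‖ - ‖N‖ * B * ‖r‖), sq_nonneg (c₁ * ‖e‖ - ‖N‖ * p),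
      sq_nonneg (‖N‖ * B * ‖r‖ - ‖N‖ * p)]
  have hX0 : X 0 = x₀ := by
    refine tendsto_nhds_unique (hX 0 (left_mem_Icc.2 hT)) ?_
    simp only [hx0]
    exact tendsto_const_nhds
  refine ⟨X, Y, Q, ⟨hY, hQ, hXY, fun t ht => ?_⟩, hX0, Eventually.of_forall fun t => rfl⟩
  have h1 : Tendsto (fun n => Dop hL (x n t)) atTop (𝓝 (Dop hL (X t))) :=
    ((Dop hL).continuous.tendsto _).comp (hX t ht)
  refine tendsto_nhds_unique h1 ?_
  have h2 : ∀ n, Dop hL (x n t) = Dop hL x₀ + ∫ s in (0 : ℝ)..t, q n s := fun n => by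
    rw [(hE n).eq_integral t ht, hx0]
  simp only [h2, hX0]
  exact tendsto_const_nhds.add
    (tendsto_integral_of_tendsto_sq hT (fun n => (hE n).memLp_deriv) hQ hlim ht)

end Limit

/-! ### The Leray projection on Fourier coefficients -/

lemma sum_intCast_sq_pos {K : Fin 3 → ℤ} (hK : K ≠ 0) : 0 < ∑ j, (K j : ℝ) ^ 2 := by
  obtain ⟨i, hi⟩ := Function.ne_iff.1 hK
  have : (K i : ℝ) ≠ 0 := by exact_mod_cast hi
  exact Finset.sum_pos' (fun _ _ => sq_nonneg _) ⟨i, Finset.mem_univ i, by positivity⟩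

lemma sum_intCast_sq_ne_zero {K : Fin 3 → ℤ} (hK : K ≠ 0) : (∑ j, (K j : ℂ) ^ 2) ≠ 0 := by
  exact_mod_cast (sum_intCast_sq_pos hK).ne'

lemma leray_zero (u : Field) : leray u 0 = 0 := by
  funext i
  simp [leray]

lemma leray_of_ne (u : Field) {K : Fin 3 → ℤ} (hK : K ≠ 0) (i : Fin 3) :
    leray u K i = u K i - (K i : ℂ) * (∑ j, u K j * (K j : ℂ)) / (∑ j, (K j : ℂ) ^ 2) := if_neg hK

lemma leray_div (u : Field) (K : Fin 3 → ℤ) : ∑ i, (K i : ℂ) * leray u K i = 0 := by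
  by_cases hK : K = 0
  · simp [hK]
  · have h := sum_intCast_sq_ne_zero hK
    have e : ∀ i, (K i : ℂ) * leray u K i = u K i * (K i : ℂ) -
        (K i : ℂ) ^ 2 * ((∑ j, u K j * (K j : ℂ)) / (∑ j, (K j : ℂ) ^ 2)) := fun i => by
      rw [leray_of_ne u hK]
      ring
    simp only [e]
    rw [Finset.sum_sub_distrib, ← Finset.sum_mul, mul_div_cancel₀ _ h, sub_self]

lemma leray_conj {u : Field} (hu : ∀ K i, (starRingEnd ℂ) (u K i) = u (-K) i) (K : Fin 3 → ℤ)
    (i : Fin 3) : (starRingEnd ℂ) (leray u K i) = leray u (-K) i := by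
  by_cases hK : K = 0
  · simp [hK, leray_zero]
  · rw [leray_of_ne u hK, leray_of_ne u (neg_ne_zero.2 hK)]
    simp [hu]

lemma leray_sub (u v : Field) : leray (u - v) = leray u - leray v := by
  funext K i
  by_cases hK : K = 0
  · simp [hK, leray_zero]
  · simp only [Pi.sub_apply, leray_of_ne _ hK, sub_mul, Finset.sum_sub_distrib]
    ring

lemma leray_add (u v : Field) : leray (u + v) = leray u + leray v := by
  funext K i
  by_cases hK : K = 0
  · simp [hK, leray_zero]
  · simp only [Pi.add_apply, leray_of_ne _ hK, add_mul, Finset.sum_add_distrib]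
    ring

lemma leray_smul (c : ℝ) (u : Field) : leray (c • u) = c • leray u := by
  funext K i
  by_cases hK : K = 0
  · simp [hK, leray_zero]
  · simp only [Pi.smul_apply, leray_of_ne _ hK, Complex.real_smul, mul_assoc, ← Finset.mul_sum]
    ring

lemma leray_eq_self {u : Field} (h0 : u 0 = 0) (hd : ∀ K, ∑ i, (K i : ℂ) * u K i = 0) :
    leray u = u := by
  funext K i
  by_cases hK : K = 0
  · rw [hK, leray_zero, h0]
  · have h1 : ∑ j, u K j * (K j : ℂ) = 0 := by
      rw [← hd K]
      exact Finset.sum_congr rfl fun _ _ => mul_comm _ _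
    rw [leray_of_ne u hK, h1]
    simp

/-- The Leray projection is orthogonal at each frequency. -/
lemma sum_conj_leray_mul (u : Field) {K : Fin 3 → ℤ} {w : Fin 3 → ℂ} (h0 : K = 0 → w = 0)
    (hw : ∑ i, (K i : ℂ) * w i = 0) :
    ∑ i, (starRingEnd ℂ) (leray u K i) * w i = ∑ i, (starRingEnd ℂ) (u K i) * w i := by
  by_cases hK : K = 0
  · simp [h0 hK]
  · have e : ∀ i, (starRingEnd ℂ) (leray u K i) * w i = (starRingEnd ℂ) (u K i) * w i -
        (starRingEnd ℂ) ((∑ j, u K j * (K j : ℂ)) / (∑ j, (K j : ℂ) ^ 2)) * ((K i : ℂ) * w i) :=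
      fun i => by
        rw [leray_of_ne u hK, map_sub, mul_div_assoc, map_mul, map_intCast]
        ring
    simp only [e]
    rw [Finset.sum_sub_distrib, ← Finset.mul_sum, hw, mul_zero, sub_zero]

lemma sum_norm_leray_sq_le (u : Field) (K : Fin 3 → ℤ) :
    ∑ i, ‖leray u K i‖ ^ 2 ≤ ∑ i, ‖u K i‖ ^ 2 := by
  have h1 := sum_conj_leray_mul u (K := K) (w := leray u K) (fun h => by rw [h, leray_zero])
    (leray_div u K)
  have e : ∀ z : ℂ, (starRingEnd ℂ) z * z = ((‖z‖ ^ 2 : ℝ) : ℂ) := fun z => by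
    rw [mul_comm, Complex.mul_conj, Complex.normSq_eq_norm_sq]
  have h2 : ∑ i, ‖leray u K i‖ ^ 2 ≤ ∑ i, ‖u K i‖ * ‖leray u K i‖ := by
    simp only [e] at h1
    rw [← Complex.ofReal_sum] at h1
    have h3 := congrArg norm h1
    rw [Complex.norm_real, Real.norm_of_nonneg (by positivity)] at h3
    rw [h3]
    refine (norm_sum_le _ _).trans (le_of_eq ?_)
    simp
  have h3 : ∑ i, ‖u K i‖ * ‖leray u K i‖ ≤
      ∑ i, (‖u K i‖ ^ 2 / 2 + ‖leray u K i‖ ^ 2 / 2) := Finset.sum_le_sum fun i _ => by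
    nlinarith [sq_nonneg (‖u K i‖ - ‖leray u K i‖)]
  rw [Finset.sum_add_distrib, ← Finset.sum_div, ← Finset.sum_div] at h3
  linarith

/-! ### Estimates for the convolution -/

/-- The sum of the absolute values of the components of a Fourier coefficient. -/
def amp (u : Field) (K : Fin 3 → ℤ) : ℝ≥0∞ := ∑ i, ‖u K i‖ₑ

lemma tsum_prod_enorm_sq (x : Hsp) :
    ∑' p : (Fin 3 → ℤ) × Fin 3, ‖coef x p.1 p.2‖ₑ ^ 2 = ‖x‖ₑ ^ 2 := by
  have h := hasSum_norm_sq x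
  have e : ∀ {E : Type} [NormedAddCommGroup E] (z : E), ‖z‖ₑ ^ 2 = ENNReal.ofReal (‖z‖ ^ 2) :=
    fun z => by rw [ENNReal.ofReal_pow (norm_nonneg _), ofReal_norm]
  simp only [e]
  rw [← ENNReal.ofReal_tsum_of_nonneg (fun _ => sq_nonneg _) h.summable, h.tsum_eq]

lemma tsum_sum_enorm_sq (x : Hsp) : ∑' K, ∑ i, ‖coef x K i‖ₑ ^ 2 = ‖x‖ₑ ^ 2 := by
  rw [← tsum_prod_enorm_sq, ENNReal.tsum_prod (f := fun K i => ‖coef x K i‖ₑ ^ 2)]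
  simp only [tsum_fintype]

lemma amp_sq_le (u : Field) (K : Fin 3 → ℤ) : amp u K ^ 2 ≤ 3 * ∑ i, ‖u K i‖ₑ ^ 2 := by
  have h := ENNReal_tsum_mul_sq_le (fun i : Fin 3 => ‖u K i‖ₑ) (fun _ => 1)
  simp only [tsum_fintype, mul_one, one_pow, Finset.sum_const, Finset.card_univ, Fintype.card_fin,
    nsmul_eq_mul] at h
  rw [mul_comm]
  exact_mod_cast h

lemma tsum_amp_sq_le (x : Hsp) : ∑' K, amp (coef x) K ^ 2 ≤ 3 * ‖x‖ₑ ^ 2 := by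
  rw [← tsum_sum_enorm_sq, ← ENNReal.tsum_mul_left]
  exact ENNReal.tsum_le_tsum fun K => amp_sq_le _ _

/-- The terms of the convolution that gives the Fourier coefficients of `(v · ∇) u`. -/
def convTerm (L : ℝ) (v u : Field) (K : Fin 3 → ℤ) (i : Fin 3) (J : Fin 3 → ℤ) : ℂ :=
  ∑ j, v J j * (2 * Real.pi * Complex.I * ((K - J) j : ℂ) / L * u (K - J) i)

lemma conv_eq_tsum (L : ℝ) (v u : Field) (K : Fin 3 → ℤ) (i : Fin 3) :
    conv L v u K i = ∑' J, convTerm L v u K i J := rfl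

section Conv
variable {L : ℝ} (hL : 0 < L)

include hL in
lemma norm_deriv_symbol_le (j : Fin 3) (M : Fin 3 → ℤ) :
    ‖(2 * Real.pi * Complex.I * (M j : ℂ) / L : ℂ)‖ ≤ lam L M ^ (1 / 2 : ℝ) := by
  have h1 : ‖(2 * Real.pi * Complex.I * (M j : ℂ) / L : ℂ)‖ = 2 * Real.pi * |(M j : ℝ)| / L := by
    simp [abs_of_pos hL, abs_of_pos Real.pi_pos]
  rw [h1, ← Real.sqrt_eq_rpow]
  refine Real.le_sqrt_of_sq_le ?_
  by_cases hM : M = 0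
  · simp [hM, lam]
  · rw [lam_of_ne hM, eig, div_pow, mul_pow, sq_abs, mul_pow, div_mul_eq_mul_div]
    have h2 : (M j : ℝ) ^ 2 ≤ ∑ i, (M i : ℝ) ^ 2 :=
      Finset.single_le_sum (f := fun i => (M i : ℝ) ^ 2) (fun _ _ => sq_nonneg _)
        (Finset.mem_univ j)
    norm_num
    gcongr

lemma enorm_deriv_coef_le (x : Hsp) (j i : Fin 3) (M : Fin 3 → ℤ) :
    ‖2 * Real.pi * Complex.I * (M j : ℂ) / L * coef (Dop hL x) M i‖ₑ ≤ ‖coef x M i‖ₑ := by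
  rw [enorm_le_iff_norm_le, norm_mul, coef_Dop, norm_mul, Complex.norm_real,
    Real.norm_of_nonneg (Real.rpow_nonneg (lam_pos hL M).le _), ← mul_assoc]
  refine mul_le_of_le_one_left (norm_nonneg _) ?_
  refine (mul_le_mul_of_nonneg_right (norm_deriv_symbol_le hL j M)
    (Real.rpow_nonneg (lam_pos hL M).le _)).trans_eq ?_
  rw [← Real.rpow_add (lam_pos hL M)]
  norm_num

lemma enorm_convTerm_le (v : Field) (x : Hsp) (K : Fin 3 → ℤ) (i : Fin 3) (J : Fin 3 → ℤ) :
    ‖convTerm L v (coef (Dop hL x)) K i J‖ₑ ≤ amp v J * ‖coef x (K - J) i‖ₑ := by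
  rw [convTerm, amp, Finset.sum_mul]
  refine (enorm_sum_le _ _).trans (Finset.sum_le_sum fun j _ => ?_)
  rw [enorm_mul]
  gcongr
  exact enorm_deriv_coef_le hL x j i (K - J)

lemma tsum_enorm_convTerm_sq_le (z x : Hsp) (K : Fin 3 → ℤ) (i : Fin 3) :
    (∑' J, ‖convTerm L (coef z) (coef (Dop hL x)) K i J‖ₑ) ^ 2 ≤ 3 * ‖z‖ₑ ^ 2 * ‖x‖ₑ ^ 2 := by
  have h1 : ∑' J, ‖convTerm L (coef z) (coef (Dop hL x)) K i J‖ₑ ≤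
      ∑' J, amp (coef z) J * ‖coef x (K - J) i‖ₑ :=
    ENNReal.tsum_le_tsum fun J => enorm_convTerm_le hL _ _ _ _ _
  have h2 := ENNReal_tsum_mul_sq_le (fun J => amp (coef z) J) (fun J => ‖coef x (K - J) i‖ₑ)
  have h3 : ∑' J, ‖coef x (K - J) i‖ₑ ^ 2 ≤ ‖x‖ₑ ^ 2 := by
    refine ((Equiv.subLeft K).tsum_eq fun M => ‖coef x M i‖ₑ ^ 2).trans_le ?_
    rw [← tsum_sum_enorm_sq]
    exact ENNReal.tsum_le_tsum fun M =>
      Finset.single_le_sum (f := fun i => ‖coef x M i‖ₑ ^ 2) (fun _ _ => zero_le)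
        (Finset.mem_univ i)
  calc _ ≤ _ := pow_le_pow_left₀ zero_le h1 2
    _ ≤ _ := h2
    _ ≤ _ := by
      gcongr
      exact tsum_amp_sq_le z

lemma summable_convTerm (z x : Hsp) (K : Fin 3 → ℤ) (i : Fin 3) :
    Summable (convTerm L (coef z) (coef (Dop hL x)) K i) := by
  refine Summable.of_norm (tsum_enorm_ne_top_iff_summable_norm.1 fun h => ?_)
  have h1 := tsum_enorm_convTerm_sq_le hL z x K i
  rw [h] at h1
  have h2 : 3 * ‖z‖ₑ ^ 2 * ‖x‖ₑ ^ 2 < ∞ := by finiteness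
  simp [h2.ne] at h1

lemma norm_conv_sq_le (z x : Hsp) (K : Fin 3 → ℤ) (i : Fin 3) :
    ‖conv L (coef z) (coef (Dop hL x)) K i‖ ^ 2 ≤ 3 * ‖z‖ ^ 2 * ‖x‖ ^ 2 := by
  have h1 : ‖conv L (coef z) (coef (Dop hL x)) K i‖ₑ ^ 2 ≤ 3 * ‖z‖ₑ ^ 2 * ‖x‖ₑ ^ 2 :=
    (pow_le_pow_left₀ zero_le enorm_tsum_le_tsum_enorm 2).trans
      (tsum_enorm_convTerm_sq_le hL z x K i)
  have h2 := ENNReal.toReal_mono (by finiteness) h1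
  simpa using h2

lemma conv_conj {v u : Field} (hv : ∀ K i, (starRingEnd ℂ) (v K i) = v (-K) i)
    (hu : ∀ K i, (starRingEnd ℂ) (u K i) = u (-K) i) (K : Fin 3 → ℤ) (i : Fin 3) :
    (starRingEnd ℂ) (conv L v u K i) = conv L v u (-K) i := by
  rw [conv_eq_tsum, conv_eq_tsum, Complex.conj_tsum, ← (Equiv.neg _).tsum_eq]
  refine tsum_congr fun J => ?_
  simp only [convTerm, map_sum, map_mul, hv, hu, map_div₀, Complex.conj_I, Complex.conj_ofReal,
    Equiv.neg_apply, neg_neg, map_ofNat, map_intCast]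
  refine Finset.sum_congr rfl fun j _ => ?_
  rw [show -(K - -J) = -K - J by abel]
  simp only [Pi.sub_apply, Pi.neg_apply, Int.cast_sub, Int.cast_neg]
  ring

end Conv

/-! ### The advection term as a bounded bilinear map -/

section Advection
variable {L : ℝ} (hL : 0 < L)

include hL in
lemma resolvent_nonneg (β : ℝ) (K : Fin 3 → ℤ) : 0 ≤ (1 + β ^ 2 * lam L K)⁻¹ := by
  have := lam_pos hL K
  positivity

include hL in
lemma resolvent_le {β : ℝ} (hβ : 0 < β) (K : Fin 3 → ℤ) :
    (1 + β ^ 2 * lam L K)⁻¹ ≤ (β ^ 2)⁻¹ * (lam L K)⁻¹ := by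
  have := lam_pos hL K
  rw [← mul_inv]
  gcongr
  linarith

/-- The coefficients of `(I + β² A)⁻¹ B(z, A^(-1/2) x)`. -/
def advectField (β : ℝ) (z x : Hsp) : Field := fun K i =>
  (((1 + β ^ 2 * lam L K)⁻¹ : ℝ) : ℂ) * leray (conv L (coef z) (coef (Dop hL x))) K i

lemma sum_norm_advectField_sq_le {β : ℝ} (hβ : 0 < β) (z x : Hsp) (K : Fin 3 → ℤ) :
    ∑ i, ‖advectField hL β z x K i‖ ^ 2 ≤
      9 * (β ^ 2)⁻¹ ^ 2 * ‖z‖ ^ 2 * ‖x‖ ^ 2 * (lam L K)⁻¹ ^ 2 := by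
  have h1 : ∑ i, ‖advectField hL β z x K i‖ ^ 2 = ((1 + β ^ 2 * lam L K)⁻¹) ^ 2 *
      ∑ i, ‖leray (conv L (coef z) (coef (Dop hL x))) K i‖ ^ 2 := by
    rw [Finset.mul_sum]
    refine Finset.sum_congr rfl fun i _ => ?_
    rw [advectField, norm_mul, mul_pow, Complex.norm_real,
      Real.norm_of_nonneg (resolvent_nonneg hL β K)]
  have h2 : ∑ i, ‖leray (conv L (coef z) (coef (Dop hL x))) K i‖ ^ 2 ≤
      9 * ‖z‖ ^ 2 * ‖x‖ ^ 2 := by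
    refine (sum_norm_leray_sq_le _ K).trans
      ((Finset.sum_le_sum fun i _ => norm_conv_sq_le hL z x K i).trans_eq ?_)
    simp
    ring
  have h3 := pow_le_pow_left₀ (resolvent_nonneg hL β K) (resolvent_le hL hβ K) 2
  rw [h1]
  calc _ ≤ ((β ^ 2)⁻¹ * (lam L K)⁻¹) ^ 2 * (9 * ‖z‖ ^ 2 * ‖x‖ ^ 2) :=
        mul_le_mul h3 h2 (by positivity) (by positivity)
    _ = _ := by ring

lemma summable_prod_fin_three {f : (Fin 3 → ℤ) × Fin 3 → ℝ} (hf : ∀ p, 0 ≤ f p)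
    (h : Summable fun K => ∑ i, f (K, i)) : Summable f := by
  refine (summable_prod_of_nonneg hf).2 ⟨fun K => (hasSum_fintype _).summable, ?_⟩
  simpa only [tsum_fintype] using h

lemma isCoef_advectField {β : ℝ} (hβ : 0 < β) (z x : Hsp) : IsCoef (advectField hL β z x) where
  zero := by
    funext i
    simp [advectField, leray_zero]
  conj K i := by
    rw [advectField, advectField, map_mul, Complex.conj_ofReal, lam_neg,
      leray_conj (conv_conj (isCoef z).conj (isCoef _).conj)]
  div K := by
    have h := leray_div (conv L (coef z) (coef (Dop hL x))) K
    simp only [advectField, mul_left_comm _ (((1 + β ^ 2 * lam L K)⁻¹ : ℝ) : ℂ)]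
    rw [← Finset.mul_sum, h, mul_zero]
  summable := by
    refine summable_prod_fin_three (fun _ => sq_nonneg _) ?_
    exact Summable.of_nonneg_of_le (fun K => Finset.sum_nonneg fun _ _ => sq_nonneg _)
      (fun K => sum_norm_advectField_sq_le hL hβ z x K) ((summable_lam_inv_sq hL).mul_left _)

lemma conv_add_left (z z' x : Hsp) : conv L (coef (z + z')) (coef (Dop hL x)) =
    conv L (coef z) (coef (Dop hL x)) + conv L (coef z') (coef (Dop hL x)) := by
  funext K i
  rw [Pi.add_apply, Pi.add_apply, conv_eq_tsum, conv_eq_tsum, conv_eq_tsum,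
    ← (summable_convTerm hL z x K i).tsum_add (summable_convTerm hL z' x K i)]
  refine tsum_congr fun J => ?_
  simp only [convTerm, coef_add, Pi.add_apply, add_mul, Finset.sum_add_distrib]

lemma conv_add_right (z x x' : Hsp) : conv L (coef z) (coef (Dop hL (x + x'))) =
    conv L (coef z) (coef (Dop hL x)) + conv L (coef z) (coef (Dop hL x')) := by
  funext K i
  rw [Pi.add_apply, Pi.add_apply, conv_eq_tsum, conv_eq_tsum, conv_eq_tsum,
    ← (summable_convTerm hL z x K i).tsum_add (summable_convTerm hL z x' K i)]
  refine tsum_congr fun J => ?_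
  simp only [convTerm, map_add, coef_add, Pi.add_apply, mul_add, Finset.sum_add_distrib]

lemma conv_smul_left (c : ℝ) (z x : Hsp) : conv L (coef (c • z)) (coef (Dop hL x)) =
    c • conv L (coef z) (coef (Dop hL x)) := by
  funext K i
  rw [Pi.smul_apply, Pi.smul_apply, conv_eq_tsum, conv_eq_tsum, ← tsum_const_smul'']
  refine tsum_congr fun J => ?_
  simp only [convTerm, coef_smul, Pi.smul_apply, smul_mul_assoc, Finset.smul_sum]

lemma conv_smul_right (c : ℝ) (z x : Hsp) : conv L (coef z) (coef (Dop hL (c • x))) =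
    c • conv L (coef z) (coef (Dop hL x)) := by
  funext K i
  rw [Pi.smul_apply, Pi.smul_apply, conv_eq_tsum, conv_eq_tsum, ← tsum_const_smul'']
  refine tsum_congr fun J => ?_
  simp only [convTerm, map_smul, coef_smul, Pi.smul_apply, mul_smul_comm, Finset.smul_sum]

/-- The bilinear map `(z, x) ↦ (I + β² A)⁻¹ B(z, A^(-1/2) x)` on `H`. The advection term is
integrable only, but its Fourier coefficients are bounded, and `∑ λ_K⁻² < ∞`. -/
def advect {β : ℝ} (hβ : 0 < β) : Hsp →L[ℝ] Hsp →L[ℝ] Hsp :=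
  LinearMap.mkContinuous₂
    (LinearMap.mk₂ ℝ (fun z x => Hsp.mk _ (isCoef_advectField hL hβ z x))
      (fun z z' x => by
        ext K i
        simp only [coef_mk, coef_add, Pi.add_apply, advectField]
        rw [← coef_add, conv_add_left, leray_add]
        simp only [Pi.add_apply, mul_add])
      (fun c z x => by
        ext K i
        simp only [coef_mk, coef_smul, Pi.smul_apply, advectField]
        rw [← coef_smul, conv_smul_left, leray_smul]
        simp only [Pi.smul_apply, mul_smul_comm])
      (fun z x x' => by
        ext K i
        simp only [coef_mk, coef_add, Pi.add_apply, advectField]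
        rw [conv_add_right, leray_add]
        simp only [Pi.add_apply, mul_add])
      (fun c z x => by
        ext K i
        simp only [coef_mk, coef_smul, Pi.smul_apply, advectField]
        rw [conv_smul_right, leray_smul]
        simp only [Pi.smul_apply, mul_smul_comm]))
    (3 * (β ^ 2)⁻¹ * Real.sqrt (∑' K, (lam L K)⁻¹ ^ 2)) (fun z x => by
      rw [LinearMap.mk₂_apply]
      refine (sq_le_sq₀ (norm_nonneg _) (by positivity)).1 ?_
      have hs : 0 ≤ ∑' K, (lam L K)⁻¹ ^ 2 := tsum_nonneg fun _ => sq_nonneg _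
      rw [mul_pow, mul_pow, mul_pow, Real.sq_sqrt hs, ← (hasSum_norm_sq _).tsum_eq,
        (hasSum_norm_sq _).summable.tsum_prod, ← tsum_mul_left, ← tsum_mul_right, ← tsum_mul_right]
      have h1 := (summable_lam_inv_sq hL).mul_left (9 * (β ^ 2)⁻¹ ^ 2 * ‖z‖ ^ 2 * ‖x‖ ^ 2)
      simp only [tsum_fintype, coef_mk]
      have h2 : Summable fun K => ∑ i, ‖advectField hL β z x K i‖ ^ 2 :=
        Summable.of_nonneg_of_le (fun K => Finset.sum_nonneg fun _ _ => sq_nonneg _)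
          (fun K => sum_norm_advectField_sq_le hL hβ z x K) h1
      refine (h2.tsum_le_tsum (fun K => sum_norm_advectField_sq_le hL hβ z x K) h1).trans_eq ?_
      refine tsum_congr fun K => ?_
      ring)

lemma coef_advect {β : ℝ} (hβ : 0 < β) (z x : Hsp) (K : Fin 3 → ℤ) (i : Fin 3) :
    coef (advect hL hβ z x) K i = (((1 + β ^ 2 * lam L K)⁻¹ : ℝ) : ℂ) *
      leray (conv L (coef z) (coef (Dop hL x))) K i := rfl

/-! ### The trilinear form -/

lemma coef_testOp (β : ℝ) (y : Hsp) (K : Fin 3 → ℤ) (i : Fin 3) :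
    coef (testOp hL β y) K i = (((lam L K)⁻¹ + β ^ 2 : ℝ) : ℂ) * coef y K i := by
  rw [testOp_apply, coef_add, Pi.add_apply, Pi.add_apply, coef_Dop_Dop, coef_smul, Pi.smul_apply,
    Pi.smul_apply, Complex.real_smul]
  push_cast
  ring

/-- Tested against `(A⁻¹ + β²) d`, the advection term is the trilinear form at `A⁻¹ d`: the
resolvent cancels, and the Leray projection is orthogonal. -/
lemma hasSum_inner_advect {β : ℝ} (hβ : 0 < β) (z x d : Hsp) :
    HasSum (fun K => (∑ i, (starRingEnd ℂ) (conv L (coef z) (coef (Dop hL x)) K i) *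
      coef (Dop hL (Dop hL d)) K i).re) (inner ℝ (advect hL hβ z x) (testOp hL β d)) := by
  have h := hasSum_inner (advect hL hβ z x) (testOp hL β d)
  have h1 := h.prod_fiberwise fun K => hasSum_fintype _
  refine h1.congr_fun fun K => ?_
  rw [← sum_conj_leray_mul _ (fun hK => by rw [hK, (isCoef (Dop hL (Dop hL d))).zero])
    ((isCoef (Dop hL (Dop hL d))).div K), Complex.re_sum]
  refine Finset.sum_congr rfl fun i _ => ?_
  rw [Complex.inner, coef_advect, coef_testOp, coef_Dop_Dop]
  congr 1
  rw [map_mul, Complex.conj_ofReal]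
  have hl := lam_pos hL K
  have e : (1 + β ^ 2 * lam L K)⁻¹ * ((lam L K)⁻¹ + β ^ 2) = (lam L K)⁻¹ := by
    field_simp
  have e' : (((1 + β ^ 2 * lam L K)⁻¹ : ℝ) : ℂ) * (((lam L K)⁻¹ + β ^ 2 : ℝ) : ℂ) =
      (((lam L K)⁻¹ : ℝ) : ℂ) := by rw [← Complex.ofReal_mul, e]
  rw [← e']
  ring

/-- The weight `λ` as an extended nonnegative number. -/
def lamE (L : ℝ) (K : Fin 3 → ℤ) : ℝ≥0∞ := ENNReal.ofReal (lam L K)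

include hL in
lemma lamE_ne_zero (K : Fin 3 → ℤ) : lamE L K ≠ 0 := by
  simp [lamE, lam_pos hL K]

lemma lamE_ne_top (K : Fin 3 → ℤ) : lamE L K ≠ ∞ := ENNReal.ofReal_ne_top

include hL in
lemma tsum_lamE_inv_sq : ∑' K, (lamE L K)⁻¹ ^ 2 = ENNReal.ofReal (∑' K, (lam L K)⁻¹ ^ 2) := by
  rw [ENNReal.ofReal_tsum_of_nonneg (fun _ => sq_nonneg _) (summable_lam_inv_sq hL)]
  refine tsum_congr fun K => ?_
  rw [lamE, ← ENNReal.ofReal_inv_of_pos (lam_pos hL K),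
    ENNReal.ofReal_pow (inv_nonneg.2 (lam_pos hL K).le)]

lemma lamE_mul_amp_Dop_sq (x : Hsp) (K : Fin 3 → ℤ) :
    lamE L K * amp (coef (Dop hL x)) K ^ 2 = amp (coef x) K ^ 2 := by
  have hl := lam_pos hL K
  have h1 : amp (coef (Dop hL x)) K =
      ENNReal.ofReal (lam L K ^ (-(1 / 2) : ℝ)) * amp (coef x) K := by
    rw [amp, amp, Finset.mul_sum]
    refine Finset.sum_congr rfl fun i _ => ?_
    rw [coef_Dop, enorm_mul]
    congr 1
    rw [← ofReal_norm, Complex.norm_real, Real.norm_of_nonneg (Real.rpow_nonneg hl.le _)]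
  rw [h1, mul_pow, ← mul_assoc, lamE, ← ENNReal.ofReal_pow (Real.rpow_nonneg hl.le _),
    ← ENNReal.ofReal_mul hl.le]
  have h2 : lam L K * (lam L K ^ (-(1 / 2) : ℝ)) ^ 2 = 1 := by
    rw [← Real.rpow_natCast, ← Real.rpow_mul hl.le]
    norm_num [Real.rpow_neg_one]
    exact mul_inv_cancel₀ hl.ne'
  rw [h2, ENNReal.ofReal_one, one_mul]

/-- The bound for the trilinear form when the transport velocity `z` has frequencies only where
`convWeight` is at most `θ`. -/
lemma tsum_trilinear_sq_le {θ : ℝ≥0∞} (z y d : Hsp)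
    (hz : ∀ J, coef z J ≠ 0 → convWeight (lamE L) J ≤ θ) :
    (∑' K, ∑' J, ∑ i, ‖convTerm L (coef z) (coef (Dop hL (Dop hL y))) K i J‖ₑ *
      ‖coef (Dop hL (Dop hL d)) K i‖ₑ) ^ 2 ≤
      27 * θ * ‖z‖ₑ ^ 2 * ‖y‖ₑ ^ 2 * ‖Dop hL d‖ₑ ^ 2 := by
  have h1 : ∑' K, ∑' J, ∑ i, ‖convTerm L (coef z) (coef (Dop hL (Dop hL y))) K i J‖ₑ *
      ‖coef (Dop hL (Dop hL d)) K i‖ₑ ≤ ∑' K, ∑' J, amp (coef z) J *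
        amp (coef (Dop hL y)) (K - J) * amp (coef (Dop hL (Dop hL d))) K := by
    refine ENNReal.tsum_le_tsum fun K => ENNReal.tsum_le_tsum fun J => ?_
    calc _ ≤ ∑ i, amp (coef z) J * ‖coef (Dop hL y) (K - J) i‖ₑ *
            amp (coef (Dop hL (Dop hL d))) K := by
          refine Finset.sum_le_sum fun i _ => ?_
          refine mul_le_mul' (enorm_convTerm_le hL _ _ _ _ _) ?_
          exact Finset.single_le_sum (f := fun i => ‖coef (Dop hL (Dop hL d)) K i‖ₑ)
            (fun _ _ => zero_le) (Finset.mem_univ i)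
      _ = _ := by rw [← Finset.sum_mul, ← Finset.mul_sum, amp]; rfl
  have h2 : ∑' K, ∑' J, amp (coef z) J * amp (coef (Dop hL y)) (K - J) *
      amp (coef (Dop hL (Dop hL d))) K = ∑' J, ∑' M, amp (coef z) J * amp (coef (Dop hL y)) M *
        amp (coef (Dop hL (Dop hL d))) (J + M) := by
    rw [ENNReal.tsum_comm]
    refine tsum_congr fun J => ?_
    rw [← tsum_shift _ J]
    refine tsum_congr fun M => ?_
    rw [add_sub_cancel_left]
  have h3 := tsum_conv_sq_le (lamE L) (lamE_ne_zero hL) lamE_ne_top (amp (coef z))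
    (amp (coef (Dop hL y))) (amp (coef (Dop hL (Dop hL d))))
  simp only [lamE_mul_amp_Dop_sq] at h3
  have h4 : ∑' J, amp (coef z) J ^ 2 * convWeight (lamE L) J ≤ θ * (3 * ‖z‖ₑ ^ 2) := by
    refine le_trans ?_ (mul_le_mul_right (tsum_amp_sq_le z) θ)
    rw [← ENNReal.tsum_mul_left]
    refine ENNReal.tsum_le_tsum fun J => ?_
    by_cases hJ : coef z J = 0
    · simp [amp, hJ]
    · rw [mul_comm]
      gcongr
      exact hz J hJ
  calc _ ≤ _ := pow_le_pow_left₀ zero_le (h1.trans_eq h2) 2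
    _ ≤ _ := h3
    _ ≤ θ * (3 * ‖z‖ₑ ^ 2) * ((3 * ‖y‖ₑ ^ 2) * (3 * ‖Dop hL d‖ₑ ^ 2)) := by
      gcongr
      · exact tsum_amp_sq_le y
      · exact tsum_amp_sq_le (Dop hL d)
    _ = _ := by ring

lemma sum_conj_conv_mul (z y : Hsp) (w : Fin 3 → ℂ) (K : Fin 3 → ℤ) :
    ∑ i, (starRingEnd ℂ) (conv L (coef z) (coef (Dop hL y)) K i) * w i =
      ∑' J, ∑ i, (starRingEnd ℂ) (convTerm L (coef z) (coef (Dop hL y)) K i J) * w i := by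
  have hs : ∀ i ∈ Finset.univ, HasSum (fun J =>
      (starRingEnd ℂ) (convTerm L (coef z) (coef (Dop hL y)) K i J) * w i)
      ((starRingEnd ℂ) (conv L (coef z) (coef (Dop hL y)) K i) * w i) := fun i _ =>
    (Complex.hasSum_conj'.2 (by
      simpa [conv_eq_tsum] using (summable_convTerm hL z y K i).hasSum)).mul_right _
  exact (hasSum_sum hs).tsum_eq.symm

lemma abs_inner_advect_le {β : ℝ} (hβ : 0 < β) {θ : ℝ} (hθ : 0 ≤ θ) (z y d : Hsp)
    (hz : ∀ J, coef z J ≠ 0 → convWeight (lamE L) J ≤ ENNReal.ofReal θ) :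
    |inner ℝ (advect hL hβ z (Dop hL y)) (testOp hL β d)| ≤
      6 * Real.sqrt θ * ‖z‖ * ‖y‖ * ‖Dop hL d‖ := by
  have h1 := tsum_trilinear_sq_le hL z y d hz
  have h2 : ‖inner ℝ (advect hL hβ z (Dop hL y)) (testOp hL β d)‖ₑ ≤
      ∑' K, ∑' J, ∑ i, ‖convTerm L (coef z) (coef (Dop hL (Dop hL y))) K i J‖ₑ *
        ‖coef (Dop hL (Dop hL d)) K i‖ₑ := by
    rw [← (hasSum_inner_advect hL hβ z (Dop hL y) d).tsum_eq]
    refine enorm_tsum_le_tsum_enorm.trans (ENNReal.tsum_le_tsum fun K => ?_)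
    have h3 : ∀ c : ℂ, ‖c.re‖ₑ ≤ ‖c‖ₑ := fun c => by
      rw [enorm_le_iff_norm_le]
      exact Complex.abs_re_le_norm c
    refine (h3 _).trans ?_
    rw [sum_conj_conv_mul]
    refine enorm_tsum_le_tsum_enorm.trans (ENNReal.tsum_le_tsum fun J => ?_)
    refine (enorm_sum_le _ _).trans (Finset.sum_le_sum fun i _ => ?_)
    rw [enorm_mul, RCLike.enorm_conj]
  have h3 := (pow_le_pow_left₀ zero_le h2 2).trans h1
  have h4 := ENNReal.toReal_mono (by finiteness) h3
  simp only [ENNReal.toReal_pow, ENNReal.toReal_mul, toReal_enorm, ENNReal.toReal_ofReal hθ,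
    ENNReal.toReal_ofNat] at h4
  refine abs_le_of_sq_le_sq ?_ (by positivity)
  rw [Real.norm_eq_abs, sq_abs] at h4
  refine h4.trans ?_
  simp only [mul_pow, Real.sq_sqrt hθ]
  gcongr
  norm_num

end Advection

/-! ### Antisymmetry of the trilinear form -/

section Antisymmetry
variable {L : ℝ} (hL : 0 < L)

/-- The term of the trilinear form that couples the frequencies `M` and `K` of `b`. -/
def pairTerm (L : ℝ) (z b : Field) (K M : Fin 3 → ℤ) : ℂ :=
  ∑ i, (starRingEnd ℂ) (convTerm L z b K i (K - M)) * b K i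

/-- Antisymmetry of the trilinear form: it uses that `z` is real and divergence free. -/
lemma conj_pairTerm {L : ℝ} {z b : Field} (hz : ∀ K i, (starRingEnd ℂ) (z K i) = z (-K) i)
    (hd : ∀ K, ∑ i, (K i : ℂ) * z K i = 0) (K M : Fin 3 → ℤ) :
    (starRingEnd ℂ) (pairTerm L z b K M) = -pairTerm L z b M K := by
  have h1 : ∀ K M : Fin 3 → ℤ, ∀ i, convTerm L z b K i (K - M) =
      (2 * Real.pi * Complex.I / L) * (∑ j, (M j : ℂ) * z (K - M) j) * b M i := fun K M i => by
    rw [convTerm, Finset.mul_sum, Finset.sum_mul]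
    refine Finset.sum_congr rfl fun j _ => ?_
    rw [sub_sub_cancel]
    ring
  have h2 : ∑ j, (M j : ℂ) * z (K - M) j = ∑ j, (K j : ℂ) * z (K - M) j := by
    have h3 := hd (K - M)
    simp only [Pi.sub_apply, Int.cast_sub, sub_mul, Finset.sum_sub_distrib] at h3
    exact (sub_eq_zero.1 h3).symm
  have h3 : (starRingEnd ℂ) (∑ j, (K j : ℂ) * z (M - K) j) = ∑ j, (K j : ℂ) * z (K - M) j := by
    rw [map_sum]
    refine Finset.sum_congr rfl fun j _ => ?_
    rw [map_mul, map_intCast, hz, neg_sub]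
  rw [pairTerm, pairTerm, map_sum, ← Finset.sum_neg_distrib]
  refine Finset.sum_congr rfl fun i _ => ?_
  rw [h1, h1, map_mul, Complex.conj_conj, h2, map_mul, map_mul, h3]
  simp only [map_div₀, map_mul, Complex.conj_I, Complex.conj_ofReal, map_ofNat]
  ring

/-- The advection term does no work: the double sum of `pairTerm` converges absolutely, so it can be
reordered, and by antisymmetry its real part vanishes. -/
lemma inner_advect_self {β : ℝ} (hβ : 0 < β) (z y : Hsp) :
    inner ℝ (advect hL hβ z (Dop hL y)) (testOp hL β y) = 0 := by
  set b := coef (Dop hL (Dop hL y)) with hb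
  set t : (Fin 3 → ℤ) × (Fin 3 → ℤ) → ℂ := fun p => pairTerm L (coef z) b p.1 p.2 with ht
  have hreindex : ∀ (F : (Fin 3 → ℤ) → ℝ≥0∞) K, ∑' M, F (K - M) = ∑' J, F J := fun F K =>
    (Equiv.subLeft K).tsum_eq F
  have hsum : Summable t := by
    refine Summable.of_norm (tsum_enorm_ne_top_iff_summable_norm.1 fun h => ?_)
    have h1 : ∑' p, ‖t p‖ₑ ≤ ∑' K, ∑' J, ∑ i, ‖convTerm L (coef z) b K i J‖ₑ * ‖b K i‖ₑ := by
      rw [ENNReal.tsum_prod (f := fun K M => ‖t (K, M)‖ₑ)]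
      refine ENNReal.tsum_le_tsum fun K => ?_
      rw [← hreindex (fun J => ∑ i, ‖convTerm L (coef z) b K i J‖ₑ * ‖b K i‖ₑ) K]
      refine ENNReal.tsum_le_tsum fun M => ?_
      refine (enorm_sum_le _ _).trans (Finset.sum_le_sum fun i _ => ?_)
      rw [enorm_mul, RCLike.enorm_conj]
    have h2 := tsum_trilinear_sq_le hL (θ := ∑' K, (lamE L K)⁻¹ ^ 2) z y y
      fun J _ => convWeight_le _ J
    rw [tsum_lamE_inv_sq hL] at h2
    have h3 : 27 * ENNReal.ofReal (∑' K, (lam L K)⁻¹ ^ 2) * ‖z‖ₑ ^ 2 * ‖y‖ₑ ^ 2 *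
        ‖Dop hL y‖ₑ ^ 2 < ∞ := by finiteness
    rw [h, top_le_iff] at h1
    rw [h1, ENNReal.top_pow two_ne_zero, top_le_iff] at h2
    exact h3.ne h2
  have h1 : (starRingEnd ℂ) (∑' p, t p) = -∑' p, t p := by
    rw [Complex.conj_tsum, ← tsum_neg, ← (Equiv.prodComm _ _).tsum_eq]
    refine tsum_congr fun p => ?_
    exact conj_pairTerm (isCoef z).conj (isCoef z).div p.2 p.1
  have h2 : (∑' p, t p).re = 0 := by
    have := congrArg Complex.re h1
    rw [Complex.conj_re, Complex.neg_re] at this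
    linarith
  rw [← h2, hsum.tsum_prod, Complex.re_tsum hsum.prod]
  refine (hasSum_inner_advect hL hβ z (Dop hL y) y).tsum_eq.symm.trans (tsum_congr fun K => ?_)
  rw [sum_conj_conv_mul hL z (Dop hL y)]
  congr 1
  exact ((Equiv.subLeft K).tsum_eq fun J =>
    ∑ i, (starRingEnd ℂ) (convTerm L (coef z) b K i J) * b K i).symm

/-- The advection term of the data assimilation system, in the variables `v = A w` and
`x = A^(1/2) w`. -/
def advectOp {β : ℝ} (hβ : 0 < β) : Hsp →L[ℝ] Hsp →L[ℝ] Hsp := (advect hL hβ).comp (testOp hL β)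

lemma advectOp_apply {β : ℝ} (hβ : 0 < β) (v x : Hsp) :
    advectOp hL hβ v x = advect hL hβ (testOp hL β v) x := rfl

/-- The estimates come from the bound on the trilinear form by `convWeight λ`, which is at most
`∑ λ_K⁻²` and tends to zero at high frequencies. -/
lemma exists_isAdvection {β : ℝ} (hβ : 0 < β) : ∃ C, IsAdvection hL β C (advectOp hL hβ) := by
  set A := normD L ^ 2 + β ^ 2 with hA
  have hA0 : 0 < A := by positivity
  have hS0 : 0 ≤ ∑' K, (lam L K)⁻¹ ^ 2 := tsum_nonneg fun _ => sq_nonneg _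
  refine ⟨6 * Real.sqrt (∑' K, (lam L K)⁻¹ ^ 2) * A, fun v y => inner_advect_self hL hβ _ y,
    by positivity, fun v y d => ?_, fun ε hε => ?_⟩
  · refine (abs_inner_advect_le hL hβ hS0 (testOp hL β v) y d fun J _ => ?_).trans ?_
    · rw [← tsum_lamE_inv_sq hL]
      exact convWeight_le _ J
    · rw [mul_assoc _ A]
      gcongr
      exact norm_testOp_le' hL β v
  · set θ := (ε / (12 * A)) ^ 2 with hθ
    have hθ0 : 0 < θ := by positivity
    have hfin : (∑' K, (lamE L K)⁻¹ ^ 2) ≠ ∞ := by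
      rw [tsum_lamE_inv_sq hL]
      exact ENNReal.ofReal_ne_top
    have h1 := (tendsto_convWeight (lamE L) hfin).eventually_le_const
      (ENNReal.ofReal_pos.2 hθ0)
    obtain ⟨B, hB⟩ := ((eventually_cofinite.1 h1).image (lam L)).bddAbove
    refine ⟨⌈B⌉₊, fun n hn v y d => ?_⟩
    have hBn : B ≤ n := (Nat.le_ceil B).trans (by exact_mod_cast hn)
    have hA2 : ‖testOp hL β (v - cutoffRoot L n (Dop hL v))‖ ≤ A * (2 * ‖v‖) := by
      refine (norm_testOp_le' hL β _).trans (mul_le_mul_of_nonneg_left ?_ hA0.le)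
      have h2 := norm_sub_le v (cutoffRoot L n (Dop hL v))
      have h3 := norm_cutoffRoot_Dop_le hL n v
      linarith
    refine (abs_inner_advect_le hL hβ hθ0.le _ y d fun J hJ => ?_).trans ?_
    · by_contra hc
      refine hJ (funext fun i => ?_)
      have h2 : lam L J ≤ n := (hB ⟨J, hc, rfl⟩).trans hBn
      change coef (testOp hL β (v - cutoffRoot L n (Dop hL v))) J i = 0
      rw [coef_testOp, coef_sub, Pi.sub_apply, Pi.sub_apply, coef_cutoffRoot_Dop, if_pos h2]
      simp
    · have h3 : 6 * Real.sqrt θ * ‖testOp hL β (v - cutoffRoot L n (Dop hL v))‖ ≤ ε * ‖v‖ := by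
        rw [hθ, Real.sqrt_sq (by positivity)]
        refine (mul_le_mul_of_nonneg_left hA2 (by positivity)).trans_eq ?_
        field_simp
        ring
      exact mul_le_mul_of_nonneg_right (mul_le_mul_of_nonneg_right h3 (norm_nonneg _))
        (norm_nonneg _)

end Antisymmetry

/-! ### The interpolation operator on `H` -/

section Interp
variable {L : ℝ} (hL : 0 < L)

lemma ofH_zero (y : Hsp) : ofH L 0 y = coef y := by
  funext K i
  simp [ofH]

include hL in
lemma ofH_two (y : Hsp) : ofH L 2 y = coef (Dop hL (Dop hL y)) := by
  funext K i
  rw [ofH, coef_Dop_Dop]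
  norm_num [Real.rpow_neg_one]

include hL in
lemma ofH_two_eq_ofH_one (y : Hsp) : ofH L 2 y = ofH L 1 (Dop hL y) := by
  funext K i
  rw [ofH_two hL, ofH, coef_Dop]

include hL in
lemma ofH_one (x : Hsp) : ofH L 1 x = coef (Dop hL x) := by
  funext K i
  rw [ofH, coef_Dop]

lemma toH_sub (hL : 0 < L) {s : ℝ} {u v : Field} (hu : u ∈ Vdot L s) (hv : v ∈ Vdot L s) :
    toH L s (u - v) = toH L s u - toH L s v := by
  ext K i
  simp only [coef_toH hL (Submodule.sub_mem _ hu hv), coef_sub, Pi.sub_apply, coef_toH hL hu,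
    coef_toH hL hv, mul_sub]

lemma sobTerm_leray_le (u : Field) (K : Fin 3 → ℤ) : sobTerm L 0 (leray u) K ≤ sobTerm L 0 u K := by
  simpa only [sobTerm, Real.rpow_zero, one_mul] using sum_norm_leray_sq_le u K

lemma leray_mem {u : Field} (hu : u ∈ Hdot L 0) : leray u ∈ Vdot L 0 :=
  ⟨⟨leray_zero u, leray_conj hu.2.1,
    Summable.of_nonneg_of_le (sobTerm_nonneg L 0 _) (sobTerm_leray_le u) hu.2.2⟩, leray_div u⟩

lemma sobNorm_leray_le {u : Field} (hu : u ∈ Hdot L 0) : sobNorm L 0 (leray u) ≤ sobNorm L 0 u := by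
  rcases le_or_gt 0 L with h | h
  · refine Real.sqrt_le_sqrt (mul_le_mul_of_nonneg_left ?_ (by positivity))
    exact (leray_mem hu).1.2.2.tsum_le_tsum (sobTerm_leray_le u) hu.2.2
  · have h1 : L ^ 3 < 0 := by nlinarith [sq_nonneg L, mul_pos_of_neg_of_neg h h]
    have h2 : 0 ≤ ∑' K, sobTerm L 0 (leray u) K := tsum_nonneg (sobTerm_nonneg L 0 _)
    rw [sobNorm, Real.sqrt_eq_zero_of_nonpos (by nlinarith)]
    exact Real.sqrt_nonneg _

variable {h c₁ c₂ : ℝ}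

/-- The interpolant of `A⁻¹ y`, projected onto divergence-free fields. -/
def interpFun (Ih : Hdot L 2 →ₗ[ℝ] Hdot L 0) (y : Hsp) : Hsp :=
  toH L 0 (leray (Ih ⟨ofH L 2 y, (ofH_mem hL 2 y).1⟩))

lemma coef_interpFun (Ih : Hdot L 2 →ₗ[ℝ] Hdot L 0) (y : Hsp) :
    coef (interpFun hL Ih y) = leray (Ih ⟨ofH L 2 y, (ofH_mem hL 2 y).1⟩) := by
  funext K i
  rw [interpFun, coef_toH hL (leray_mem (Ih _).2)]
  simp

lemma norm_interpFun_sub_le (hh : 0 < h) (hc₁ : 0 < c₁) (hc₂ : 0 < c₂)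
    {Ih : Hdot L 2 →ₗ[ℝ] Hdot L 0} (hIh : ApproximationProperty h c₁ c₂ Ih) (y : Hsp) :
    ‖interpFun hL Ih y - Dop hL (Dop hL y)‖ ≤ c₁ * h * ‖Dop hL y‖ + c₂ * h ^ 2 * ‖y‖ := by
  set g : Hdot L 2 := ⟨ofH L 2 y, (ofH_mem hL 2 y).1⟩ with hg
  have hgV : (g : Field) ∈ Vdot L 0 := by
    change ofH L 2 y ∈ Vdot L 0
    rw [ofH_two hL, ← ofH_zero (L := L)]
    exact ofH_mem hL 0 _
  have hdiff : (Ih g : Field) - (g : Field) ∈ Hdot L 0 := Submodule.sub_mem _ (Ih g).2 hgV.1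
  have e : toH L 0 (leray ((Ih g : Field) - (g : Field))) =
      interpFun hL Ih y - Dop hL (Dop hL y) := by
    rw [leray_sub, leray_eq_self hgV.1.1 hgV.2, toH_sub hL (leray_mem (Ih g).2) hgV]
    congr 1
    change toH L 0 (ofH L 2 y) = _
    rw [ofH_two hL, ← ofH_zero (L := L), toH_ofH hL]
  have h1 := sobNorm_eq hL (leray_mem hdiff)
  rw [e] at h1
  have h2 := sobNorm_leray_le hdiff
  have h3 := hIh g
  have h4 : sobNorm L 1 (g : Field) = Real.sqrt (L ^ 3) * ‖Dop hL y‖ := by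
    change sobNorm L 1 (ofH L 2 y) = _
    rw [ofH_two_eq_ofH_one hL, sobNorm_ofH hL]
  have h5 : sobNorm L 2 (g : Field) = Real.sqrt (L ^ 3) * ‖y‖ := sobNorm_ofH hL 2 y
  have hs : 0 < Real.sqrt (L ^ 3) := Real.sqrt_pos.2 (by positivity)
  rw [h1] at h2
  rw [h4, h5] at h3
  have h6 := (pow_le_pow_left₀ (by positivity) h2 2).trans h3
  refine le_of_mul_le_mul_left ?_ hs
  refine (sq_le_sq₀ (by positivity) (by positivity)).1 (h6.trans ?_)
  have h7 : 0 ≤ Real.sqrt (L ^ 3) ^ 2 * (2 * (c₁ * h * ‖Dop hL y‖) * (c₂ * h ^ 2 * ‖y‖)) := by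
    positivity
  linarith

/-- The operator `y ↦ P I_h A⁻¹ y` on `H`. -/
def interpOp (hh : 0 < h) (hc₁ : 0 < c₁) (hc₂ : 0 < c₂) {Ih : Hdot L 2 →ₗ[ℝ] Hdot L 0}
    (hIh : ApproximationProperty h c₁ c₂ Ih) : Hsp →L[ℝ] Hsp :=
  LinearMap.mkContinuous
    { toFun := interpFun hL Ih
      map_add' := fun y y' => by
        have e : (⟨ofH L 2 (y + y'), (ofH_mem hL 2 _).1⟩ : Hdot L 2) =
            ⟨ofH L 2 y, (ofH_mem hL 2 y).1⟩ + ⟨ofH L 2 y', (ofH_mem hL 2 y').1⟩ := by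
          ext K i
          simp [ofH, mul_add]
        ext K i
        rw [coef_add, coef_interpFun, coef_interpFun, coef_interpFun, e, map_add, Submodule.coe_add,
          leray_add]
      map_smul' := fun c y => by
        have e : (⟨ofH L 2 (c • y), (ofH_mem hL 2 _).1⟩ : Hdot L 2) =
            c • ⟨ofH L 2 y, (ofH_mem hL 2 y).1⟩ := by
          ext K i
          simp [ofH]
          ring
        ext K i
        rw [RingHom.id_apply, coef_smul, coef_interpFun, coef_interpFun, e, map_smul,
          Submodule.coe_smul, leray_smul] }
    (normD L ^ 2 + c₁ * h * normD L + c₂ * h ^ 2) (fun y => by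
      have h1 := norm_interpFun_sub_le hL hh hc₁ hc₂ hIh y
      have h2 := norm_le_norm_add_norm_sub (Dop hL (Dop hL y)) (interpFun hL Ih y)
      rw [norm_sub_rev] at h2
      have h3 := norm_Dop_le hL (Dop hL y)
      have h4 := norm_Dop_le hL y
      have h5 := mul_le_mul_of_nonneg_left h4 (normD_pos hL).le
      have h6 := mul_le_mul_of_nonneg_left h4 (by positivity : 0 ≤ c₁ * h)
      change ‖interpFun hL Ih y‖ ≤ _
      linarith)

lemma isInterpolation_interpOp (hh : 0 < h) (hc₁ : 0 < c₁) (hc₂ : 0 < c₂)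
    {Ih : Hdot L 2 →ₗ[ℝ] Hdot L 0} (hIh : ApproximationProperty h c₁ c₂ Ih) :
    IsInterpolation hL (interpOp hL hh hc₁ hc₂ hIh) (c₁ * h) (c₂ * h ^ 2) :=
  norm_interpFun_sub_le hL hh hc₁ hc₂ hIh

lemma coef_interpOp (hh : 0 < h) (hc₁ : 0 < c₁) (hc₂ : 0 < c₂)
    {Ih : Hdot L 2 →ₗ[ℝ] Hdot L 0} (hIh : ApproximationProperty h c₁ c₂ Ih) (y : Hsp) :
    coef (interpOp hL hh hc₁ hc₂ hIh y) = leray (interp Ih (ofH L 2 y)) := by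
  rw [interp, dif_pos (ofH_mem hL 2 y).1]
  exact coef_interpFun hL Ih y

end Interp

/-! ### The equation in the two formulations -/

section Equation
variable {L : ℝ} (hL : 0 < L)

lemma stokes_apply {u : Field} (hu : u 0 = 0) (K : Fin 3 → ℤ) (i : Fin 3) :
    stokes L u K i = (lam L K : ℂ) * u K i := by
  by_cases hK : K = 0
  · simp [stokes, hK, hu]
  · rw [stokes, lam_of_ne hK]

lemma helmholtz_apply {β : ℝ} {u : Field} (hu : u 0 = 0) (K : Fin 3 → ℤ) (i : Fin 3) :
    helmholtz L β u K i = ((1 + β ^ 2 * lam L K : ℝ) : ℂ) * u K i := by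
  rw [helmholtz, Pi.add_apply, Pi.add_apply, Pi.smul_apply, Pi.smul_apply, stokes_apply hu,
    Complex.real_smul]
  push_cast
  ring

/-- `(I + β² A)⁻¹` on `H`. -/
def resolvent (β : ℝ) : Hsp →L[ℝ] Hsp :=
  fcalc L (fun r => (1 + β ^ 2 * r)⁻¹) ⟨1, fun K => by
    have h1 := mul_nonneg (sq_nonneg β) (lam_pos hL K).le
    rw [abs_of_nonneg (resolvent_nonneg hL β K)]
    exact inv_le_one_of_one_le₀ (by linarith)⟩

/-- `A (I + β² A)⁻¹` on `H`, the inverse of `A⁻¹ + β²`. -/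
def testInv {β : ℝ} (hβ : 0 < β) : Hsp →L[ℝ] Hsp :=
  fcalc L (fun r => r * (1 + β ^ 2 * r)⁻¹) ⟨(β ^ 2)⁻¹, fun K => by
    have hl := lam_pos hL K
    rw [abs_of_nonneg (mul_nonneg hl.le (resolvent_nonneg hL β K))]
    refine (mul_le_mul_of_nonneg_left (resolvent_le hL hβ K) hl.le).trans_eq ?_
    field_simp⟩

lemma testOp_testInv {β : ℝ} (hβ : 0 < β) (y : Hsp) : testOp hL β (testInv hL hβ y) = y := by
  ext K i
  have hl := lam_pos hL K
  rw [coef_testOp, testInv, coef_fcalc, ← mul_assoc, ← Complex.ofReal_mul]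
  have : ((lam L K)⁻¹ + β ^ 2) * (lam L K * (1 + β ^ 2 * lam L K)⁻¹) = 1 := by field_simp
  rw [this, Complex.ofReal_one, one_mul]

include hL in
lemma ofH_apply_zero (s : ℝ) (y : Hsp) : ofH L s y 0 = 0 := (ofH_mem hL s y).1.1

lemma helmholtz_ofH_two (β : ℝ) (y : Hsp) : helmholtz L β (ofH L 2 y) = coef (testOp hL β y) := by
  funext K i
  have hl := lam_pos hL K
  rw [helmholtz_apply (ofH_apply_zero hL 2 y), ofH_two hL, coef_testOp, coef_Dop_Dop, ← mul_assoc,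
    ← Complex.ofReal_mul]
  congr 2
  field_simp

lemma ofH_testOp {β : ℝ} (q : Hsp) (K : Fin 3 → ℤ) (i : Fin 3) :
    ofH L (-2) (testOp hL β q) K i = ((1 + β ^ 2 * lam L K : ℝ) : ℂ) * coef q K i := by
  have hl := lam_pos hL K
  rw [ofH, coef_testOp, ← mul_assoc, ← Complex.ofReal_mul]
  congr 2
  norm_num
  field_simp

lemma summable_coef_sq (z : Hsp) (j : Fin 3) : Summable fun K => ‖coef z K j‖ ^ 2 := by
  have hinj : Function.Injective fun K : Fin 3 → ℤ => (K, j) := Prod.mk_left_injective j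
  have h := (isCoef z).summable.comp_injective hinj
  simpa only [Function.comp_def] using h

lemma summable_partialCoeff_sq (x : Hsp) (j i : Fin 3) :
    Summable fun K => ‖partialCoeff L j (fun J => coef (Dop hL x) J i) K‖ ^ 2 :=
  Summable.of_nonneg_of_le (fun _ => sq_nonneg _) (fun K => pow_le_pow_left₀
      (norm_nonneg _) (enorm_le_iff_norm_le.1 (enorm_deriv_coef_le hL x j i K)) 2)
      (summable_coef_sq x i)

lemma bilin_eq (v x : Hsp) :
    bilin L (coef v) (coef (Dop hL x)) = leray (conv L (coef v) (coef (Dop hL x))) :=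
  congrArg leray (advection_eq_conv (summable_coef_sq v) (summable_partialCoeff_sq hL x))

/-- The data assimilation equation at a given time, with `y = A w` and `q = dw/dt`, before and after
application of `(I + β² A)⁻¹`. -/
lemma equation_iff {ν β η h c₁ c₂ : ℝ} (hβ : 0 < β) (hh : 0 < h) (hc₁ : 0 < c₁) (hc₂ : 0 < c₂)
    {Ih : Hdot L 2 →ₗ[ℝ] Hdot L 0} (hIh : ApproximationProperty h c₁ c₂ Ih) (y q yu F : Hsp) :
    ofH L (-2) (testOp hL β q) + ν • stokes L (helmholtz L β (ofH L 2 y)) +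
        bilin L (helmholtz L β (ofH L 2 y)) (ofH L 2 y) =
      ofH L 0 F - η • helmholtz L β (leray (interp Ih (ofH L 2 y) - interp Ih (ofH L 2 yu))) ↔
    q = (resolvent hL β F + η • interpOp hL hh hc₁ hc₂ hIh yu) - ν • y -
      η • interpOp hL hh hc₁ hc₂ hIh y - advectOp hL hβ y (Dop hL y) := by
  set J := interpOp hL hh hc₁ hc₂ hIh with hJ
  have e1 : ∀ K i, stokes L (helmholtz L β (ofH L 2 y)) K i =
      ((1 + β ^ 2 * lam L K : ℝ) : ℂ) * coef y K i := fun K i => by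
    have hl := lam_pos hL K
    rw [helmholtz_ofH_two hL, stokes_apply (isCoef _).zero, coef_testOp, ← mul_assoc,
      ← Complex.ofReal_mul]
    congr 2
    field_simp
  have hcancel : ∀ K, ((1 + β ^ 2 * lam L K : ℝ) : ℂ) * (((1 + β ^ 2 * lam L K)⁻¹ : ℝ) : ℂ) = 1 :=
    fun K => by
      have := mul_nonneg (sq_nonneg β) (lam_pos hL K).le
      rw [← Complex.ofReal_mul, mul_inv_cancel₀ (by linarith), Complex.ofReal_one]
  have e2 : ∀ K i, bilin L (helmholtz L β (ofH L 2 y)) (ofH L 2 y) K i =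
      ((1 + β ^ 2 * lam L K : ℝ) : ℂ) * coef (advectOp hL hβ y (Dop hL y)) K i := fun K i => by
    rw [helmholtz_ofH_two hL, ofH_two hL, bilin_eq, advectOp_apply, coef_advect, ← mul_assoc,
      hcancel, one_mul]
  have e3 : ∀ K i, helmholtz L β (leray (interp Ih (ofH L 2 y) - interp Ih (ofH L 2 yu))) K i =
      ((1 + β ^ 2 * lam L K : ℝ) : ℂ) * (coef (J y) K i - coef (J yu) K i) := fun K i => by
    rw [helmholtz_apply (leray_zero _), leray_sub, hJ, coef_interpOp, coef_interpOp]
    rfl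
  have e4 : ∀ K i, ofH L 0 F K i =
      ((1 + β ^ 2 * lam L K : ℝ) : ℂ) * coef (resolvent hL β F) K i := fun K i => by
    rw [resolvent, coef_fcalc, ← mul_assoc, hcancel, one_mul, ofH_zero]
  have hne : ∀ K, ((1 + β ^ 2 * lam L K : ℝ) : ℂ) ≠ 0 := fun K h0 => by
    have := hcancel K
    rw [h0, zero_mul] at this
    exact zero_ne_one this
  constructor
  · intro H
    ext K i
    have H1 := congrFun (congrFun H K) i
    simp only [Pi.add_apply, Pi.sub_apply, Pi.smul_apply, Complex.real_smul, e1, e2, e3, e4,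
      ofH_testOp] at H1
    refine mul_left_cancel₀ (hne K) ?_
    simp only [coef_add, coef_sub, coef_smul, Pi.add_apply, Pi.sub_apply, Pi.smul_apply,
      Complex.real_smul]
    linear_combination H1
  · intro H
    funext K i
    have H1 := congrArg (fun z => coef z K i) H
    simp only [coef_add, coef_sub, coef_smul, Pi.add_apply, Pi.sub_apply, Pi.smul_apply,
      Complex.real_smul] at H1
    simp only [Pi.add_apply, Pi.sub_apply, Pi.smul_apply, Complex.real_smul, e1, e2, e3, e4,
      ofH_testOp]
    rw [H1]
    ring

end Equation

/-! ### Time-dependent fields and curves in `H` -/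

section TimeDependent
variable {L : ℝ} (hL : 0 < L) {T s : ℝ}

lemma restrict_Ioo_eq_Ioc : volume.restrict (Ioo 0 T) = volume.restrict (Ioc 0 T) :=
  Measure.restrict_congr_set Ioo_ae_eq_Ioc

include hL in
lemma aestronglyMeasurable_toH {g : ℝ → Field} (hm : TimeMeasurable T g)
    (hg : ∀ᵐ t ∂volume.restrict (Ioo 0 T), g t ∈ Vdot L s) :
    AEStronglyMeasurable (fun t => toH L s (g t)) (volume.restrict (Ioo 0 T)) := by
  refine aestronglyMeasurable_of_coef fun K i => ?_
  refine AEMeasurable.congr ((hm K i).const_mul ((lam L K ^ (s / 2) : ℝ) : ℂ)) ?_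
  filter_upwards [hg] with t ht
  rw [coef_toH hL ht]

include hL in
lemma memLp_toH {g : ℝ → Field} (hg : MemL2 L T s g) :
    MemLp (fun t => toH L s (g t)) 2 (volume.restrict (Ioc 0 T)) := by
  rw [← restrict_Ioo_eq_Ioc]
  have hm := aestronglyMeasurable_toH hL hg.1 hg.2.1
  rw [memLp_two_iff_integrable_sq_norm hm]
  have h1 : Integrable (fun t => (L ^ 3)⁻¹ * sobNorm L s (g t) ^ 2) (volume.restrict (Ioo 0 T)) :=
    Integrable.const_mul hg.2.2 _
  refine h1.congr ?_
  filter_upwards [hg.2.1] with t ht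
  rw [sobNorm_eq hL ht, mul_pow, Real.sq_sqrt (by positivity), ← mul_assoc,
    inv_mul_cancel₀ (by positivity), one_mul]

include hL in
lemma memLp_toH_of_memLinfty {g : ℝ → Field} (hg : MemLinfty L T s g) :
    MemLp (fun t => toH L s (g t)) 2 (volume.restrict (Ioc 0 T)) := by
  rw [← restrict_Ioo_eq_Ioc]
  obtain ⟨M, hM⟩ := hg.2.2
  have hs : 0 < Real.sqrt (L ^ 3) := Real.sqrt_pos.2 (by positivity)
  refine MemLp.of_bound (aestronglyMeasurable_toH hL hg.1 hg.2.1) (M / Real.sqrt (L ^ 3)) ?_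
  filter_upwards [hM, hg.2.1] with t h1 h2
  rw [sobNorm_eq hL h2] at h1
  rw [le_div_iff₀ hs]
  linarith

include hL in
lemma memL2_ofH {y : ℝ → Hsp} (hy : MemLp y 2 (volume.restrict (Ioc 0 T))) {w : ℝ → Field}
    (hw : ∀ᵐ t ∂volume.restrict (Ioc 0 T), w t = ofH L s (y t)) : MemL2 L T s w := by
  rw [← restrict_Ioo_eq_Ioc] at hy hw
  refine ⟨fun K i => ?_, hw.mono fun t ht => ht ▸ ofH_mem hL s (y t), ?_⟩
  · refine AEMeasurable.congr (((measurable_coef hy.1 K i).aemeasurable).const_mul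
      ((lam L K ^ (-(s / 2)) : ℝ) : ℂ)) ?_
    filter_upwards [hw] with t ht
    rw [ht, ofH]
  · have h1 : Integrable (fun t => L ^ 3 * ‖y t‖ ^ 2) (volume.restrict (Ioo 0 T)) :=
      (integrable_norm_sq hy).const_mul _
    refine h1.congr ?_
    filter_upwards [hw] with t ht
    rw [ht, sobNorm_ofH hL, mul_pow, Real.sq_sqrt (by positivity)]

lemma toH_one_of_mem {u : Field} (hu : u ∈ Vdot L 2) : toH L 1 u = Dop hL (toH L 2 u) := by
  rw [← toH_ofH hL 1 (Dop hL (toH L 2 u)), ← ofH_two_eq_ofH_one hL, ofH_toH hL hu]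

lemma coef_Dop_toH_one {u : Field} (hu : u ∈ Vdot L 1) : coef (Dop hL (toH L 1 u)) = u := by
  rw [← ofH_one hL, ofH_toH hL hu]

end TimeDependent

/-! ### The data assimilation system as an evolution equation in `H` -/

section System
variable {L : ℝ} (hL : 0 < L) {T ν β η h c₁ c₂ : ℝ}

/-- The right-hand side `(I + β² A)⁻¹ f + η P I_h u`. -/
def forcing (hh : 0 < h) (hc₁ : 0 < c₁) (hc₂ : 0 < c₂) {Ih : Hdot L 2 →ₗ[ℝ] Hdot L 0}
    (hIh : ApproximationProperty h c₁ c₂ Ih) (β η : ℝ) (f u : ℝ → Field) (t : ℝ) : Hsp :=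
  resolvent hL β (toH L 0 (f t)) + η • interpOp hL hh hc₁ hc₂ hIh (toH L 2 (u t))

variable (hh : 0 < h) (hc₁ : 0 < c₁) (hc₂ : 0 < c₂) {Ih : Hdot L 2 →ₗ[ℝ] Hdot L 0}
  (hIh : ApproximationProperty h c₁ c₂ Ih) {f u : ℝ → Field}

lemma memLp_forcing (hf : MemLinfty L T 0 f) (hu : MemL2 L T 2 u) :
    MemLp (forcing hL hh hc₁ hc₂ hIh β η f u) 2 (volume.restrict (Ioc 0 T)) :=
  ((resolvent hL β).comp_memLp' (memLp_toH_of_memLinfty hL hf)).add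
    (((interpOp hL hh hc₁ hc₂ hIh).comp_memLp' (memLp_toH hL hu)).const_smul η)

/-- A solution of the data assimilation system, in the variables `A^(1/2) w` and `A w`. -/
lemma IsNudgedSolution.evol (hβ : 0 < β) (hf : MemLinfty L T 0 f) (hu : MemL2 L T 2 u)
    {w₀ : Field} {w : ℝ → Field} (hw : IsNudgedSolution L T ν β η Ih f u w₀ w) :
    ∃ q : ℝ → Hsp, (∀ t ∈ Ico 0 T, Evol hL t (fun τ => toH L 1 (w τ)) (fun τ => toH L 2 (w τ)) q) ∧
      ∀ᵐ t ∂volume.restrict (Ioc 0 T), q t = forcing hL hh hc₁ hc₂ hIh β η f u t -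
        ν • toH L 2 (w t) - η • interpOp hL hh hc₁ hc₂ hIh (toH L 2 (w t)) -
        advectOp hL hβ (toH L 2 (w t)) (Dop hL (toH L 2 (w t))) := by
  obtain ⟨hr, z', hz', hzd, heq⟩ := hw
  set q : ℝ → Hsp := fun t => testInv hL hβ (toH L (-2) (z' t)) with hq
  have hqm : MemLp q 2 (volume.restrict (Ioc 0 T)) :=
    (testInv hL hβ).comp_memLp' (memLp_toH hL hz')
  have hwm := memLp_toH hL hr.memL2
  have hw2 : ∀ᵐ t ∂volume.restrict (Ioc 0 T), w t ∈ Vdot L 2 := by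
    rw [← restrict_Ioo_eq_Ioc]
    exact hr.memL2.2.1
  have hzq : ∀ᵐ t ∂volume.restrict (Ioc 0 T), z' t = ofH L (-2) (testOp hL β (q t)) := by
    rw [← restrict_Ioo_eq_Ioc]
    filter_upwards [hz'.2.1] with t ht
    rw [hq]
    simp only
    rw [testOp_testInv, ofH_toH hL ht]
  refine ⟨q, fun t ht => ?_, ?_⟩
  · have ht' : t ∈ Icc 0 T := ⟨ht.1, ht.2.le⟩
    refine ⟨MemLp.restrict_Ioc hwm ht', MemLp.restrict_Ioc hqm ht',
      (ae_restrict_Ioc_mono hw2 ht').mono fun τ hτ => toH_one_of_mem hL hτ, fun τ hτ => ?_⟩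
    have hτT : τ < T := hτ.2.trans_lt ht.2
    have hτ' : τ ∈ Icc 0 T := ⟨hτ.1, hτT.le⟩
    have hT0 : (0 : ℝ) ∈ Ico 0 T := ⟨le_rfl, hτ.1.trans_lt hτT⟩
    have hVτ := (hr.continuous τ ⟨hτ.1, hτT⟩).1
    have hV0 := (hr.continuous 0 hT0).1
    ext K i
    have h1 := hzd 0 τ le_rfl hτ.1 hτT K i
    simp only [helmholtz_apply hVτ.1.1, helmholtz_apply hV0.1.1] at h1
    have h2 : ∫ s in (0 : ℝ)..τ, z' s K i = ((1 + β ^ 2 * lam L K : ℝ) : ℂ) *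
        ∫ s in (0 : ℝ)..τ, coef (q s) K i := by
      rw [← intervalIntegral.integral_const_mul, intervalIntegral.integral_of_le hτ.1,
        intervalIntegral.integral_of_le hτ.1]
      refine integral_congr_ae ?_
      filter_upwards [ae_restrict_Ioc_mono hzq hτ'] with s hs
      rw [hs, ofH_testOp]
    have hne : ((1 + β ^ 2 * lam L K : ℝ) : ℂ) ≠ 0 := by
      have := mul_nonneg (sq_nonneg β) (lam_pos hL K).le
      exact_mod_cast (by linarith : (0 : ℝ) < 1 + β ^ 2 * lam L K).ne'
    rw [h2, ← mul_sub] at h1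
    have h3 := mul_left_cancel₀ hne h1
    have h4 : coef (∫ s in (0 : ℝ)..τ, q s) K i = ∫ s in (0 : ℝ)..τ, coef (q s) K i :=
      ((coefL K i).intervalIntegral_comp_comm (MemLp.intervalIntegrable hqm hτ')).symm
    rw [coef_add, Pi.add_apply, Pi.add_apply, coef_Dop_toH_one hL hVτ, coef_Dop_toH_one hL hV0, h4]
    linear_combination h3
  · have hf0 : ∀ᵐ t ∂volume.restrict (Ioc 0 T), f t ∈ Vdot L 0 := by
      rw [← restrict_Ioo_eq_Ioc]
      exact hf.2.1
    have hu2 : ∀ᵐ t ∂volume.restrict (Ioc 0 T), u t ∈ Vdot L 2 := by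
      rw [← restrict_Ioo_eq_Ioc]
      exact hu.2.1
    rw [restrict_Ioo_eq_Ioc] at heq
    filter_upwards [heq, hw2, hzq, hf0, hu2] with t h1 h2 h3 h4 h5
    refine (equation_iff hL hβ hh hc₁ hc₂ hIh _ _ _ _).1 ?_
    rw [ofH_toH hL h2, ofH_toH hL h4, ofH_toH hL h5, ← h3]
    exact h1

/-- Conversely, curves in `H` that solve the evolution equation give solutions of the system. -/
lemma Evol.isNudgedSolution (hβ : 0 < β) (hf : MemLinfty L T 0 f) (hu : MemL2 L T 2 u) {w₀ : Field}
    (hw₀ : w₀ ∈ Vdot L 1) {x y q : ℝ → Hsp} (hE : Evol hL T x y q) (hx0 : x 0 = toH L 1 w₀)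
    (hq : ∀ᵐ t ∂volume.restrict (Ioc 0 T), q t = forcing hL hh hc₁ hc₂ hIh β η f u t - ν • y t -
      η • interpOp hL hh hc₁ hc₂ hIh (y t) - advectOp hL hβ (y t) (Dop hL (y t))) :
    IsNudgedSolution L T ν β η Ih f u w₀ fun t => ofH L 1 (x t) := by
  have hxy : ∀ᵐ t ∂volume.restrict (Ioc 0 T), ofH L 1 (x t) = ofH L 2 (y t) :=
    hE.ae_eq.mono fun t ht => by rw [ht, ofH_two_eq_ofH_one hL]
  have hcoef : ∀ s t, 0 ≤ s → s ≤ t → t < T → ∀ K i,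
      ofH L 1 (x t) K i - ofH L 1 (x s) K i = ∫ τ in s..t, coef (q τ) K i := by
    intro s t hs hst ht K i
    have ht' : t ∈ Icc 0 T := ⟨hs.trans hst, ht.le⟩
    have hs' : s ∈ Icc 0 T := ⟨hs, hst.trans ht.le⟩
    have hi := memLp_coef hE.memLp_deriv K i
    rw [ofH_one hL, ofH_one hL, hE.coef_eq_integral K i ht', hE.coef_eq_integral K i hs',
      ← intervalIntegral.integral_interval_sub_left (MemLp.intervalIntegrable hi ht')
        (MemLp.intervalIntegrable hi hs')]
    ring
  refine ⟨⟨fun t ht => ⟨ofH_mem hL 1 _, ?_⟩, memL2_ofH hL hE.memLp hxy,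
    ⟨fun t => coef (q t), memL2_ofH hL hE.memLp_deriv
      (Eventually.of_forall fun t => (ofH_zero _).symm), hcoef⟩, ?_⟩,
    fun t => ofH L (-2) (testOp hL β (q t)),
    memL2_ofH hL ((testOp hL β).comp_memLp' hE.memLp_deriv) (Eventually.of_forall fun t => rfl),
    fun s t hs hst ht K i => ?_, ?_⟩
  · have h1 := (hE.continuousOn t ⟨ht.1, ht.2.le⟩).mono Ico_subset_Icc_self
    have h2 := (tendsto_iff_norm_sub_tendsto_zero.1 h1).const_mul (Real.sqrt (L ^ 3))
    rw [mul_zero] at h2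
    refine h2.congr fun τ => ?_
    rw [← ofH_sub, sobNorm_ofH hL]
  · rw [hx0, ofH_toH hL hw₀]
  · simp only [helmholtz_apply (ofH_apply_zero hL 1 _), ofH_testOp]
    rw [← mul_sub, hcoef s t hs hst ht K i, intervalIntegral.integral_const_mul]
  · have hf0 : ∀ᵐ t ∂volume.restrict (Ioc 0 T), f t ∈ Vdot L 0 := by
      rw [← restrict_Ioo_eq_Ioc]
      exact hf.2.1
    have hu2 : ∀ᵐ t ∂volume.restrict (Ioc 0 T), u t ∈ Vdot L 2 := by
      rw [← restrict_Ioo_eq_Ioc]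
      exact hu.2.1
    rw [restrict_Ioo_eq_Ioc]
    filter_upwards [hxy, hq, hf0, hu2] with t h1 h2 h3 h4
    have h5 := (equation_iff hL (ν := ν) (η := η) hβ hh hc₁ hc₂ hIh (y t) (q t) (toH L 2 (u t))
      (toH L 0 (f t))).2 h2
    rw [ofH_toH hL h3, ofH_toH hL h4] at h5
    rw [h1]
    exact h5

/-- Continuous dependence on the initial value, which contains uniqueness. -/
lemma IsNudgedSolution.stability (hν : 0 < ν) (hβ : 0 < β) (hη : 0 ≤ η) (hh : 0 < h) (hc₁ : 0 < c₁)
    (hc₂ : 0 < c₂) (hIh : ApproximationProperty h c₁ c₂ Ih) (hη₂ : η * (c₂ * h ^ 2) ≤ ν / 2)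
    (hL : 0 < L) (hf : MemLinfty L T 0 f) (hu : MemL2 L T 2 u) {w₀ : Field} {w : ℝ → Field}
    (hw : IsNudgedSolution L T ν β η Ih f u w₀ w) :
    ∃ C : ℝ, ∀ (w₀' : Field) (w' : ℝ → Field), IsNudgedSolution L T ν β η Ih f u w₀' w' →
      ∀ t ∈ Ico 0 T, sobNorm L 1 (w' t - w t) ≤ C * sobNorm L 1 (w₀' - w₀) := by
  obtain ⟨q, hE, hq⟩ := hw.evol hL hh hc₁ hc₂ hIh hβ hf hu
  obtain ⟨N, hN⟩ := exists_isAdvection hL hβ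
  have hJ := isInterpolation_interpOp hL hh hc₁ hc₂ hIh
  set k : ℝ → ℝ := fun τ => (N ^ 2 / (ν * β ^ 2 / 4) * ‖toH L 2 (w τ)‖ ^ 2 +
    2 * coerConst L ν β η (c₁ * h) (c₂ * h ^ 2)) / β ^ 2 with hk
  set E := (normD L ^ 2 + β ^ 2) * Real.exp (∫ τ in Ioc 0 T, k τ) / β ^ 2 with hEd
  have hE0 : 0 ≤ E := by positivity
  have hki : IntegrableOn k (Ioc 0 T) :=
    (((integrable_norm_sq (memLp_toH hL hw.1.memL2)).const_mul _).add
      (integrable_const _)).div_const _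
  have hk0 : ∀ τ, 0 ≤ k τ := fun τ => by
    have := normD_pos hL
    simp only [hk, coerConst]
    positivity
  refine ⟨Real.sqrt E, fun w₀' w' hw' t ht => ?_⟩
  obtain ⟨q', hE', hq'⟩ := hw'.evol hL hh hc₁ hc₂ hIh hβ hf hu
  have ht' : t ∈ Icc 0 T := ⟨ht.1, ht.2.le⟩
  have hT0 : (0 : ℝ) ∈ Ico 0 T := ⟨le_rfl, ht.1.trans_lt ht.2⟩
  have h1 := (hE t ht).stability hL hν hβ hη (by positivity) hJ hη₂ hN (hE' t ht)
    (ae_restrict_Ioc_mono hq ht') (ae_restrict_Ioc_mono hq' ht') (right_mem_Icc.2 ht.1)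
  have hmem : ∀ {v₀ : Field} {v : ℝ → Field}, IsNudgedSolution L T ν β η Ih f u v₀ v →
      ∀ τ ∈ Ico 0 T, v τ ∈ Vdot L 1 := fun hv τ hτ => (hv.1.continuous τ hτ).1
  have h2 : ∫ τ in Ioc 0 t, k τ ≤ ∫ τ in Ioc 0 T, k τ :=
    setIntegral_mono_set hki (Eventually.of_forall hk0) (Ioc_subset_Ioc_right ht.2.le).eventuallyLE
  have h3 : ‖toH L 1 (w' t) - toH L 1 (w t)‖ ^ 2 ≤
      E * ‖toH L 1 (w' 0) - toH L 1 (w 0)‖ ^ 2 := by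
    refine le_of_mul_le_mul_left ?_ (by positivity : 0 < β ^ 2)
    have h4 := mul_le_mul_of_nonneg_left (Real.exp_le_exp.2 h2)
      (by positivity : 0 ≤ (normD L ^ 2 + β ^ 2) * ‖toH L 1 (w' 0) - toH L 1 (w 0)‖ ^ 2)
    refine (h1.trans h4).trans_eq ?_
    rw [hEd]
    field_simp
  rw [← hw.1.initial, ← hw'.1.initial,
    sobNorm_eq hL (Submodule.sub_mem _ (hmem hw' t ht) (hmem hw t ht)),
    sobNorm_eq hL (Submodule.sub_mem _ (hmem hw' 0 hT0) (hmem hw 0 hT0)),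
    toH_sub hL (hmem hw' t ht) (hmem hw t ht), toH_sub hL (hmem hw' 0 hT0) (hmem hw 0 hT0)]
  have h5 : ‖toH L 1 (w' t) - toH L 1 (w t)‖ ≤
      Real.sqrt E * ‖toH L 1 (w' 0) - toH L 1 (w 0)‖ := by
    refine (sq_le_sq₀ (norm_nonneg _) (by positivity)).1 ?_
    rw [mul_pow, Real.sq_sqrt hE0]
    exact h3
  have h6 := mul_le_mul_of_nonneg_left h5 (Real.sqrt_nonneg (L ^ 3))
  linarith

lemma eq_of_sobNorm_sub_le_zero (hL : 0 < L) {s : ℝ} {v v' : Field} (hv : v ∈ Vdot L s)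
    (hv' : v' ∈ Vdot L s) (h : sobNorm L s (v' - v) ≤ 0) : v' = v := by
  have hm := Submodule.sub_mem _ hv' hv
  have hs : 0 < Real.sqrt (L ^ 3) := Real.sqrt_pos.2 (by positivity)
  rw [sobNorm_eq hL hm] at h
  have h1 : toH L s (v' - v) = 0 := by
    rw [← norm_le_zero_iff]
    exact nonpos_of_mul_nonpos_right h hs
  have h2 := ofH_toH hL hm
  rw [h1] at h2
  rw [← sub_eq_zero, ← h2]
  funext K i
  simp [ofH]

end System

end MLAlpha

end

theorem theorem3p1 (L T ν α β η h c₁ c₂ : ℝ) (hL : 0 < L) (hT : 0 < T) (hν : 0 < ν) (hα : 0 < α)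
    (hβ : 0 < β) (hη : 0 < η) (hh : 0 < h) (hc₁ : 0 < c₁) (hc₂ : 0 < c₂)
    (Ih : MLAlpha.Hdot L 2 →ₗ[ℝ] MLAlpha.Hdot L 0)
    (hIh : MLAlpha.ApproximationProperty h c₁ c₂ Ih)
    (hη₁ : η ≤ ν / 2 * min (1 / (c₁ ^ 2 * h ^ 2)) (β ^ 2 / (c₂ ^ 2 * h ^ 4)))
    (hη₂ : η ^ 2 * c₂ ^ 2 * h ^ 4 < ν ^ 2 / 4)
    (f : ℝ → MLAlpha.Field) (hf : MLAlpha.MemLinfty L T 0 f)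
    (u₀ : MLAlpha.Field) (hu₀ : u₀ ∈ MLAlpha.Vdot L 1)
    (u : ℝ → MLAlpha.Field) (hu : MLAlpha.IsMLAlphaSolution L T ν α f u₀ u) :
    ∀ w₀ ∈ MLAlpha.Vdot L 1,
      (∃ w : ℝ → MLAlpha.Field, MLAlpha.IsNudgedSolution L T ν β η Ih f u w₀ w ∧
        ∀ w' : ℝ → MLAlpha.Field, MLAlpha.IsNudgedSolution L T ν β η Ih f u w₀ w' →
          ∀ t ∈ Set.Ico 0 T, w' t = w t) ∧
      (∀ w : ℝ → MLAlpha.Field, MLAlpha.IsNudgedSolution L T ν β η Ih f u w₀ w →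
        ∃ C : ℝ, ∀ w₀' ∈ MLAlpha.Vdot L 1, ∀ w' : ℝ → MLAlpha.Field,
          MLAlpha.IsNudgedSolution L T ν β η Ih f u w₀' w' →
          ∀ t ∈ Set.Ico 0 T,
            MLAlpha.sobNorm L 1 (w' t - w t) ≤ C * MLAlpha.sobNorm L 1 (w₀' - w₀)) := by
  intro w₀ hw₀
  have hu2 : MLAlpha.MemL2 L T 2 u := hu.1.memL2
  have hηb : η * (c₂ * h ^ 2) ≤ ν / 2 := by
    refine (sq_le_sq₀ (by positivity) (by positivity)).1 ?_
    linarith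
  constructor
  · obtain ⟨C, hN⟩ := MLAlpha.exists_isAdvection hL hβ
    obtain ⟨x, y, q, hE, hx0, hq⟩ := MLAlpha.exists_evol hL hT.le hν hβ hη.le (by positivity)
      (MLAlpha.isInterpolation_interpOp hL hh hc₁ hc₂ hIh) hηb hN
      (MLAlpha.memLp_forcing hL (β := β) (η := η) hh hc₁ hc₂ hIh hf hu2) (MLAlpha.toH L 1 w₀)
    have hw := hE.isNudgedSolution hL hh hc₁ hc₂ hIh hβ hf hu2 hw₀ hx0 hq
    refine ⟨_, hw, fun w' hw' t ht => ?_⟩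
    obtain ⟨C', hC'⟩ := hw.stability hν hβ hη.le hh hc₁ hc₂ hIh hηb hL hf hu2
    refine MLAlpha.eq_of_sobNorm_sub_le_zero hL (hw.1.continuous t ht).1 (hw'.1.continuous t ht).1
      ((hC' w₀ w' hw' t ht).trans_eq ?_)
    simp [MLAlpha.sobNorm, MLAlpha.sobTerm]
  · intro w hw
    obtain ⟨C, hC⟩ := hw.stability hν hβ hη.le hh hc₁ hc₂ hIh hηb hL hf hu2
    exact ⟨C, fun w₀' _ w' hw' => hC w₀' w' hw'⟩
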